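/- Write a permutation of $\{1,\dots,n\}$ as a word $a_1\dots a_n$; $S_n(p)$ is the set of permutations of length $n$ avoiding the pattern $p$. Let $r$ (reverse), $c$ (complement) and $i$ (inverse) be the usual maps on permutations; the *trivial bijections* are the compositions of $r,c,i$. Dyck paths are words in $u,d$; the *reflection* of a path reads it backwards and interchanges $u$ and $d$. The *standard bijection* $f$ from $S_n(132)$ to Dyck paths is given by $f(\epsilon)=\epsilon$, $f(\pi_L\,n\,\pi_R)=u f(\pi_L)\,d f(\pi_R)$. Consider the following ten bijections (for all $n$ at once). * $\Phi$, $S_n(231)\to S_n(321)$: $\Phi(\epsilon)=\epsilon$, $\Phi(\alpha(\sigma))=\beta(\Phi(\sigma))$, $\Phi(\sigma\oplus\tau)=\Phi(\tau)\oplus\Phi(\sigma)$. Here $\oplus$ is the direct sum, $\alpha$ prepends a new largest letter, and $\beta(\epsilon)=1$; for nonempty $\pi$, to form $\beta(\pi)$ box the left-to-right maxima of $\pi$ that are to the right of $1$ and are not right-to-left minima, insert a new largest letter, boxed, immediately to the left of $1$, and shift the boxed letters cyclically one step to the left. * $\mathrm{Knuth}$, $S_n(321)\to S_n(132)$: let $(P,Q)$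 be the Robinson–Schensted pair of $\pi$; let $A$ have $j$-th step $u$ if $j$ is in the first row of $P$ and $d$ otherwise, let $B$ have $j$-th step $d$ if $j$ is in the first row of $Q$ and $u$ otherwise, and let $B^r$ be the word $B$ read backwards. Then $\pi\mapsto\sigma$ if $AB^r$ is the reflection of $f(\sigma)$. * $\mathrm{KnuthRotem}$, $S_n(321)\to S_n(132)$: let $b_1=0$ and, for $j\ge2$, $b_j=b_{j-1}$ if $p_j$ is a left-to-right maximum of $\pi=p_1\dots p_n$, $b_j=p_j$ otherwise. The lattice path from $(0,0)$ to $(n,n)$ whose $j$-th east step is at height $b_j$, traversed from $(n,n)$ to $(0,0)$ with vertical steps read as $u$ and horizontal ones as $d$, is a Dyck path $P$; then $\pi\mapsto f^{-1}(P)$. * $\mathrm{SimionSchmidt}$, $S_n(123)\to S_n(132)$: $a_1\dots a_n\mapsto c_1\dots c_n$, where $c_j=a_j$ if $a_j$ is a left-to-right minimum, and otherwise $c_j$ is the smallest letter not among $c_1,\dots,c_{j-1}$ that is larger than $\min(a_1,\dots,a_j)$. * $\mathrm{KnuthRichards}$, $S_n(132)\to S_n(123)$: $f$ followed by Richards' algorithm,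 which scans the down-steps $d_1,\dots,d_n$ of the path from left to right: if $d_j$ directly follows the $k$-th up-step, put $a_{n+1-k}=j$; otherwise put $a_k=j$ for the largest $k$ with $a_k$ unset. The result is $a_1\dots a_n$. * $\mathrm{West}$, $S_n(123)\to S_n(132)$: a site of a $p$-avoiding permutation (one of the places where a new largest letter can be inserted) is active if the insertion yields a $p$-avoiding permutation. The signature of $\pi$ of length $n$ is the sequence, for $j=0,\dots,n-1$, of the numbers of active sites of $\pi$ without its $j$ largest letters. Then $\pi\mapsto\sigma$ if the signature of $\pi$ (for $p=123$) equals that of $\sigma$ (for $p=132$). * $\mathrm{Krattenthaler}$, $S_n(123)\to S_n(132)$: write $\pi=w_sm_s\dots w_1m_1$ with $m_1,\dots,m_s$ the right-to-left maxima, and let $m_0=0$. To $\pi$ corresponds the reflection of $u^{m_1-m_0}d^{|w_1|+1}u^{m_2-m_1}d^{|w_2|+1}\cdots$. To $\sigma=p_1\dots p_n\in S_n(132)$ corresponds the path obtained by adjoining, for $j=1,\dots,n$, up-steps to reach height $h_j+1$ and then a down-step, where $h_j$ is the number of letters larger than $p_j$ to its right. Permutations with the same path correspond to each other. * $\mathrm{Reifegerste}$,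 $S_n(321)\to S_n(132)$: call $(j,n+1-a_j)$ with $a_j>j$ an $E$-square of $\pi=a_1\dots a_n$, and shade every square $(a,b)$ of the $n\times n$ matrix for which no $E$-square $(j,k)$ has $j\ge a$, $k\ge b$. Row by row from the first, place a dot in the leftmost shaded square whose column is free. The image sends $a$ to $b$ if $(a,b)$ has a dot. * $\mathrm{ElizaldeDeutsch}=\varphi^{-1}\circ\Psi^{-1}\circ\psi$, $S_n(321)\to S_n(132)$: $\varphi$ is $f$ followed by reflection. $\psi(\pi)$ is read off (down as $u$, right as $d$) from the path of down- and right-steps from the upper-left to the lower-right corner of the $n\times n$ array with crosses in the squares $(j,\pi(j))$ that leaves all crosses to its right and is as close to the diagonal as possible. $\Psi(P)$ is obtained by reading the steps of $P$ in the order $1,2n,2,2n-1,\dots$ and writing $u$ or $d$ according to whether the matching step has not or has been read before. * $\mathrm{MansourDengDu}$, $S_n(321)\to S_n(231)$: it maps $(12\dots n)\sigma$ to $(12\dots n)\tau$, where $\sigma$ and $\tau$ are the zigzag and the trapezoidal decomposition of the same Dyck path of semilength $n$, and the simple transposition $s_k$ interchanges the letters in positions $k$ and $k+1$ (products act from left to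 right). A cell $(x,y)$ is the unit diamond with leftmost corner $(x,y)$ and rightmost corner $(x+2,y)$, lying between the $x$-axis and the path; it is essential if $(x-1,y-1)$ and $(x,y)$ are the starting points of two consecutive up-steps of the path, and the step from $(x-1,y-1)$ to $(x,y)$ is then its left arm. Both decompositions are empty if there is no essential cell. Otherwise: *(zigzag)* let the strip be the set of cells, from the rightmost essential cell on to the right, that have an edge on the path; if the labels $(x+y)/2$ of its cells are $a,a+1,\dots,b$, the decomposition is that of the path obtained by deleting the strip, followed by $s_bs_{b-1}\cdots s_a$. *(trapezoidal)* Write the path as $Q_1\,u\,Q_2\,d\,R$ with $u$ the left arm of the rightmost essential cell that touches the axis and $d$ the down-step matching $u$ (so $R=ud\cdots ud$); if the cells that touch the axis under $uQ_2d$ have the labels $(x-y+2)/2=a,\dots,b$, the decomposition is that of $Q_1$, then that of $Q_2$ (above its own base line, with the labels inherited from the whole path), then $s_bs_{b-1}\cdots s_a$. **Theorem.** (a) The following relations hold: $$r\circ\Phi^{-1}=i\circ\mathrm{SimionSchmidt}\circ r=i\circ\mathrm{Krattenthaler}\circ r\circ i=i\circ r\circ\mathrm{MansourDengDu}=\mathrm{KnuthRichards}^{-1}\circ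 r$$ and $$\mathrm{Reifegerste}=i\circ\mathrm{KnuthRotem}\circ i .$$ (b) Apart from self-symmetries there are no other relations among these bijections and their inverses via the trivial bijections. Precisely, let $B,B'$ be any of the ten bijections, $\varepsilon,\varepsilon'\in\{1,-1\}$, and $s,t,s',t'$ trivial bijections such that $t\circ B^{\varepsilon}\circ s=t'\circ B'^{\varepsilon'}\circ s'$ as maps on permutations of all lengths (same domain, same values). Then this relation follows from those in (a), together with whichever of the three relations $i\circ\mathrm{SimionSchmidt}\circ i=\mathrm{SimionSchmidt}$, $i\circ\mathrm{Knuth}\circ i=\mathrm{Knuth}$, $i\circ\mathrm{KnuthRotem}\circ i\circ r\circ c=\mathrm{KnuthRotem}$ of a bijection with itself are valid, by equational reasoning, composition with trivial bijections on either side, passing to inverses, and replacing composites of $r,c,i$ by equal ones. -/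

import Mathlib

namespace PermBij

/-! ### Permutations as words, patterns, trivial bijections -/

/-- A permutation of length `n` is written as the word `a₁ a₂ … aₙ` of its values. -/
abbrev Word := List ℕ

/-- `w` is a permutation of `{1, …, n}`, where `n` is the length of `w`. -/
def IsPerm (w : Word) : Prop := w.Perm (List.range' 1 w.length)

instance (w : Word) : Decidable (IsPerm w) := by
  unfold IsPerm
  infer_instance

/-- `u` and `p` have the same length and their letters are in the same relative order. -/
def OrderIso (u p : Word) : Prop :=
  u.length = p.length ∧
    ∀ i < p.length, ∀ j < p.length, (u.getD i 0 < u.getD j 0 ↔ p.getD i 0 < p.getD j 0)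

instance (u p : Word) : Decidable (OrderIso u p) := by
  unfold OrderIso
  infer_instance

/-- No subword of `w` is an occurrence of the pattern `p`. -/
def Avoids (p w : Word) : Prop := ∀ u ∈ w.sublists, ¬ OrderIso u p

instance (p w : Word) : Decidable (Avoids p w) := by
  unfold Avoids
  infer_instance

/-- The `p`-avoiding permutations, of all lengths. -/
def Av (p : Word) : Set Word := {w | IsPerm w ∧ Avoids p w}

def complement (w : Word) : Word := w.map fun x => w.length + 1 - x

def inverse (w : Word) : Word := (List.range' 1 w.length).map fun v => w.idxOf v + 1

/-- The generators of the group of trivial bijections: reverse, complement, inverse. -/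
inductive Sym where
  | r | c | i

def Sym.act : Sym → Word → Word
  | .r => List.reverse
  | .c => complement
  | .i => inverse

/-- The trivial bijection `s₁ ∘ s₂ ∘ … ∘ sₖ`. -/
def act (s : List Sym) (w : Word) : Word := s.foldr Sym.act w

/-! ### Lattice paths and the standard bijection -/

/-- A path with up-steps `U` and down-steps `D`. -/
abbrev Path := List DyckStep

def swapStep : DyckStep → DyckStep
  | .U => .D
  | .D => .U

/-- Reflection of a path in a vertical line. -/
def reflect (P : Path) : Path := P.reverse.map swapStep

/-- Helper for `stdPath`; the first argument is an upper bound for the length of the word. -/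
def stdPathAux : ℕ → Word → Path
  | 0, _ => []
  | _ + 1, [] => []
  | k + 1, a :: v =>
    let w := a :: v
    let m := w.foldr max 0
    (.U :: stdPathAux k (w.takeWhile (· ≠ m))) ++
      (.D :: stdPathAux k (w.dropWhile (· ≠ m)).tail)

/-- The standard bijection `f` from 132-avoiding permutations to Dyck paths:
`f(π_L n π_R) = u f(π_L) d f(π_R)`, where `n` is the largest letter. -/
def stdPath (w : Word) : Path := stdPathAux w.length w

/-! ### Knuth -/

/-- The two rows of the insertion tableau (`p1`, `p2`) and of the recording tableau
(`q1`, `q2`). -/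
structure Tableaux where
  p1 : Word
  p2 : Word
  q1 : Word
  q2 : Word

/-- Step `i` of row insertion: insert the letter `a`. -/
def Tableaux.insert (t : Tableaux) (i a : ℕ) : Tableaux :=
  if ∀ x ∈ t.p1, x < a then
    { t with p1 := t.p1 ++ [a], q1 := t.q1 ++ [i] }
  else
    let m := (t.p1.find? (a < ·)).getD 0
    { t with
      p1 := t.p1.map (fun x => if x = m then a else x)
      p2 := t.p2 ++ [m]
      q2 := t.q2 ++ [i] }

def rskAux (t : Tableaux) (i : ℕ) : Word → Tableaux
  | [] => t
  | a :: w => rskAux (t.insert i a) (i + 1) w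

/-- The Robinson–Schensted–Knuth correspondence on permutations with tableaux of at most
two rows. -/
def rsk (w : Word) : Tableaux := rskAux ⟨[], [], [], []⟩ 1 w

/-- Knuth's path `A Bʳ` of a 321-avoiding permutation. -/
def knuthPath (w : Word) : Path :=
  let t := rsk w
  let A : Path := (List.range' 1 w.length).map fun i => if i ∈ t.p1 then .U else .D
  let B : Path := (List.range' 1 w.length).map fun i => if i ∈ t.q1 then .D else .U
  A ++ B.reverse

/-- Knuth: the standard path is reflected before the comparison. -/
def KnuthGraph (π σ : Word) : Prop :=
  π ∈ Av [3, 2, 1] ∧ σ ∈ Av [1, 3, 2] ∧ knuthPath π = reflect (stdPath σ)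

/-! ### Knuth–Rotem -/

/-- `mx` is the largest letter and `b` the last entry of the ballot-sequence so far. -/
def ballotAux (mx b : ℕ) : Word → List ℕ
  | [] => []
  | p :: w => if mx < p then b :: ballotAux p b w else p :: ballotAux mx p w

/-- The ballot-sequence: `bᵢ = bᵢ₋₁` if `pᵢ` is a left-to-right maximum, `bᵢ = pᵢ` otherwise. -/
def ballot (w : Word) : List ℕ := ballotAux 0 0 w

/-- The lattice path from `(0, 0)` to `(n, n)` below which the bars of heights `b₁, …, bₙ` lie,
with north steps coded as `U` and east steps as `D`; `h` is the current height. -/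
def barPath (n h : ℕ) : List ℕ → Path
  | [] => List.replicate (n - h) .U
  | b :: bs => List.replicate (b - h) .U ++ .D :: barPath n b bs

/-- After rotation by `3π/4` the lattice path is traversed from `(n, n)` to `(0, 0)`, and its
north and east steps become up- and down-steps. -/
def rotemPath (w : Word) : Path := (barPath w.length 0 (ballot w)).reverse

def KnuthRotemGraph (π σ : Word) : Prop :=
  π ∈ Av [3, 2, 1] ∧ σ ∈ Av [1, 3, 2] ∧ rotemPath π = stdPath σ

/-! ### Simion–Schmidt -/

/-- The loop: `n` is the length of the permutation, `x` the smallest letter read so far,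
`used` the letters written so far. -/
def simionSchmidtAux (n x : ℕ) (used : List ℕ) : Word → Word
  | [] => []
  | a :: w =>
    if a < x then a :: simionSchmidtAux n a (a :: used) w
    else
      let c := ((List.range' (x + 1) (n - x)).find? (· ∉ used)).getD 0
      c :: simionSchmidtAux n x (c :: used) w

def simionSchmidt : Word → Word
  | [] => []
  | a :: w => a :: simionSchmidtAux (w.length + 1) a [a] w

def SimionSchmidtGraph (π σ : Word) : Prop := π ∈ Av [1, 2, 3] ∧ σ = simionSchmidt π

/-! ### Knuth–Richards -/

/-- The largest `k < r` such that `aₖ` is unset (unset values are `0`). -/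
def nextUnset (a : ℕ → ℕ) : ℕ → ℕ
  | 0 => 0
  | r + 1 => if a r = 0 then r else nextUnset a r

/-- The loop of Richards' algorithm, reading the path step by step: `i`, `r`, `s` are the
variables of the algorithm, and `afterUp` tells whether the previous step is an up-step. -/
def richardsAux (i r s : ℕ) (a : ℕ → ℕ) (afterUp : Bool) : Path → (ℕ → ℕ)
  | [] => a
  | .U :: P => richardsAux i r (s - 1) a true P
  | .D :: P =>
    if afterUp then richardsAux (i + 1) r s (Function.update a s i) false P
    else
      let k := nextUnset a r
      richardsAux (i + 1) k s (Function.update a k i) false P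

/-- Richards' algorithm from Dyck paths to 123-avoiding permutations. -/
def richards (P : Path) : Word :=
  let n := P.length / 2
  (List.range' 1 n).map (richardsAux 1 (n + 1) (n + 1) (fun _ => 0) false P)

def KnuthRichardsGraph (π σ : Word) : Prop := π ∈ Av [1, 3, 2] ∧ σ = richards (stdPath π)

/-! ### West -/

/-- The number of active sites of `w` with respect to the pattern `p`. -/
def activeSites (p w : Word) : ℕ :=
  ((List.range (w.length + 1)).filter
    fun i => Avoids p (w.insertIdx i (w.length + 1))).length

/-- The signature: entry `i` is the number of active sites after removal of the `i` largest
letters, `0 ≤ i < n`. -/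
def signature (p w : Word) : List ℕ :=
  (List.range w.length).map fun i => activeSites p (w.filter (· ≤ w.length - i))

def WestGraph (π σ : Word) : Prop :=
  π ∈ Av [1, 2, 3] ∧ σ ∈ Av [1, 3, 2] ∧ signature [1, 2, 3] π = signature [1, 3, 2] σ

/-! ### Krattenthaler -/

/-- Reads a permutation from right to left (so the argument is the reversed word): a
right-to-left maximum `x` with preceding maximum `m` gives `x - m` up-steps; these are followed
by one down-step for the maximum and one for each letter up to the next maximum. -/
def krattenthalerAux (m : ℕ) : Word → Path
  | [] => []
  | x :: w => List.replicate (x - m) .U ++ .D :: krattenthalerAux (max m x) w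

/-- Krattenthaler's path of a 123-avoiding permutation. -/
def krattenthalerPath (w : Word) : Path := reflect (krattenthalerAux 0 w.reverse)

/-- Reads a permutation from left to right, `h` being the height reached: a letter with `k`
larger letters to its right gives up-steps to height `k + 1` and a down-step to height `k`. -/
def heightPathAux (h : ℕ) : Word → Path
  | [] => []
  | x :: w =>
    let k := w.countP (x < ·)
    List.replicate (k + 1 - h) .U ++ .D :: heightPathAux k w

/-- Krattenthaler's path of a 132-avoiding permutation. -/
def heightPath (w : Word) : Path := heightPathAux 0 w

def KrattenthalerGraph (π σ : Word) : Prop :=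
  π ∈ Av [1, 2, 3] ∧ σ ∈ Av [1, 3, 2] ∧ krattenthalerPath π = heightPath σ

/-! ### Reifegerste -/

/-- The square in row `a` and column `b` is shaded: there is no excedance `i` of `w` whose
square `(i, n + 1 - aᵢ)` satisfies `i ≥ a` and `n + 1 - aᵢ ≥ b`. -/
def Shaded (w : Word) (a b : ℕ) : Prop :=
  ¬ ∃ i ∈ List.range' 1 w.length,
    i < w.getD (i - 1) 0 ∧ a ≤ i ∧ b ≤ w.length + 1 - w.getD (i - 1) 0

instance (w : Word) (a b : ℕ) : Decidable (Shaded w a b) := by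
  unfold Shaded
  infer_instance

/-- Row by row, the column of the leftmost shaded square in an unused column. -/
def reifegerste (w : Word) : Word :=
  (List.range' 1 w.length).foldl
    (fun cols a =>
      cols ++ [((List.range' 1 w.length).find? fun b => b ∉ cols ∧ Shaded w a b).getD 0])
    []

def ReifegersteGraph (π σ : Word) : Prop := π ∈ Av [3, 2, 1] ∧ σ = reifegerste π

/-! ### Elizalde–Deutsch -/

/-- The boundary path in the array of a permutation of length `n`; down-steps of the boundary
are coded as `U`, right-steps as `D`, and `x` is the current abscissa. The path that leaves all
crosses to its right and is as close to the diagonal as possible crosses each row at the abscissa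
`y`, where `y + 1` is the least column of a cross in this row or a lower one. -/
def diagonalPathAux (n x : ℕ) : Word → Path
  | [] => List.replicate (n - x) .D
  | p :: w =>
    let y := w.foldr min p - 1
    List.replicate (y - x) .D ++ .U :: diagonalPathAux n y w

/-- The bijection `ψ` from 321-avoiding permutations to Dyck paths. -/
def diagonalPath (w : Word) : Path := diagonalPathAux w.length 0 w

/-- The path is a Dyck path (see `DyckWord`), as a decidable property. -/
def IsDyck (P : Path) : Prop :=
  P.count .U = P.count .D ∧ ∀ i ≤ P.length, (P.take i).count .D ≤ (P.take i).count .U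

instance (P : Path) : Decidable (IsDyck P) := by
  unfold IsDyck
  infer_instance

/-- The `a`-th step of `P` is an up-step whose corresponding down-step is the `b`-th step. -/
def Matched (P : Path) (a b : ℕ) : Prop :=
  a < b ∧ P[a - 1]? = some .U ∧ P[b - 1]? = some .D ∧ IsDyck ((P.take (b - 1)).drop a)

instance (P : Path) (a b : ℕ) : Decidable (Matched P a b) := by
  unfold Matched
  infer_instance

/-- The order `1, 2n, 2, 2n - 1, …` in which the `N = 2n` steps of a path are read. -/
def zigzagOrder (N i : ℕ) : ℕ := if i % 2 = 1 then (i + 1) / 2 else N + 1 - i / 2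

/-- The step matching the `i`-th step read has been read before. -/
def MatchRead (P : Path) (i : ℕ) : Prop :=
  ∃ k ∈ List.range' 1 (i - 1),
    Matched P (zigzagOrder P.length k) (zigzagOrder P.length i) ∨
    Matched P (zigzagOrder P.length i) (zigzagOrder P.length k)

instance (P : Path) (i : ℕ) : Decidable (MatchRead P i) := by
  unfold MatchRead
  infer_instance

/-- The automorphism `Ψ` of the Dyck paths. -/
def elizaldeDeutschPsi (P : Path) : Path :=
  (List.range' 1 P.length).map fun i => if MatchRead P i then .D else .U

/-- The bijection `φ⁻¹ ∘ Ψ⁻¹ ∘ ψ`, with `φ` the reflected standard bijection. -/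
def ElizaldeDeutschGraph (π σ : Word) : Prop :=
  π ∈ Av [3, 2, 1] ∧ σ ∈ Av [1, 3, 2] ∧
    elizaldeDeutschPsi (reflect (stdPath σ)) = diagonalPath π

/-! ### Mansour–Deng–Du -/

/-- The height of the path after `x` steps. -/
def height (P : Path) (x : ℕ) : ℕ := (P.take x).count .U - (P.take x).count .D

/-- The cells in the region enclosed by a Dyck path and the `x`-axis; `(i, j)` stands for the cell
with the corners `(i, j)`, `(i + 1, j - 1)`, `(i + 2, j)`, `(i + 1, j + 1)`. -/
def cells (P : DyckWord) : Set (ℕ × ℕ) :=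
  {c | 1 ≤ c.2 ∧ Even (c.1 + c.2) ∧ c.2 + 1 ≤ height P.toList (c.1 + 1)}

/-- The essential cells: `(i, j)` such that `(i - 1, j - 1)` and `(i, j)` are the starting points
of two consecutive up-steps. -/
def essentialCells (P : DyckWord) : Set (ℕ × ℕ) :=
  {c | 1 ≤ c.1 ∧ P.toList[c.1 - 1]? = some .U ∧ P.toList[c.1]? = some .U ∧
    c.2 = height P.toList c.1}

/-- The border strip that begins at the cell `e`: the cells that are not to the left of `e` and
have an edge on the path. -/
def zigzagStrip (P : DyckWord) (e : ℕ × ℕ) : Set (ℕ × ℕ) :=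
  {c ∈ cells P | e.1 ≤ c.1 ∧ height P.toList (c.1 + 1) = c.2 + 1 ∧
    (height P.toList c.1 = c.2 ∨ height P.toList (c.1 + 2) = c.2)}

def sumLabel (c : ℕ × ℕ) : ℕ := (c.1 + c.2) / 2

def diffLabel (c : ℕ × ℕ) : ℕ := (c.1 - c.2 + 2) / 2

/-- The indices of the run `s_b s_{b-1} ⋯ s_a` of simple transpositions. -/
def run (b a : ℕ) : List ℕ := (List.range' a (b + 1 - a)).reverse

/-- `Zigzag P σ`: the zigzag decomposition of `P` is `σ`, a list of runs. -/
inductive Zigzag : DyckWord → List (List ℕ) → Prop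
  | nil {P : DyckWord} : essentialCells P = ∅ → Zigzag P []
  | strip {P Q : DyckWord} {e : ℕ × ℕ} {a b : ℕ} {σ : List (List ℕ)} :
      e ∈ essentialCells P → (∀ c ∈ essentialCells P, c.1 ≤ e.1) →
      Q.semilength = P.semilength → cells Q = cells P \ zigzagStrip P e →
      a ≤ b → sumLabel '' zigzagStrip P e = Set.Icc a b →
      Zigzag Q σ → Zigzag P (σ ++ [run b a])

/-- `Trapezoidal x y P σ`: the trapezoidal decomposition of `P` is `σ`, where `P` is a part, with
starting point `(x, y)`, of a path whose labels it carries. Here `P = Q₁ u Q₂ d R`, where `u` is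
the left arm of the rightmost essential cell that touches the line of height `y`, `d` is the
down-step corresponding to `u`, and `R = ud⋯ud` has no cells. The trapezoidal strip goes from
the essential cell to the last cell in the same row below `u Q₂ d`. -/
inductive Trapezoidal : ℕ → ℕ → DyckWord → List (List ℕ) → Prop
  | nil {x y : ℕ} {P : DyckWord} : essentialCells P = ∅ → Trapezoidal x y P []
  | strip {x y : ℕ} {Q₁ Q₂ R : DyckWord} {σ τ : List (List ℕ)} :
      Q₂ ≠ 0 → essentialCells R = ∅ →
      Trapezoidal x y Q₁ σ →
      Trapezoidal (x + Q₁.toList.length + 1) (y + 1) Q₂ τ →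
      Trapezoidal x y (Q₁ + Q₂.nest + R)
        (σ ++ τ ++
          [run (diffLabel (x + Q₁.toList.length + Q₂.toList.length - 1, y + 1))
            (diffLabel (x + Q₁.toList.length + 1, y + 1))])

/-- The action of `sᵢ`: interchange the letters in positions `i` and `i + 1`. -/
def swapAt (w : Word) (i : ℕ) : Word :=
  w.take (i - 1) ++
    match w.drop (i - 1) with
    | a :: b :: v => b :: a :: v
    | v => v

/-- The permutation `(1 2 … n) σ₁ σ₂ ⋯ σₖ`. -/
def fromRuns (n : ℕ) (σ : List (List ℕ)) : Word := σ.flatten.foldl swapAt (List.range' 1 n)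

def MansourDengDuGraph (π σ : Word) : Prop :=
  ∃ (P : DyckWord) (zs ts : List (List ℕ)), Zigzag P zs ∧ Trapezoidal 0 0 P ts ∧
    π = fromRuns P.semilength zs ∧ σ = fromRuns P.semilength ts

/-! ### The recursive bijection -/

/-- The sum `σ ⊕ τ`. -/
def osum (σ τ : Word) : Word := σ ++ τ.map (· + σ.length)

/-- Prepend a new largest letter. -/
def alpha (w : Word) : Word := (w.length + 1) :: w

def IsLRMax (w : Word) (x : ℕ) : Prop := ∀ y ∈ w.takeWhile (· ≠ x), y < x

def IsRLMin (w : Word) (x : ℕ) : Prop := ∀ y ∈ w.dropWhile (· ≠ x), x ≤ y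

instance (w : Word) (x : ℕ) : Decidable (IsLRMax w x) := by
  unfold IsLRMax
  infer_instance

instance (w : Word) (x : ℕ) : Decidable (IsRLMin w x) := by
  unfold IsRLMin
  infer_instance

/-- Box the left-to-right maxima to the right of `1` that are not right-to-left minima, insert a
new largest letter, boxed, immediately to the left of `1`, and shift the boxed letters cyclically
one step to the left: every boxed letter is replaced by the next one, the last by the first. The
empty word is sent to `1`. -/
def beta (w : Word) : Word :=
  let before := w.takeWhile (· ≠ 1)
  let after := w.dropWhile (· ≠ 1)
  let boxed := (w.length + 1) :: after.filter fun x => IsLRMax w x ∧ ¬ IsRLMin w x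
  (before ++ (w.length + 1) :: after).map boxed.formPerm

/-- The graph of `Φ`, from 231-avoiding to 321-avoiding permutations: `Φ(ε) = ε`,
`Φ(α(σ)) = β(Φ(σ))`, `Φ(σ ⊕ τ) = Φ(τ) ⊕ Φ(σ)`. -/
inductive PhiGraph : Word → Word → Prop
  | nil : PhiGraph [] []
  | alpha {σ σ₁ : Word} : PhiGraph σ σ₁ → PhiGraph (alpha σ) (beta σ₁)
  | osum {σ σ₁ τ τ₁ : Word} : PhiGraph σ σ₁ → PhiGraph τ τ₁ →
      PhiGraph (osum σ τ) (osum τ₁ σ₁)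

/-! ### Relations via the trivial bijections -/

/-- The ten bijections. -/
inductive Bij where
  | Phi | Knuth | KnuthRotem | SimionSchmidt | KnuthRichards | West | Krattenthaler
  | Reifegerste | ElizaldeDeutsch | MansourDengDu

/-- The graphs of the ten bijections. Permutations of all lengths are treated at once; the
bijections preserve the length. -/
def graph : Bij → Word → Word → Prop
  | .Phi => PhiGraph
  | .Knuth => KnuthGraph
  | .KnuthRotem => KnuthRotemGraph
  | .SimionSchmidt => SimionSchmidtGraph
  | .KnuthRichards => KnuthRichardsGraph
  | .West => WestGraph
  | .Krattenthaler => KrattenthalerGraph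
  | .Reifegerste => ReifegersteGraph
  | .ElizaldeDeutsch => ElizaldeDeutschGraph
  | .MansourDengDu => MansourDengDuGraph

/-- A formal composite `t ∘ B ∘ s` or `t ∘ B⁻¹ ∘ s` of one of the ten bijections or its inverse
with trivial bijections `t` and `s`. -/
structure Composite where
  left : List Sym
  bij : Bij
  inverted : Bool
  right : List Sym

/-- The graph of a composite. -/
def Composite.graph (x : Composite) (π σ : Word) : Prop :=
  IsPerm π ∧ ∃ ρ, σ = act x.left ρ ∧
    if x.inverted then PermBij.graph x.bij ρ (act x.right π)
    else PermBij.graph x.bij (act x.right π) ρ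

/-- The relation `x = y` holds: the two composites are the same map, for all lengths. -/
def Holds (x y : Composite) : Prop := ∀ π σ : Word, x.graph π σ ↔ y.graph π σ

/-- The inverse composite (each generator of the trivial bijections is an involution). -/
def Composite.inverse (x : Composite) : Composite :=
  ⟨x.right.reverse, x.bij, !x.inverted, x.left.reverse⟩

/-- `u ∘ x ∘ v` for trivial bijections `u` and `v`. -/
def Composite.comp (u : List Sym) (x : Composite) (v : List Sym) : Composite :=
  ⟨u ++ x.left, x.bij, x.inverted, x.right ++ v⟩

/-- The relation `x = y` follows formally from the relations in `R`: it is obtained from them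
by equational reasoning, composition with trivial bijections, passing to inverses, and the
relations between the trivial bijections themselves. -/
inductive Follows (R : Composite → Composite → Prop) : Composite → Composite → Prop
  | of {x y : Composite} : R x y → Follows R x y
  | refl (x : Composite) : Follows R x x
  | symm {x y : Composite} : Follows R x y → Follows R y x
  | trans {x y z : Composite} : Follows R x y → Follows R y z → Follows R x z
  | comp {x y : Composite} (u v : List Sym) :
      Follows R x y → Follows R (x.comp u v) (y.comp u v)
  | inverse {x y : Composite} : Follows R x y → Follows R x.inverse y.inverse
  | trivial {s s₁ t t₁ : List Sym} (B : Bij) (b : Bool) :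
      (∀ w, IsPerm w → act t w = act t₁ w) → (∀ w, IsPerm w → act s w = act s₁ w) →
      Follows R ⟨t, B, b, s⟩ ⟨t₁, B, b, s₁⟩

/-- `r ∘ Φ⁻¹ = i ∘ SimionSchmidt ∘ r = i ∘ Krattenthaler ∘ r ∘ i = i ∘ r ∘ MansourDengDu
= KnuthRichards⁻¹ ∘ r` and `Reifegerste = i ∘ KnuthRotem ∘ i`. -/
inductive MainRelation : Composite → Composite → Prop
  | simionSchmidt :
      MainRelation ⟨[.r], .Phi, true, []⟩ ⟨[.i], .SimionSchmidt, false, [.r]⟩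
  | krattenthaler :
      MainRelation ⟨[.r], .Phi, true, []⟩ ⟨[.i], .Krattenthaler, false, [.r, .i]⟩
  | mansourDengDu :
      MainRelation ⟨[.r], .Phi, true, []⟩ ⟨[.i, .r], .MansourDengDu, false, []⟩
  | knuthRichards :
      MainRelation ⟨[.r], .Phi, true, []⟩ ⟨[], .KnuthRichards, true, [.r]⟩
  | reifegerste :
      MainRelation ⟨[], .Reifegerste, false, []⟩ ⟨[.i], .KnuthRotem, false, [.i]⟩

/-- Relations between a bijection and itself: `SimionSchmidt = i ∘ SimionSchmidt ∘ i`,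
`Knuth = i ∘ Knuth ∘ i`, `KnuthRotem = i ∘ KnuthRotem ∘ i ∘ r ∘ c`. -/
inductive SelfRelation : Composite → Composite → Prop
  | simionSchmidt :
      SelfRelation ⟨[], .SimionSchmidt, false, []⟩ ⟨[.i], .SimionSchmidt, false, [.i]⟩
  | knuth :
      SelfRelation ⟨[], .Knuth, false, []⟩ ⟨[.i], .Knuth, false, [.i]⟩
  | knuthRotem :
      SelfRelation ⟨[], .KnuthRotem, false, []⟩ ⟨[.i], .KnuthRotem, false, [.i, .r, .c]⟩

end PermBij

open PermBij

/-!
# Relations between bijections for 321- and 132-avoiding permutations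

The four relations of the first chain hold because all five composites in it have the same graph,
`SameMinima`: a 321-avoiding permutation `π` is related to a 132-avoiding permutation `σ` of the
same length if and only if the right-to-left minima of `π`, read from the right, are the
left-to-right minima of the inverse of `σ`. Minima are handled through the region `NE w` of the
points `(i, v)` such that one of the first `i` letters of `w` is at most `v` (`SE w` is the
analogue for the letters after the first `i`). A 132-avoiding or a 123-avoiding permutation is
determined by this region (`eq_of_NE_eq_132`, `eq_of_NE_eq_123`), so `SameMinima` is a partial
bijection, and for each composite it is enough to trace the minima:

* Simion–Schmidt, Knuth–Richards and Reifegerste fill a region row by row, greedily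
  (`leastSteps_spec`, `largestSteps_spec`);
* the paths of Krattenthaler and of Knuth–Rotem and the standard path, which for 132-avoiding
  permutations is Krattenthaler's path (`stdPath_eq_heightPath`), are boundaries of such regions.
  A path is encoded by the relation `Precedes` between its up-steps and its down-steps, which
  determines it (`path_ext`);
* `Φ` reflects the region of the right-to-left minima in the antidiagonal (`phiGraph_spec`), since
  `α` adds no minimum to a nonempty word and `β` moves all minima one position to the
  right (`beta_spec`);
* in the bijection of Mansour, Deng and Du both permutations of a Dyck path have their
  right-to-left minima at the peaks of the path (`Fits`). A trapezoidal decomposition builds its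
  permutation by `⊕` and `α` along `Q₁ u Q₂ d R` (`trapezoidal_spec`). Deleting the zigzag strip
  moves one up-step to the right in the path, and the run of the strip moves the corresponding
  letter back in the permutation (`LastUU.cells_deletion`, `LastUU.fits_foldl`, `zigzag_spec`).

The relation between the bijections of Reifegerste and Knuth–Rotem follows in the same way: the
shaded region of the former is bounded by the path of the latter (`holds_reifegerste`).

For the absence of other relations, the main relations reduce every composite formally to one of
five bijections (`exists_follows_rep`), and every relation that holds to one of the form
`B = t ∘ B'^{±1} ∘ s` with `t` and `s` among the eight normal forms `rᵃ cᵇ iᵉ`. These are finitely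
many, and each of them, except for the trivial ones and the self-symmetries, is refuted by a
permutation of length at most four (`separation`). The reduction preserves validity
because formal consequences of valid relations are valid (`Follows.holds`); this is where the main
relations themselves are needed.
-/


namespace PermBij

/-! ### Patterns of length three in subword form -/

theorem avoids_three_iff {a b c : ℕ} {w : Word} :
    Avoids [a, b, c] w ↔ ∀ x y z, [x, y, z].Sublist w → ¬ OrderIso [x, y, z] [a, b, c] := by
  unfold Avoids
  constructor
  · intro h x y z hs
    exact h _ (List.mem_sublists.2 hs)
  · intro h u hu ho
    have hl := ho.1
    match u, hl with
    | [x, y, z], _ => exact h x y z (List.mem_sublists.1 hu) ho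

theorem avoids_iff_132 {w : Word} :
    Avoids [1, 3, 2] w ↔ ∀ x y z, [x, y, z].Sublist w → x < z → z < y → False := by
  rw [avoids_three_iff]
  refine forall_congr' fun x => forall_congr' fun y => forall_congr' fun z => imp_congr_right fun _ => ?_
  constructor
  · intro h h1 h2
    refine h ⟨rfl, fun i hi j hj => ?_⟩
    simp only [List.length_cons, List.length_nil] at hi hj
    interval_cases i <;> interval_cases j <;> simp <;> omega
  · rintro h ⟨-, h2⟩
    have h02 := h2 0 (by simp) 2 (by simp)
    have h21 := h2 2 (by simp) 1 (by simp)
    simp at h02 h21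
    exact h h02 h21

theorem avoids_iff_123 {w : Word} :
    Avoids [1, 2, 3] w ↔ ∀ x y z, [x, y, z].Sublist w → x < y → y < z → False := by
  rw [avoids_three_iff]
  refine forall_congr' fun x => forall_congr' fun y => forall_congr' fun z => imp_congr_right fun _ => ?_
  constructor
  · intro h h1 h2
    refine h ⟨rfl, fun i hi j hj => ?_⟩
    simp only [List.length_cons, List.length_nil] at hi hj
    interval_cases i <;> interval_cases j <;> simp <;> omega
  · rintro h ⟨-, h2⟩
    have h01 := h2 0 (by simp) 1 (by simp)
    have h12 := h2 1 (by simp) 2 (by simp)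
    simp at h01 h12
    exact h h01 h12

theorem avoids_iff_321 {w : Word} :
    Avoids [3, 2, 1] w ↔ ∀ x y z, [x, y, z].Sublist w → y < x → z < y → False := by
  rw [avoids_three_iff]
  refine forall_congr' fun x => forall_congr' fun y => forall_congr' fun z => imp_congr_right fun _ => ?_
  constructor
  · intro h h1 h2
    refine h ⟨rfl, fun i hi j hj => ?_⟩
    simp only [List.length_cons, List.length_nil] at hi hj
    interval_cases i <;> interval_cases j <;> simp <;> omega
  · rintro h ⟨-, h2⟩
    have h01 := h2 1 (by simp) 0 (by simp)
    have h12 := h2 2 (by simp) 1 (by simp)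
    simp at h01 h12
    exact h h01 h12

theorem avoids_iff_231 {w : Word} :
    Avoids [2, 3, 1] w ↔ ∀ x y z, [x, y, z].Sublist w → x < y → z < x → False := by
  rw [avoids_three_iff]
  refine forall_congr' fun x => forall_congr' fun y => forall_congr' fun z => imp_congr_right fun _ => ?_
  constructor
  · intro h h1 h2
    refine h ⟨rfl, fun i hi j hj => ?_⟩
    simp only [List.length_cons, List.length_nil] at hi hj
    interval_cases i <;> interval_cases j <;> simp <;> omega
  · rintro h ⟨-, h2⟩
    have h01 := h2 0 (by simp) 1 (by simp)
    have h12 := h2 2 (by simp) 0 (by simp)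
    simp at h01 h12
    exact h h01 h12

theorem avoids_123_reverse {w : Word} : Avoids [1, 2, 3] w.reverse ↔ Avoids [3, 2, 1] w := by
  rw [avoids_iff_123, avoids_iff_321]
  constructor
  · intro h x y z hs h1 h2
    exact h z y x (by simpa using hs.reverse) h2 h1
  · intro h x y z hs h1 h2
    exact h z y x (by simpa using hs.reverse) h2 h1

theorem avoids_132_reverse {w : Word} : Avoids [1, 3, 2] w.reverse ↔ Avoids [2, 3, 1] w := by
  rw [avoids_iff_132, avoids_iff_231]
  constructor
  · intro h x y z hs h1 h2
    exact h z y x (by simpa using hs.reverse) h2 h1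
  · intro h x y z hs h1 h2
    exact h z y x (by simpa using hs.reverse) h2 h1

/-! ### Permutations and the trivial bijections -/

theorem IsPerm.nodup {w : Word} (h : IsPerm w) : w.Nodup :=
  (List.Perm.nodup_iff h).2 List.nodup_range'

theorem IsPerm.mem {w : Word} (h : IsPerm w) {x : ℕ} : x ∈ w ↔ 1 ≤ x ∧ x ≤ w.length := by
  rw [List.Perm.mem_iff h, List.mem_range'_1]; omega

theorem isPerm_iff {w : Word} : IsPerm w ↔ w.Nodup ∧ ∀ x ∈ w, 1 ≤ x ∧ x ≤ w.length := by
  constructor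
  · exact fun h => ⟨h.nodup, fun x hx => h.mem.1 hx⟩
  · rintro ⟨h1, h2⟩
    refine (List.subperm_of_subset h1 fun x hx => ?_).perm_of_length_le (by simp)
    have := h2 x hx
    rw [List.mem_range'_1]; omega

/-- A duplicate-free list of numbers in `{1, …, n}` with `n` entries is a permutation. -/
theorem isPerm_of_nodup {w : Word} {n : ℕ} (hl : w.length = n) (h1 : w.Nodup)
    (h2 : ∀ x ∈ w, 1 ≤ x ∧ x ≤ n) : IsPerm w :=
  isPerm_iff.2 ⟨h1, by subst hl; exact h2⟩

theorem IsPerm.reverse {w : Word} (h : IsPerm w) : IsPerm w.reverse := by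
  rw [isPerm_iff] at *
  simpa using h

theorem IsPerm.getElem_bounds {w : Word} (h : IsPerm w) {i : ℕ} (hi : i < w.length) :
    1 ≤ w[i] ∧ w[i] ≤ w.length := h.mem.1 (List.getElem_mem hi)

@[simp] theorem length_complement (w : Word) : (complement w).length = w.length := by
  simp [complement]

@[simp] theorem length_inverse (w : Word) : (PermBij.inverse w).length = w.length := by
  simp [PermBij.inverse]

theorem IsPerm.complement {w : Word} (h : IsPerm w) : IsPerm (complement w) := by
  refine isPerm_of_nodup (length_complement w) ?_ ?_
  · unfold PermBij.complement
    refine List.Nodup.map_on ?_ h.nodup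
    intro x hx y hy hxy
    have := h.mem.1 hx
    have := h.mem.1 hy
    omega
  · intro x hx
    simp only [PermBij.complement, List.mem_map] at hx
    obtain ⟨y, hy, rfl⟩ := hx
    have := h.mem.1 hy
    omega

theorem complement_complement {w : Word} (h : IsPerm w) :
    PermBij.complement (PermBij.complement w) = w := by
  unfold PermBij.complement
  rw [List.map_map, List.length_map]
  conv_rhs => rw [← List.map_id w]
  refine List.map_congr_left fun x hx => ?_
  have := h.mem.1 hx
  simp; omega

theorem getElem_inverse (w : Word) {v : ℕ} (hv : v < (PermBij.inverse w).length) :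
    (PermBij.inverse w)[v] = w.idxOf (v + 1) + 1 := by
  simp [PermBij.inverse, Nat.add_comm]

theorem IsPerm.inverse {w : Word} (h : IsPerm w) : IsPerm (PermBij.inverse w) := by
  refine isPerm_of_nodup (length_inverse w) ?_ ?_
  · unfold PermBij.inverse
    refine List.Nodup.map_on ?_ List.nodup_range'
    intro x hx y hy hxy
    have hx' := (h.mem_iff).2 hx
    exact (List.idxOf_inj hx').1 (by omega)
  · intro x hx
    simp only [PermBij.inverse, List.mem_map] at hx
    obtain ⟨y, hy, rfl⟩ := hx
    have := List.idxOf_lt_length_iff.2 ((h.mem_iff).2 hy)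
    omega

/-- The letter `v` stands at position `j` of `w` iff `j` stands at position `v` of the inverse
(positions counted from zero, letters from one). -/
theorem IsPerm.inverse_getElem_eq_iff {w : Word} (h : IsPerm w) {j v : ℕ} (hj : j < w.length)
    (hv : v < w.length) :
    (PermBij.inverse w)[v]'(by simpa using hv) = j + 1 ↔ w[j] = v + 1 := by
  rw [getElem_inverse]
  constructor
  · intro h1
    have h2 : w.idxOf (v + 1) = j := by omega
    subst h2
    exact List.getElem_idxOf hj
  · intro h1
    rw [← h1, h.nodup.idxOf_getElem]

theorem inverse_inverse {w : Word} (h : IsPerm w) : PermBij.inverse (PermBij.inverse w) = w := by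
  refine List.ext_getElem (by simp) fun i h1 h2 => ?_
  have hb := h.getElem_bounds h2
  have hi' := h.inverse
  have : w[i] = (w[i] - 1) + 1 := by omega
  rw [this, hi'.inverse_getElem_eq_iff (by simp; omega) (by simpa using h2),
    h.inverse_getElem_eq_iff h2 (by omega)]
  omega

theorem reverse_complement (w : Word) :
    PermBij.complement w.reverse = (PermBij.complement w).reverse := by
  simp [PermBij.complement, List.map_reverse]

theorem inverse_reverse {w : Word} (h : IsPerm w) :
    PermBij.inverse w.reverse = PermBij.complement (PermBij.inverse w) := by
  refine List.ext_getElem (by simp) fun i h1 h2 => ?_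
  simp only [length_inverse, List.length_reverse, length_complement] at h1 h2
  have hb := h.inverse.getElem_bounds (i := i) (by simpa using h1)
  simp only [length_inverse] at hb
  have e : (PermBij.complement (PermBij.inverse w))[i]'(by simpa using h1) =
      (w.length - (PermBij.inverse w)[i]'(by simpa using h1)) + 1 := by
    simp only [PermBij.complement, List.getElem_map, length_inverse]; omega
  rw [e, h.reverse.inverse_getElem_eq_iff (by simp; omega) (by simpa using h1),
    List.getElem_reverse]
  have := (h.inverse_getElem_eq_iff (j := (PermBij.inverse w)[i]'(by simpa using h1) - 1)
    (v := i) (by omega) h1).1 (by omega)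
  rw [← this]
  congr 1
  omega

theorem inverse_complement {w : Word} (h : IsPerm w) :
    PermBij.inverse (PermBij.complement w) = (PermBij.inverse w).reverse := by
  have h1 := inverse_reverse h.inverse
  rw [inverse_inverse h] at h1
  rw [← h1, inverse_inverse h.inverse.reverse]

theorem IsPerm.symAct {w : Word} (h : IsPerm w) (s : PermBij.Sym) : IsPerm (s.act w) := by
  cases s
  · exact h.reverse
  · exact h.complement
  · exact h.inverse

theorem symAct_symAct {w : Word} (h : IsPerm w) (s : PermBij.Sym) : s.act (s.act w) = w := by
  cases s
  · exact List.reverse_reverse w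
  · exact complement_complement h
  · exact inverse_inverse h

theorem IsPerm.act {w : Word} (h : IsPerm w) (s : List PermBij.Sym) : IsPerm (act s w) := by
  induction s with
  | nil => exact h
  | cons a s ih => exact ih.symAct a

theorem act_append (s t : List PermBij.Sym) (w : Word) : act (s ++ t) w = act s (act t w) := by
  simp [PermBij.act]

theorem act_reverse_act {w : Word} (h : IsPerm w) (s : List PermBij.Sym) :
    act s.reverse (act s w) = w := by
  induction s with
  | nil => rfl
  | cons a s ih =>
    rw [List.reverse_cons, act_append]
    change act s.reverse (a.act (a.act (act s w))) = w
    rw [symAct_symAct (h.act s), ih]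

theorem act_act_reverse {w : Word} (h : IsPerm w) (s : List PermBij.Sym) :
    act s (act s.reverse w) = w := by
  have := act_reverse_act h s.reverse
  rwa [List.reverse_reverse] at this

/-! ### Patterns and inverses -/

theorem three_sublist_iff {x y z : ℕ} {w : Word} :
    [x, y, z].Sublist w ↔ ∃ (i j k : ℕ) (_ : i < j) (hjk : j < k) (hk : k < w.length),
      w[i] = x ∧ w[j] = y ∧ w[k] = z := by
  constructor
  · intro h
    obtain ⟨f, hf⟩ := List.sublist_iff_exists_fin_orderEmbedding_get_eq.1 h
    refine ⟨f ⟨0, by simp⟩, f ⟨1, by simp⟩, f ⟨2, by simp⟩, ?_, ?_, (f ⟨2, by simp⟩).2, ?_, ?_, ?_⟩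
    · exact f.strictMono (by simp)
    · exact f.strictMono (by simp)
    · simpa using (hf ⟨0, by simp⟩).symm
    · simpa using (hf ⟨1, by simp⟩).symm
    · simpa using (hf ⟨2, by simp⟩).symm
  · rintro ⟨i, j, k, hij, hjk, hk, rfl, rfl, rfl⟩
    have h1 : w = w.take i ++ w[i] :: ((w.drop (i + 1)).take (j - (i + 1)) ++ w[j] ::
        ((w.drop (j + 1)).take (k - (j + 1)) ++ w[k] :: w.drop (k + 1))) := by
      have e1 : ((w.drop (j + 1)).take (k - (j + 1)) ++ w[k] :: w.drop (k + 1)) =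
          w.drop (j + 1) := by
        rw [← List.drop_eq_getElem_cons]
        conv_rhs => rw [← List.take_append_drop (k - (j + 1)) (w.drop (j + 1))]
        rw [List.drop_drop]; congr 2; omega
      have e2 : ((w.drop (i + 1)).take (j - (i + 1)) ++ w[j] :: w.drop (j + 1)) =
          w.drop (i + 1) := by
        rw [← List.drop_eq_getElem_cons]
        conv_rhs => rw [← List.take_append_drop (j - (i + 1)) (w.drop (i + 1))]
        rw [List.drop_drop]; congr 2; omega
      rw [e1, e2, ← List.drop_eq_getElem_cons, List.take_append_drop]
    conv => arg 2; rw [h1]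
    refine List.Sublist.trans ?_ (List.sublist_append_right _ _)
    refine List.Sublist.cons_cons _ (List.Sublist.trans ?_ (List.sublist_append_right _ _))
    refine List.Sublist.cons_cons _ (List.Sublist.trans ?_ (List.sublist_append_right _ _))
    exact List.Sublist.cons_cons _ (List.nil_sublist _)

/-- The point `(position, letter)` of `w` read off from a point of the inverse. -/
theorem IsPerm.getElem_of_inverse {w : Word} (h : IsPerm w) {v : ℕ} (hv : v < w.length) :
    ∃ hj : (PermBij.inverse w)[v]'(by simpa using hv) - 1 < w.length,
      w[(PermBij.inverse w)[v]'(by simpa using hv) - 1] = v + 1 := by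
  have hb := h.inverse.getElem_bounds (i := v) (by simpa using hv)
  simp only [length_inverse] at hb
  refine ⟨by omega, ?_⟩
  exact (h.inverse_getElem_eq_iff (by omega) hv).1 (by omega)

theorem avoids_132_inverse {w : Word} (h : IsPerm w) (ha : Avoids [1, 3, 2] w) :
    Avoids [1, 3, 2] (PermBij.inverse w) := by
  rw [avoids_iff_132] at *
  intro x y z hs hxz hzy
  obtain ⟨i, j, k, hij, hjk, hk, rfl, rfl, rfl⟩ := three_sublist_iff.1 hs
  simp only [length_inverse] at hk
  obtain ⟨h1, e1⟩ := h.getElem_of_inverse (v := i) (by omega)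
  obtain ⟨h2, e2⟩ := h.getElem_of_inverse (v := j) (by omega)
  obtain ⟨h3, e3⟩ := h.getElem_of_inverse (v := k) (by omega)
  have b1 := (h.inverse.getElem_bounds (i := i) (by simp; omega)).1
  have b2 := (h.inverse.getElem_bounds (i := k) (by simp; omega)).1
  refine ha _ _ _ (three_sublist_iff.2 ⟨_, _, _, ?_, ?_, h2, e1, e3, e2⟩) ?_ ?_ <;> omega

theorem avoids_123_inverse {w : Word} (h : IsPerm w) (ha : Avoids [1, 2, 3] w) :
    Avoids [1, 2, 3] (PermBij.inverse w) := by
  rw [avoids_iff_123] at *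
  intro x y z hs hxz hzy
  obtain ⟨i, j, k, hij, hjk, hk, rfl, rfl, rfl⟩ := three_sublist_iff.1 hs
  simp only [length_inverse] at hk
  obtain ⟨h1, e1⟩ := h.getElem_of_inverse (v := i) (by omega)
  obtain ⟨h2, e2⟩ := h.getElem_of_inverse (v := j) (by omega)
  obtain ⟨h3, e3⟩ := h.getElem_of_inverse (v := k) (by omega)
  have b1 := (h.inverse.getElem_bounds (i := i) (by simp; omega)).1
  have b2 := (h.inverse.getElem_bounds (i := j) (by simp; omega)).1
  refine ha _ _ _ (three_sublist_iff.2 ⟨_, _, _, ?_, ?_, h3, e1, e2, e3⟩) ?_ ?_ <;> omega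

theorem avoids_321_inverse {w : Word} (h : IsPerm w) (ha : Avoids [3, 2, 1] w) :
    Avoids [3, 2, 1] (PermBij.inverse w) := by
  rw [avoids_iff_321] at *
  intro x y z hs hxz hzy
  obtain ⟨i, j, k, hij, hjk, hk, rfl, rfl, rfl⟩ := three_sublist_iff.1 hs
  simp only [length_inverse] at hk
  obtain ⟨h1, e1⟩ := h.getElem_of_inverse (v := i) (by omega)
  obtain ⟨h2, e2⟩ := h.getElem_of_inverse (v := j) (by omega)
  obtain ⟨h3, e3⟩ := h.getElem_of_inverse (v := k) (by omega)
  have b1 := (h.inverse.getElem_bounds (i := k) (by simp; omega)).1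
  have b2 := (h.inverse.getElem_bounds (i := j) (by simp; omega)).1
  refine ha _ _ _ (three_sublist_iff.2 ⟨_, _, _, ?_, ?_, h1, e3, e2, e1⟩) ?_ ?_ <;> omega

/-! ### The region above the left-to-right minima -/

/-- Some letter among the first `i` is at most `v`: the point `(i, v)` of the permutation diagram
lies weakly to the north-east of a left-to-right minimum. -/
def NE (w : Word) (i v : ℕ) : Prop := ∃ u ∈ w.take i, u ≤ v

/-- Some letter after the first `i` is at most `v`. -/
def SE (w : Word) (i v : ℕ) : Prop := ∃ u ∈ w.drop i, u ≤ v

theorem NE_iff_getElem {w : Word} {i v : ℕ} :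
    NE w i v ↔ ∃ (j : ℕ) (h : j < w.length), j < i ∧ w[j] ≤ v := by
  unfold NE
  constructor
  · rintro ⟨u, hu, huv⟩
    obtain ⟨j, hj, rfl⟩ := List.mem_take_iff_getElem.1 hu
    exact ⟨j, by omega, by omega, huv⟩
  · rintro ⟨j, h, hj, huv⟩
    exact ⟨_, List.mem_take_iff_getElem.2 ⟨j, by omega, rfl⟩, huv⟩

theorem SE_iff_getElem {w : Word} {i v : ℕ} :
    SE w i v ↔ ∃ (j : ℕ) (h : j < w.length), i ≤ j ∧ w[j] ≤ v := by
  unfold SE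
  constructor
  · rintro ⟨u, hu, huv⟩
    obtain ⟨j, hj, rfl⟩ := List.mem_iff_getElem.1 hu
    simp only [List.length_drop] at hj
    simp only [List.getElem_drop] at huv
    exact ⟨i + j, by omega, by omega, huv⟩
  · rintro ⟨j, h, hj, huv⟩
    refine ⟨w[j], List.mem_iff_getElem.2 ⟨j - i, by simp; omega, ?_⟩, huv⟩
    simp only [List.getElem_drop]; congr 1; omega

theorem NE_length_le {w : Word} {i v : ℕ} (h : w.length ≤ i) : NE w i v ↔ NE w w.length v := by
  simp [NE, List.take_of_length_le h]

theorem NE_zero_right {w : Word} (h : IsPerm w) (i : ℕ) : ¬ NE w i 0 := by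
  rintro ⟨u, hu, hu0⟩
  have := (h.mem.1 (List.mem_of_mem_take hu)).1
  omega

theorem NE_reverse {w : Word} {i v : ℕ} : NE w.reverse i v ↔ SE w (w.length - i) v := by
  simp [NE, SE, List.take_reverse]

theorem NE_inverse {w : Word} (h : IsPerm w) {i v : ℕ} :
    NE (PermBij.inverse w) i v ↔ NE w v i := by
  rw [NE_iff_getElem, NE_iff_getElem]
  constructor
  · rintro ⟨j, hj, hji, hv⟩
    simp only [length_inverse] at hj
    obtain ⟨h1, e1⟩ := h.getElem_of_inverse hj
    have b1 := (h.inverse.getElem_bounds (i := j) (by simpa using hj)).1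
    exact ⟨_, h1, by omega, by omega⟩
  · rintro ⟨j, hj, hji, hv⟩
    have b := h.getElem_bounds hj
    refine ⟨w[j] - 1, by simp; omega, by omega, ?_⟩
    have := (h.inverse_getElem_eq_iff (j := j) (v := w[j] - 1) hj (by omega)).2 (by omega)
    omega

/-- Two arrangements `w`, `w'` of the same letters that have the same left-to-right minima after
the prefix `pre` are equal, if the following is excluded: after a common prefix containing a
letter `u`, one of the two continues with `a` and the other with `b`, where `u < a < b`. In that
situation the first word has the subword `u a b` and the second one `u b a`. -/
theorem eq_of_NE_eq_aux {pre w w' : Word} (hp : w.Perm w') (hn : (pre ++ w).Nodup)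
    (hR : ∀ (u a b : ℕ) (p s s' : Word), u ∈ p → u < a → a < b →
      p ++ a :: s = pre ++ w → p ++ b :: s' = pre ++ w' → b ∈ s → a ∈ s' → False)
    (hR' : ∀ (u a b : ℕ) (p s s' : Word), u ∈ p → u < a → a < b →
      p ++ a :: s = pre ++ w' → p ++ b :: s' = pre ++ w → b ∈ s → a ∈ s' → False)
    (hNE : ∀ i v, NE (pre ++ w) i v ↔ NE (pre ++ w') i v) : w = w' := by
  induction w generalizing pre w' with
  | nil => exact hp.nil_eq
  | cons a w ih =>
    match w', hp with
    | [], hp => exact absurd hp.symm.nil_eq (by simp)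
    | b :: w', hp =>
      -- the smaller of the two next letters is not a new minimum, since the other word would
      -- have to share it
      have key : ∀ x y : ℕ, (∀ v, (∃ u ∈ pre ++ [x], u ≤ v) → (∃ u ∈ pre ++ [y], u ≤ v)) →
          x < y → x ∉ pre → ∃ u ∈ pre, u < x := by
        intro x y h hxy hx
        obtain ⟨u, hu, hux⟩ := h x ⟨x, by simp, le_rfl⟩
        rcases List.mem_append.1 hu with hu | hu
        · exact ⟨u, hu, lt_of_le_of_ne hux fun e => hx (e ▸ hu)⟩
        · simp at hu; omega
      have h1 : ∀ v, (∃ u ∈ pre ++ [a], u ≤ v) ↔ (∃ u ∈ pre ++ [b], u ≤ v) := by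
        intro v
        have := hNE (pre.length + 1) v
        have ht : pre.take (pre.length + 1) = pre := List.take_of_length_le (by omega)
        simpa [NE, List.take_append, ht] using this
      have hab : a = b := by
        rcases lt_trichotomy a b with hlt | heq | hgt
        · exfalso
          obtain ⟨u, hu, hua⟩ := key a b (fun v => (h1 v).1) hlt (by
            intro h; exact (List.disjoint_of_nodup_append hn) h (by simp))
          refine hR u a b pre w w' hu hua hlt rfl rfl ?_ ?_
          · have := hp.symm.subset (List.mem_cons_self (a := b) (l := w'))
            simp only [List.mem_cons] at this
            rcases this with h | h
            · omega
            · exact h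
          · have := hp.subset (List.mem_cons_self (a := a) (l := w))
            simp only [List.mem_cons] at this
            rcases this with h | h
            · omega
            · exact h
        · exact heq
        · exfalso
          obtain ⟨u, hu, hua⟩ := key b a (fun v => (h1 v).2) hgt (by
            intro h
            exact (List.disjoint_of_nodup_append hn) h (hp.symm.subset (by simp)))
          refine hR' u b a pre w' w hu hua hgt rfl rfl ?_ ?_
          · have := hp.subset (List.mem_cons_self (a := a) (l := w))
            simp only [List.mem_cons] at this
            rcases this with h | h
            · omega
            · exact h
          · have := hp.symm.subset (List.mem_cons_self (a := b) (l := w'))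
            simp only [List.mem_cons] at this
            rcases this with h | h
            · omega
            · exact h
      subst hab
      congr 1
      refine ih (pre := pre ++ [a]) hp.cons_inv (by simpa using hn) ?_ ?_ (by simpa using hNE)
      · simpa using hR
      · simpa using hR'

theorem three_sublist_of_mem {u a b : ℕ} {p s : Word} (hu : u ∈ p) (hb : b ∈ s) :
    [u, a, b].Sublist (p ++ a :: s) :=
  (List.singleton_sublist.2 hu).append ((List.singleton_sublist.2 hb).cons_cons a)

/-- A 132-avoiding permutation is determined by its left-to-right minima. -/
theorem eq_of_NE_eq_132 {w w' : Word} (h : w ∈ Av [1, 3, 2]) (h' : w' ∈ Av [1, 3, 2])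
    (hl : w.length = w'.length) (hNE : ∀ i v, NE w i v ↔ NE w' i v) : w = w' := by
  have a1 := avoids_iff_132.1 h.2
  have a2 := avoids_iff_132.1 h'.2
  have hp : w.Perm w' := h.1.trans (hl ▸ h'.1.symm)
  refine eq_of_NE_eq_aux (pre := []) hp h.1.nodup ?_ ?_ hNE
  · intro u a b p s s' hu hua hab e e' hb ha
    refine a2 u b a ?_ hua hab
    simp only [List.nil_append] at e'
    exact e' ▸ three_sublist_of_mem hu ha
  · intro u a b p s s' hu hua hab e e' hb ha
    refine a1 u b a ?_ hua hab
    simp only [List.nil_append] at e'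
    exact e' ▸ three_sublist_of_mem hu ha

/-- A 123-avoiding permutation is determined by its left-to-right minima. -/
theorem eq_of_NE_eq_123 {w w' : Word} (h : w ∈ Av [1, 2, 3]) (h' : w' ∈ Av [1, 2, 3])
    (hl : w.length = w'.length) (hNE : ∀ i v, NE w i v ↔ NE w' i v) : w = w' := by
  have a1 := avoids_iff_123.1 h.2
  have a2 := avoids_iff_123.1 h'.2
  have hp : w.Perm w' := h.1.trans (hl ▸ h'.1.symm)
  refine eq_of_NE_eq_aux (pre := []) hp h.1.nodup ?_ ?_ hNE
  · intro u a b p s s' hu hua hab e e' hb ha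
    refine a1 u a b ?_ hua hab
    simp only [List.nil_append] at e
    exact e ▸ three_sublist_of_mem hu hb
  · intro u a b p s s' hu hua hab e e' hb ha
    refine a2 u a b ?_ hua hab
    simp only [List.nil_append] at e
    exact e ▸ three_sublist_of_mem hu hb

/-- The common description of the five composites in the first chain of relations, from
321-avoiding to 132-avoiding permutations: the right-to-left minima of `π`, read from the right,
are the left-to-right minima of the inverse of `σ`. -/
def SameMinima (π σ : Word) : Prop :=
  π ∈ Av [3, 2, 1] ∧ σ ∈ Av [1, 3, 2] ∧ π.length = σ.length ∧
    ∀ i v, NE π.reverse i v ↔ NE σ v i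

theorem reverse_mem_Av_123 {w : Word} : w.reverse ∈ Av [1, 2, 3] ↔ w ∈ Av [3, 2, 1] := by
  constructor
  · rintro ⟨h1, h2⟩
    exact ⟨by simpa using h1.reverse, avoids_123_reverse.1 h2⟩
  · rintro ⟨h1, h2⟩
    exact ⟨h1.reverse, avoids_123_reverse.2 h2⟩

theorem reverse_mem_Av_132 {w : Word} : w.reverse ∈ Av [1, 3, 2] ↔ w ∈ Av [2, 3, 1] := by
  constructor
  · rintro ⟨h1, h2⟩
    exact ⟨by simpa using h1.reverse, avoids_132_reverse.1 h2⟩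
  · rintro ⟨h1, h2⟩
    exact ⟨h1.reverse, avoids_132_reverse.2 h2⟩

theorem inverse_mem_Av_132 {w : Word} (h : w ∈ Av [1, 3, 2]) :
    PermBij.inverse w ∈ Av [1, 3, 2] := ⟨h.1.inverse, avoids_132_inverse h.1 h.2⟩

theorem inverse_mem_Av_321 {w : Word} (h : w ∈ Av [3, 2, 1]) :
    PermBij.inverse w ∈ Av [3, 2, 1] := ⟨h.1.inverse, avoids_321_inverse h.1 h.2⟩

theorem inverse_mem_Av_123 {w : Word} (h : w ∈ Av [1, 2, 3]) :
    PermBij.inverse w ∈ Av [1, 2, 3] := ⟨h.1.inverse, avoids_123_inverse h.1 h.2⟩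

theorem SameMinima.left_unique {π π' σ : Word} (h : SameMinima π σ) (h' : SameMinima π' σ) :
    π = π' := by
  have := eq_of_NE_eq_123 (reverse_mem_Av_123.2 h.1) (reverse_mem_Av_123.2 h'.1)
    (by simp [h.2.2.1, h'.2.2.1]) fun i v => (h.2.2.2 i v).trans (h'.2.2.2 i v).symm
  simpa using this

theorem SameMinima.right_unique {π σ σ' : Word} (h : SameMinima π σ) (h' : SameMinima π σ') :
    σ = σ' :=
  eq_of_NE_eq_132 h.2.1 h'.2.1 (by rw [← h.2.2.1, h'.2.2.1])
    fun i v => (h.2.2.2 v i).symm.trans (h'.2.2.2 v i)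

/-! ### Greedy fillings with prescribed left-to-right minima -/

theorem exists_not_mem_of_length_lt {l : List ℕ} {lo m : ℕ} (h : l.length < m) :
    ∃ b, lo ≤ b ∧ b < lo + m ∧ b ∉ l := by
  by_contra! hc
  have : (List.range' lo m).Subperm l :=
    List.subperm_of_subset List.nodup_range' fun x hx => by
      rw [List.mem_range'_1] at hx
      exact hc x hx.1 hx.2
  have := this.length_le
  simp at this
  omega

theorem exists_mem_le_of_nodup {l : List ℕ} {n k : ℕ} (hl : l.Nodup) (hn : ∀ x ∈ l, x ≤ n)
    (hk : l.length = k + 1) (hkn : k < n) : ∃ u ∈ l, u ≤ n - k := by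
  by_contra! hc
  have : l.Subperm (List.range' (n - k + 1) k) :=
    List.subperm_of_subset hl fun x hx => by
      rw [List.mem_range'_1]
      have := hc x hx
      have := hn x hx
      omega
  have := this.length_le
  simp at this
  omega

/-- Among the first `i` letters of a permutation of length `n` one is at most `n + 1 - i`. -/
theorem IsPerm.NE_antidiagonal {w : Word} (h : IsPerm w) {k : ℕ} (hk : k < w.length) :
    NE w (k + 1) (w.length - k) :=
  exists_mem_le_of_nodup (h.nodup.sublist (List.take_sublist _ _))
    (fun _ hx => (h.mem.1 (List.mem_of_mem_take hx)).2) (by simp; omega) hk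

/-- `StepsFrom R pre r`: every letter `c` of `r` is related by `R` to the list of all letters
before it in `pre ++ r`. -/
def StepsFrom (R : List ℕ → ℕ → Prop) : List ℕ → Word → Prop
  | _, [] => True
  | pre, c :: r => R pre c ∧ StepsFrom R (pre ++ [c]) r

theorem StepsFrom.getElem {R : List ℕ → ℕ → Prop} {pre : List ℕ} {r : Word}
    (h : StepsFrom R pre r) {j : ℕ} (hj : j < r.length) : R (pre ++ r.take j) r[j] := by
  induction r generalizing pre j with
  | nil => simp at hj
  | cons c r ih =>
    cases j with
    | zero => simpa using h.1
    | succ j => simpa using ih h.2 (by simpa using hj)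

/-- Conditions on a region `S` of points (position, letter) that make it the region to the
north-east of the left-to-right minima of a permutation of length `n`. -/
structure IsRegion (n : ℕ) (S : ℕ → ℕ → Prop) : Prop where
  mono : ∀ {i i' v v'}, i ≤ i' → v ≤ v' → S i v → S i' v'
  antidiagonal : ∀ {k}, k < n → S (k + 1) (n - k)

theorem IsPerm.isRegion_NE {w : Word} (h : IsPerm w) : IsRegion w.length (NE w) where
  mono := by
    intro i i' v v' hi hv h
    rw [NE_iff_getElem] at *
    obtain ⟨j, h1, h2, h3⟩ := h
    exact ⟨j, h1, by omega, by omega⟩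
  antidiagonal := fun hk => h.NE_antidiagonal hk

/-- `c` is the least unused letter in the row of `S` that follows the letters `pre`. -/
def LeastStep (n : ℕ) (S : ℕ → ℕ → Prop) (pre : List ℕ) (c : ℕ) : Prop :=
  1 ≤ c ∧ c ≤ n ∧ c ∉ pre ∧ S (pre.length + 1) c ∧
    ∀ b, 1 ≤ b → b < c → S (pre.length + 1) b → b ∈ pre

theorem nodup_of_not_mem_take {w : Word} (h : ∀ j (hj : j < w.length), w[j] ∉ w.take j) :
    w.Nodup := by
  refine List.pairwise_iff_getElem.2 fun i j hi hj hij e => h j hj ?_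
  rw [← e]
  exact List.mem_take_iff_getElem.2 ⟨i, by omega, rfl⟩

/-- The greedy filling of a region with least letters is the 132-avoiding permutation whose
left-to-right minima bound the region. It avoids 132 because, at the time when the letter of the
role 3 is placed, that of the role 2 is a smaller available choice. -/
theorem leastSteps_spec {n : ℕ} {S : ℕ → ℕ → Prop} (hS : IsRegion n S) {w : Word}
    (hl : w.length = n) (h : StepsFrom (LeastStep n S) [] w) :
    w ∈ Av [1, 3, 2] ∧ ∀ i v, 1 ≤ i → i ≤ n → 1 ≤ v → (NE w i v ↔ S i v) := by
  have hs : ∀ j (hj : j < w.length), 1 ≤ w[j] ∧ w[j] ≤ n ∧ w[j] ∉ w.take j ∧ S (j + 1) w[j] ∧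
      ∀ b, 1 ≤ b → b < w[j] → S (j + 1) b → b ∈ w.take j := by
    intro j hj
    have := h.getElem hj
    simp only [LeastStep, List.nil_append, List.length_take] at this
    rwa [min_eq_left hj.le] at this
  have hnd := nodup_of_not_mem_take fun j hj => (hs j hj).2.2.1
  refine ⟨⟨isPerm_of_nodup hl hnd ?_, ?_⟩, ?_⟩
  · intro x hx
    obtain ⟨j, hj, rfl⟩ := List.mem_iff_getElem.1 hx
    exact ⟨(hs j hj).1, (hs j hj).2.1⟩
  · rw [avoids_iff_132]
    intro x y z hsub hxz hzy
    obtain ⟨a, b, c, hab, hbc, hc, rfl, rfl, rfl⟩ := three_sublist_iff.1 hsub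
    have h1 : S (b + 1) w[c] :=
      hS.mono (by omega) hxz.le (hs a (by omega)).2.2.2.1
    have h2 := (hs b (by omega)).2.2.2.2 _ (hs c hc).1 hzy h1
    obtain ⟨d, hd, e⟩ := List.mem_take_iff_getElem.1 h2
    have := (hnd.getElem_inj_iff).1 e
    omega
  · intro i v hi hin hv
    rw [NE_iff_getElem]
    constructor
    · rintro ⟨j, hj, hji, hjv⟩
      exact hS.mono (by omega) hjv (hs j hj).2.2.2.1
    · intro hSv
      have hi' : i - 1 < w.length := by omega
      rcases le_or_gt w[i - 1] v with hle | hlt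
      · exact ⟨i - 1, hi', by omega, hle⟩
      · have h2 := (hs (i - 1) hi').2.2.2.2 v hv hlt (by
          rwa [show i - 1 + 1 = i by omega])
        obtain ⟨d, hd, e⟩ := List.mem_take_iff_getElem.1 h2
        exact ⟨d, by omega, by omega, e.le⟩

/-- `c` bounds the row of `S` that follows the letters `pre` if this row differs from the row
before it, and is the largest unused letter otherwise. -/
def LargestStep (n : ℕ) (S : ℕ → ℕ → Prop) (pre : List ℕ) (c : ℕ) : Prop :=
  1 ≤ c ∧ c ≤ n ∧ c ∉ pre ∧ S (pre.length + 1) c ∧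
    (∀ v, S (pre.length + 1) v → S pre.length v ∨ c ≤ v) ∧
    (¬ S pre.length c ∨ ∀ b, 1 ≤ b → b ≤ n → b ∉ pre → b ≤ c)

/-- The greedy filling of a region with largest letters is the 123-avoiding permutation whose
left-to-right minima bound the region. It avoids 123 because, at the time when the letter of the
role 2 is placed, that of the role 3 is a larger available choice. -/
theorem largestSteps_spec {n : ℕ} {S : ℕ → ℕ → Prop} (hS : IsRegion n S) (h0 : ∀ v, ¬ S 0 v)
    {w : Word} (hl : w.length = n) (h : StepsFrom (LargestStep n S) [] w) :
    w ∈ Av [1, 2, 3] ∧ ∀ i v, i ≤ n → (NE w i v ↔ S i v) := by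
  have hs : ∀ j (hj : j < w.length), 1 ≤ w[j] ∧ w[j] ≤ n ∧ w[j] ∉ w.take j ∧ S (j + 1) w[j] ∧
      (∀ v, S (j + 1) v → S j v ∨ w[j] ≤ v) ∧
      (¬ S j w[j] ∨ ∀ b, 1 ≤ b → b ≤ n → b ∉ w.take j → b ≤ w[j]) := by
    intro j hj
    have := h.getElem hj
    simp only [LargestStep, List.nil_append, List.length_take] at this
    rwa [min_eq_left hj.le] at this
  have hnd := nodup_of_not_mem_take fun j hj => (hs j hj).2.2.1
  refine ⟨⟨isPerm_of_nodup hl hnd ?_, ?_⟩, ?_⟩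
  · intro x hx
    obtain ⟨j, hj, rfl⟩ := List.mem_iff_getElem.1 hx
    exact ⟨(hs j hj).1, (hs j hj).2.1⟩
  · rw [avoids_iff_123]
    intro x y z hsub hxy hyz
    obtain ⟨a, b, c, hab, hbc, hc, rfl, rfl, rfl⟩ := three_sublist_iff.1 hsub
    have h1 : S b w[b] :=
      hS.mono (by omega) hxy.le (hs a (by omega)).2.2.2.1
    have h2 := ((hs b (by omega)).2.2.2.2.2.resolve_left (not_not.2 h1)) w[c] (hs c hc).1
      (hs c hc).2.1 fun hmem => by
        obtain ⟨d, hd, e⟩ := List.mem_take_iff_getElem.1 hmem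
        have := (hnd.getElem_inj_iff).1 e
        omega
    omega
  · intro i v hin
    rw [NE_iff_getElem]
    constructor
    · rintro ⟨j, hj, hji, hjv⟩
      exact hS.mono (by omega) hjv (hs j hj).2.2.2.1
    · intro hSv
      induction i with
      | zero => exact absurd hSv (h0 v)
      | succ i ih =>
        rcases (hs i (by omega)).2.2.2.2.1 v hSv with h1 | h1
        · obtain ⟨j, hj, hji, hjv⟩ := ih (by omega) h1
          exact ⟨j, hj, by omega, hjv⟩
        · exact ⟨i, by omega, by omega, h1⟩

/-! ### Simion–Schmidt -/

/-- The loop of Simion and Schmidt's algorithm makes greedy steps: `pre'` has been read, `pre` has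
been written, and `x` is the least letter of both. -/
theorem simionSchmidtAux_steps {n x : ℕ} {pre' w : Word} {pre used : List ℕ}
    (hused : ∀ b, b ∈ used ↔ b ∈ pre) (hp : IsPerm (pre' ++ w)) (hn : (pre' ++ w).length = n)
    (hlen : pre'.length = pre.length) (hx : x ∈ pre) (hx' : x ∈ pre')
    (hle : ∀ u ∈ pre, x ≤ u) (hle' : ∀ u ∈ pre', x ≤ u) :
    StepsFrom (LeastStep n (NE (pre' ++ w))) pre (simionSchmidtAux n x used w) ∧
      (simionSchmidtAux n x used w).length = w.length := by
  induction w generalizing x pre' pre used with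
  | nil => simp [simionSchmidtAux, StepsFrom]
  | cons a w ih =>
    have htake : (pre' ++ a :: w).take (pre.length + 1) = pre' ++ [a] := by
      rw [← hlen, List.take_append]
      simp [List.take_of_length_le]
    have hab := hp.mem.1 (show a ∈ pre' ++ a :: w by simp)
    have hxb := hp.mem.1 (show x ∈ pre' ++ a :: w by simp [hx'])
    have happ : pre' ++ a :: w = (pre' ++ [a]) ++ w := by simp
    unfold simionSchmidtAux
    split_ifs with hax
    · have := ih (x := a) (pre' := pre' ++ [a]) (pre := pre ++ [a]) (used := a :: used)
        (by intro b; simp [hused, or_comm]) (happ ▸ hp) (happ ▸ hn) (by simpa using hlen)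
        (by simp) (by simp)
        (by
          intro u hu
          rcases List.mem_append.1 hu with hu | hu
          · exact hax.le.trans (hle u hu)
          · simp at hu; omega)
        (by
          intro u hu
          rcases List.mem_append.1 hu with hu | hu
          · exact hax.le.trans (hle' u hu)
          · simp at hu; omega)
      rw [← happ] at this
      refine ⟨⟨⟨hab.1, hn ▸ hab.2, fun h => ?_, ?_, ?_⟩, this.1⟩, by simp [this.2]⟩
      · have := hle a h; omega
      · exact ⟨a, by rw [htake]; simp, le_rfl⟩
      · rintro b - hb ⟨u, hu, hub⟩
        rw [htake] at hu
        rcases List.mem_append.1 hu with hu | hu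
        · have := hle' u hu; omega
        · simp at hu; omega
    · have hk : pre.length < n := by rw [← hn, ← hlen]; simp
      -- the minimum lies so low that more letters above it exist than have been used
      obtain ⟨u, hu, hun⟩ := hp.NE_antidiagonal (hn ▸ hk)
      rw [hn] at hun
      rw [htake] at hu
      have hxn : x ≤ n - pre.length := by
        rcases List.mem_append.1 hu with hu | hu
        · exact (hle' u hu).trans hun
        · simp at hu; omega
      obtain ⟨b, hb1, hb2, hb3⟩ := exists_not_mem_of_length_lt (l := pre) (lo := n - pre.length)
        (m := pre.length + 1) (by omega)
      have hbx : b ≠ x := fun e => hb3 (e ▸ hx)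
      obtain ⟨c, hc⟩ : ∃ c, (List.range' (x + 1) (n - x)).find? (fun b => decide (b ∉ used)) =
          some c := by
        rw [← Option.isSome_iff_exists, List.find?_isSome]
        exact ⟨b, by rw [List.mem_range'_1]; omega, by simpa [hused] using hb3⟩
      simp only [hc, Option.getD_some]
      rw [List.find?_range'_eq_some] at hc
      obtain ⟨hc1, hc2, hc3⟩ := hc
      rw [List.mem_range'_1] at hc2
      have hcp : c ∉ pre := by simpa [hused] using hc1
      have := ih (x := x) (pre' := pre' ++ [a]) (pre := pre ++ [c]) (used := c :: used)
        (by intro b; simp [hused, or_comm]) (happ ▸ hp) (happ ▸ hn) (by simpa using hlen)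
        (by simp [hx]) (by simp [hx'])
        (by
          intro u hu
          rcases List.mem_append.1 hu with hu | hu
          · exact hle u hu
          · simp at hu; omega)
        (by
          intro u hu
          rcases List.mem_append.1 hu with hu | hu
          · exact hle' u hu
          · simp at hu; omega)
      rw [← happ] at this
      refine ⟨⟨⟨by omega, by omega, hcp, ?_, ?_⟩, this.1⟩, by simp [this.2]⟩
      · exact ⟨x, by rw [htake]; simp [hx'], by omega⟩
      · rintro b - hb ⟨u, hu, hub⟩
        rw [htake] at hu
        have hxb : x ≤ b := by
          rcases List.mem_append.1 hu with hu | hu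
          · exact (hle' u hu).trans hub
          · simp at hu; omega
        rcases hxb.eq_or_lt with rfl | hxb
        · exact hx
        · have := hc3 b (by omega) hb
          simpa [hused] using this

theorem simionSchmidt_steps {w : Word} (h : IsPerm w) :
    StepsFrom (LeastStep w.length (NE w)) [] (simionSchmidt w) ∧
      (simionSchmidt w).length = w.length := by
  cases w with
  | nil => simp [simionSchmidt, StepsFrom]
  | cons a w =>
    have := simionSchmidtAux_steps (n := w.length + 1) (x := a) (pre' := [a]) (w := w)
      (pre := [a]) (used := [a]) (by simp) h (by simp) rfl (by simp) (by simp) (by simp) (by simp)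
    have hab := h.mem.1 (show a ∈ a :: w by simp)
    refine ⟨⟨⟨hab.1, hab.2, by simp, ⟨a, by simp, le_rfl⟩, ?_⟩, this.1⟩, ?_⟩
    · rintro b - hb ⟨u, hu, hub⟩
      simp at hu; omega
    · simp [simionSchmidt, this.2]

theorem NE_iff_of_bounded {w : Word} (h : IsPerm w) {S : ℕ → ℕ → Prop}
    (hS : ∀ i v, 1 ≤ i → i ≤ w.length → 1 ≤ v → (NE w i v ↔ S i v)) {w' : Word} (h' : IsPerm w')
    (hl : w'.length = w.length)
    (hS' : ∀ i v, 1 ≤ i → i ≤ w.length → 1 ≤ v → (NE w' i v ↔ S i v)) :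
    ∀ i v, NE w i v ↔ NE w' i v := by
  intro i v
  rcases Nat.eq_zero_or_pos i with rfl | hi
  · simp [NE]
  rcases Nat.eq_zero_or_pos v with rfl | hv
  · exact iff_of_false (NE_zero_right h i) (NE_zero_right h' i)
  rcases le_or_gt i w.length with hin | hin
  · exact (hS i v hi hin hv).trans (hS' i v hi hin hv).symm
  · rw [NE_length_le hin.le, NE_length_le (w := w') (by omega), hl]
    rcases Nat.eq_zero_or_pos w.length with h0 | h0
    · simp [NE, h0]
    · exact (hS _ v h0 le_rfl hv).trans (hS' _ v h0 le_rfl hv).symm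

/-- Simion and Schmidt's map keeps the left-to-right minima. -/
theorem simionSchmidt_spec {w : Word} (h : IsPerm w) :
    simionSchmidt w ∈ Av [1, 3, 2] ∧ (simionSchmidt w).length = w.length ∧
      ∀ i v, NE (simionSchmidt w) i v ↔ NE w i v := by
  obtain ⟨h1, h2⟩ := simionSchmidt_steps h
  obtain ⟨h3, h4⟩ := leastSteps_spec h.isRegion_NE h2 h1
  refine ⟨h3, h2, NE_iff_of_bounded h3.1 (S := NE w) ?_ h h2.symm (fun _ _ _ _ _ => Iff.rfl)⟩
  rw [h2]
  exact h4

theorem sameMinima_of_simionSchmidt {π : Word} (h : π ∈ Av [3, 2, 1]) :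
    SameMinima π (PermBij.inverse (simionSchmidt π.reverse)) := by
  obtain ⟨h1, h2, h3⟩ := simionSchmidt_spec h.1.reverse
  refine ⟨h, inverse_mem_Av_132 h1, by simp [h2], fun i v => ?_⟩
  rw [NE_inverse h1.1, h3]

theorem holds_simionSchmidt_iff (π σ : Word) :
    Composite.graph ⟨[.i], .SimionSchmidt, false, [.r]⟩ π σ ↔ SameMinima π σ := by
  constructor
  · rintro ⟨-, ρ, rfl, h, rfl⟩
    exact sameMinima_of_simionSchmidt (reverse_mem_Av_123.1 h)
  · intro h
    refine ⟨h.1.1, simionSchmidt π.reverse, ?_, reverse_mem_Av_123.2 h.1, rfl⟩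
    exact h.right_unique (sameMinima_of_simionSchmidt h.1)

/-! ### Lattice paths -/

/-- The up-step number `k` of the path precedes the down-step number `j` (both counted from
zero); a down-step that is missing counts as lying behind the whole path. -/
def Precedes : Path → ℕ → ℕ → Prop
  | [], _, _ => False
  | .U :: P, k, j => k = 0 ∨ Precedes P (k - 1) j
  | .D :: P, k, j => j ≠ 0 ∧ Precedes P k (j - 1)

theorem precedes_append (P Q : Path) (k j : ℕ) :
    Precedes (P ++ Q) k j ↔ Precedes P k j ∨
      (P.count .U ≤ k ∧ P.count .D ≤ j ∧ Precedes Q (k - P.count .U) (j - P.count .D)) := by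
  induction P generalizing k j with
  | nil => simp [Precedes]
  | cons s P ih =>
    cases s with
    | U =>
      have e : (DyckStep.U :: P).count .D = P.count .D := by simp
      simp only [List.cons_append, Precedes, ih, List.count_cons_self, e]
      rw [Nat.sub_sub, Nat.add_comm 1]
      rcases Nat.eq_zero_or_pos k with rfl | hk
      · simp
      · constructor
        · rintro (h | h | ⟨h1, h2, h3⟩)
          · omega
          · exact Or.inl (Or.inr h)
          · exact Or.inr ⟨by omega, h2, h3⟩
        · rintro ((h | h) | ⟨h1, h2, h3⟩)
          · omega
          · exact Or.inr (Or.inl h)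
          · exact Or.inr (Or.inr ⟨by omega, h2, h3⟩)
    | D =>
      have e : (DyckStep.D :: P).count .U = P.count .U := by simp
      simp only [List.cons_append, Precedes, ih, List.count_cons_self, e]
      rw [Nat.sub_sub, Nat.add_comm 1]
      rcases Nat.eq_zero_or_pos j with rfl | hj
      · simp
      · constructor
        · rintro ⟨h0, h | ⟨h1, h2, h3⟩⟩
          · exact Or.inl ⟨h0, h⟩
          · exact Or.inr ⟨h1, by omega, h3⟩
        · rintro (⟨h0, h⟩ | ⟨h1, h2, h3⟩)
          · exact ⟨h0, Or.inl h⟩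
          · exact ⟨by omega, Or.inr ⟨h1, by omega, h3⟩⟩

theorem precedes_of_lt {P : Path} {k j : ℕ} (hk : k < P.count .U) (hj : P.count .D ≤ j) :
    Precedes P k j := by
  induction P generalizing k j with
  | nil => simp at hk
  | cons s P ih =>
    cases s with
    | U =>
      simp only [List.count_cons_self] at hk
      simp at hj
      rcases Nat.eq_zero_or_pos k with rfl | hk0
      · exact Or.inl rfl
      · exact Or.inr (ih (by omega) (by omega))
    | D =>
      simp only [List.count_cons_self] at hj
      simp at hk
      exact ⟨by omega, ih (by omega) (by omega)⟩

theorem not_precedes_of_le {P : Path} {k j : ℕ} (hk : P.count .U ≤ k) : ¬ Precedes P k j := by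
  induction P generalizing k j with
  | nil => simp [Precedes]
  | cons s P ih =>
    cases s with
    | U =>
      simp only [List.count_cons_self] at hk
      rintro (h | h)
      · omega
      · exact ih (by omega) h
    | D =>
      simp at hk
      rintro ⟨-, h⟩
      exact ih (by omega) h

theorem precedes_replicate_U (m : ℕ) (P : Path) (k j : ℕ) :
    Precedes (List.replicate m .U ++ P) k j ↔ k < m ∨ Precedes P (k - m) j := by
  induction m generalizing k with
  | zero => simp
  | succ m ih =>
    simp only [List.replicate_succ, List.cons_append, Precedes, ih]
    rw [Nat.sub_sub, Nat.add_comm 1]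
    constructor
    · rintro (h | h | h)
      · exact Or.inl (by omega)
      · exact Or.inl (by omega)
      · exact Or.inr h
    · rintro (h | h)
      · omega
      · exact Or.inr (Or.inr h)

/-- A path is determined by the order relation between its up-steps and its down-steps. -/
theorem path_ext {P Q : Path} (hU : P.count .U = Q.count .U) (hD : P.count .D = Q.count .D)
    (h : ∀ k j, k < P.count .U → j < P.count .D → (Precedes P k j ↔ Precedes Q k j)) : P = Q := by
  induction P generalizing Q with
  | nil =>
    cases Q with
    | nil => rfl
    | cons s Q => cases s <;> simp at hU hD
  | cons s P ih =>
    cases Q with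
    | nil => cases s <;> simp at hU hD
    | cons s' Q =>
      cases s <;> cases s' <;> simp at hU hD
      · congr 1
        refine ih hU hD fun k j hk hj => ?_
        simpa [Precedes] using h (k + 1) j (by simpa using hk) (by simpa using hj)
      · have := h 0 0 (by simp) (by simp [-List.count_pos_iff]; omega)
        simp [Precedes] at this
      · have := h 0 0 (by simp [-List.count_pos_iff]; omega) (by simp)
        simp [Precedes] at this
      · congr 1
        refine ih hU hD fun k j hk hj => ?_
        simpa [Precedes] using h k (j + 1) (by simpa using hk) (by simpa using hj)

theorem count_reflect (P : Path) :
    (reflect P).count .U = P.count .D ∧ (reflect P).count .D = P.count .U := by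
  induction P with
  | nil => simp [reflect]
  | cons s P ih =>
    have e : reflect (s :: P) = reflect P ++ [swapStep s] := by simp [reflect]
    rw [e]
    cases s <;> simp [swapStep, ih.1, ih.2]

theorem precedes_reflect {P : Path} {k j : ℕ} (hk : k < P.count .D) (hj : j < P.count .U) :
    Precedes (reflect P) k j ↔ Precedes P (P.count .U - 1 - j) (P.count .D - 1 - k) := by
  induction P generalizing k j with
  | nil => simp at hk
  | cons s P ih =>
    have e : reflect (s :: P) = reflect P ++ [swapStep s] := by simp [reflect]
    rw [e, precedes_append, (count_reflect P).1, (count_reflect P).2]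
    cases s with
    | U =>
      have e' : (DyckStep.U :: P).count .D = P.count .D := by simp
      rw [e'] at hk ⊢
      simp only [List.count_cons_self] at hj ⊢
      simp only [Precedes]
      rcases Nat.lt_or_ge j (P.count .U) with hj' | hj'
      · rw [ih hk hj', show P.count .U + 1 - 1 - j - 1 = P.count .U - 1 - j by omega]
        constructor
        · rintro (h | h)
          · exact Or.inr h
          · omega
        · rintro (h | h)
          · omega
          · exact Or.inl h
      · exact iff_of_true (Or.inl (precedes_of_lt (by rw [(count_reflect P).1]; omega)
          (by rw [(count_reflect P).2]; omega))) (Or.inl (by omega))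
    | D =>
      have e' : (DyckStep.D :: P).count .U = P.count .U := by simp
      rw [e'] at hj ⊢
      simp only [List.count_cons_self] at hk ⊢
      simp only [Precedes]
      rcases Nat.lt_or_ge k (P.count .D) with hk' | hk'
      · rw [ih hk' hj, show P.count .D + 1 - 1 - k - 1 = P.count .D - 1 - k by omega]
        constructor
        · rintro (h | h)
          · exact ⟨by omega, h⟩
          · omega
        · rintro ⟨h, h'⟩
          exact Or.inl h'
      · refine iff_of_false ?_ (fun h => h.1 (by omega))
        rintro (h | h)
        · exact not_precedes_of_le (by rw [(count_reflect P).1]; omega) h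
        · omega

theorem precedes_reverse {P : Path} {k j : ℕ} (hk : k < P.count .U) (hj : j < P.count .D) :
    Precedes P.reverse k j ↔ ¬ Precedes P (P.count .U - 1 - k) (P.count .D - 1 - j) := by
  induction P generalizing k j with
  | nil => simp at hk
  | cons s P ih =>
    rw [List.reverse_cons, precedes_append, List.count_reverse, List.count_reverse]
    cases s with
    | U =>
      have e' : (DyckStep.U :: P).count .D = P.count .D := by simp
      rw [e'] at hj ⊢
      simp only [List.count_cons_self] at hk ⊢
      simp only [Precedes]
      rcases Nat.lt_or_ge k (P.count .U) with hk' | hk'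
      · rw [ih hk' hj, show P.count .U + 1 - 1 - k - 1 = P.count .U - 1 - k by omega]
        constructor
        · rintro (h | h)
          · rintro (h' | h')
            · omega
            · exact h h'
          · omega
        · intro h
          exact Or.inl fun h' => h (Or.inr h')
      · refine iff_of_false ?_ (not_not.2 (Or.inl (by omega)))
        rintro (h | h)
        · exact not_precedes_of_le (by rw [List.count_reverse]; omega) h
        · omega
    | D =>
      have e' : (DyckStep.D :: P).count .U = P.count .U := by simp
      rw [e'] at hk ⊢
      simp only [List.count_cons_self] at hj ⊢
      simp only [Precedes]
      rcases Nat.lt_or_ge j (P.count .D) with hj' | hj'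
      · rw [ih hk hj', show P.count .D + 1 - 1 - j - 1 = P.count .D - 1 - j by omega]
        constructor
        · rintro (h | h)
          · rintro ⟨-, h'⟩
            exact h h'
          · omega
        · intro h
          exact Or.inl fun h' => h ⟨by omega, h'⟩
      · exact iff_of_true (Or.inl (precedes_of_lt (by rw [List.count_reverse]; omega)
          (by rw [List.count_reverse]; omega))) fun h => h.1 (by omega)

/-! ### The path of a 132-avoiding permutation -/

theorem countP_gt_eq {n m : ℕ} {w : Word} (h : IsPerm w) (hn : w.length = n) (hm : m ≤ n) :
    w.countP (m < ·) = n - m := by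
  rw [List.Perm.countP_eq _ h, hn]
  have : ∀ n m : ℕ, m ≤ n → (List.range' 1 n).countP (m < ·) = n - m := by
    intro n
    induction n with
    | zero => simp
    | succ n ih =>
      intro m hm
      rw [List.range'_1_concat, List.countP_append]
      rcases Nat.lt_or_ge n m with h | h
      · have : m = n + 1 := by omega
        subst this
        rw [List.countP_eq_zero.2]
        · simp; omega
        · intro a ha
          rw [List.mem_range'_1] at ha
          simp; omega
      · rw [ih m h]
        have : m < 1 + n := by omega
        simp [this]; omega
  exact this n m hm

/-- The height `h` reached by `heightPathAux` after the letters `pre` is governed by their least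
letter `m`, with `m = n + 1` at the start: the letters larger than `m` are those of `pre` other
than `m` and `h` further ones. -/
theorem heightPathAux_step {pre w : Word} {x m n h : ℕ} (hp : IsPerm (pre ++ x :: w))
    (hn : (pre ++ x :: w).length = n) (ha : Avoids [1, 3, 2] (pre ++ x :: w))
    (hm : (pre = [] ∧ m = n + 1) ∨ m ∈ pre) (hle : ∀ u ∈ pre, m ≤ u)
    (hh : h + pre.length + m = n + 1) :
    (w.countP (x < ·) + 1 - h) + (h + pre.length) = n + 1 - min m x ∧
      w.countP (x < ·) + (pre ++ [x]).length + min m x = n + 1 := by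
  have hx := hp.mem.1 (show x ∈ pre ++ x :: w by simp)
  have hnd := hp.nodup
  have hxpre : x ∉ pre := fun h => by
    have := List.disjoint_of_nodup_append hnd h
    simp at this
  have c1 := countP_gt_eq hp hn (m := x) (by omega)
  simp only [List.countP_append, List.countP_cons, lt_irrefl, decide_false] at c1
  rcases lt_or_ge x m with hlt | hge
  · have c2 : pre.countP (x < ·) = pre.length := by
      rw [List.countP_eq_length]
      intro u hu
      have := hle u hu
      simp; omega
    rw [min_eq_right hlt.le]
    simp at c1 ⊢
    omega
  · have hmem : m ∈ pre := by
      rcases hm with ⟨-, h⟩ | h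
      · omega
      · exact h
    have hmx : m < x := lt_of_le_of_ne hge fun e => hxpre (e ▸ hmem)
    have c3 := countP_gt_eq hp hn (m := m) (by omega)
    -- avoidance of 132: the letters to the right that exceed the minimum `m` exceed `x`
    have c4 : w.countP (m < ·) = w.countP (x < ·) := by
      refine List.countP_congr fun u hu => ?_
      simp only [decide_eq_true_eq]
      refine ⟨fun h => ?_, fun h => by omega⟩
      by_contra hux
      have hne : u ≠ x := fun e => by
        subst e
        have := (List.nodup_append.1 hnd).2.1
        simp at this
        exact this.1 hu
      exact avoids_iff_132.1 ha m x u (three_sublist_of_mem hmem hu) h (by omega)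
    have c5 : pre.countP (m < ·) + 1 = pre.length := by
      have : (pre.filter (· ≠ m)).length + 1 = pre.length := by
        have h1 := List.length_eq_countP_add_countP (fun u => decide (u ≠ m)) (l := pre)
        rw [← List.countP_eq_length_filter]
        have h2 : pre.count m = 1 :=
          List.count_eq_one_of_mem (List.nodup_append.1 hnd).1 hmem
        rw [List.count] at h2
        have h3 : pre.countP (fun a => ¬ decide (a ≠ m) = true) = pre.countP (· == m) := by
          refine List.countP_congr fun u _ => by simp
        omega
      rw [← this, List.countP_eq_length_filter]
      congr 2
      refine List.filter_congr fun u hu => ?_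
      have := hle u hu
      exact decide_eq_decide.2 ⟨fun h => by omega, fun h => by omega⟩
    simp only [List.countP_append, List.countP_cons, hmx, decide_true] at c3
    rw [min_eq_left hmx.le]
    simp at c1 c3 ⊢
    omega

theorem heightPathAux_spec {pre w : Word} {m n h : ℕ} (hp : IsPerm (pre ++ w))
    (hn : (pre ++ w).length = n) (ha : Avoids [1, 3, 2] (pre ++ w))
    (hm : (pre = [] ∧ m = n + 1) ∨ m ∈ pre) (hle : ∀ u ∈ pre, m ≤ u)
    (hh : h + pre.length + m = n + 1) :
    (heightPathAux h w).count .D = w.length ∧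
    h + pre.length + (heightPathAux h w).count .U = n ∧
    ∀ k j, j < w.length → h + pre.length + k < n →
      (Precedes (heightPathAux h w) k j ↔
        NE (pre ++ w) (pre.length + j + 1) (n - (h + pre.length + k))) := by
  induction w generalizing pre m h with
  | nil =>
    have hm1 : m = 1 := by
      simp only [List.append_nil] at hp hn
      rcases hm with ⟨rfl, rfl⟩ | hm
      · simp at hn; omega
      · have h1 := hp.mem.1 hm
        have h2 : 1 ∈ pre := hp.mem.2 (by omega)
        have := hle 1 h2
        omega
    simp [heightPathAux]
    omega
  | cons x w ih =>
    obtain ⟨s1, s2⟩ := heightPathAux_step hp hn ha hm hle hh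
    have hx := hp.mem.1 (show x ∈ pre ++ x :: w by simp)
    have happ : pre ++ x :: w = (pre ++ [x]) ++ w := by simp
    have hmem : min m x ∈ pre ++ [x] := by
      rcases hm with ⟨h1, h2⟩ | hm
      · rw [min_eq_right (by omega)]; simp
      · rcases le_total m x with h | h
        · rw [min_eq_left h]; simp [hm]
        · rw [min_eq_right h]; simp
    have hle' : ∀ u ∈ pre ++ [x], min m x ≤ u := by
      intro u hu
      rcases List.mem_append.1 hu with hu | hu
      · exact (min_le_left _ _).trans (hle u hu)
      · simp at hu; simp [hu]
    have hmin1 : 1 ≤ min m x := by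
      have := (hp.mem.1 (happ ▸ List.mem_append_left w hmem)).1
      exact this
    obtain ⟨i1, i2, i3⟩ := ih (pre := pre ++ [x]) (m := min m x) (h := w.countP (x < ·))
      (happ ▸ hp) (happ ▸ hn) (happ ▸ ha) (Or.inr hmem) hle' s2
    rw [← happ] at i3
    have hU : ∀ (l : ℕ) (P : Path), (List.replicate l DyckStep.U ++ .D :: P).count .U =
        l + P.count .U := by intro l P; simp
    have hD : ∀ (l : ℕ) (P : Path), (List.replicate l DyckStep.U ++ .D :: P).count .D =
        P.count .D + 1 := by intro l P; simp [List.count_replicate]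
    simp only [heightPathAux]
    rw [hU, hD]
    simp only [List.length_append, List.length_cons, List.length_nil] at i2 s2
    refine ⟨by simp [i1], by omega, fun k j hj hk => ?_⟩
    rw [precedes_replicate_U]
    cases j with
    | zero =>
      have : Precedes (.D :: heightPathAux (w.countP (x < ·)) w)
          (k - (w.countP (x < ·) + 1 - h)) 0 ↔ False := by simp [Precedes]
      rw [this, or_false]
      have ht : (pre ++ x :: w).take (pre.length + 0 + 1) = pre ++ [x] := by
        rw [List.take_append]; simp [List.take_of_length_le]
      unfold NE
      rw [ht]
      constructor
      · intro h1
        exact ⟨_, hmem, by omega⟩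
      · rintro ⟨u, hu, hun⟩
        have := hle' u hu
        omega
    | succ j =>
      have i3' := i3 (k - (w.countP (x < ·) + 1 - h)) j (by simpa using hj)
      have hD' : Precedes (.D :: heightPathAux (w.countP (x < ·)) w)
          (k - (w.countP (x < ·) + 1 - h)) (j + 1) ↔
          Precedes (heightPathAux (w.countP (x < ·)) w)
          (k - (w.countP (x < ·) + 1 - h)) j := by simp [Precedes]
      rw [hD']
      simp only [List.length_append, List.length_cons, List.length_nil] at i3'
      rcases lt_or_ge k (w.countP (x < ·) + 1 - h) with hlt | hge
      · refine iff_of_true (Or.inl hlt) ?_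
        refine NE_iff_getElem.2 ?_
        obtain ⟨i, hi, e⟩ := List.mem_iff_getElem.1 hmem
        refine ⟨i, ?_, ?_, ?_⟩
        · simp at hi ⊢; omega
        · simp at hi; omega
        · have : (pre ++ x :: w)[i]'(by simp at hi ⊢; omega) = min m x := by
            rw [← e]
            simp only [happ]
            exact List.getElem_append_left hi
          rw [this]; omega
      · have e2 : w.countP (x < ·) + (pre.length + (0 + 1)) +
            (k - (w.countP (x < ·) + 1 - h)) = h + pre.length + k := by omega
        rw [e2] at i3'
        rw [i3' (by omega), or_iff_right (by omega)]
        rw [show pre.length + (0 + 1) + j + 1 = pre.length + (j + 1) + 1 by omega]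

/-- The path of a 132-avoiding permutation is the boundary of the region above its
left-to-right minima. -/
theorem heightPath_spec {w : Word} (h : w ∈ Av [1, 3, 2]) :
    (heightPath w).count .D = w.length ∧ (heightPath w).count .U = w.length ∧
    ∀ k j, j < w.length → k < w.length →
      (Precedes (heightPath w) k j ↔ NE w (j + 1) (w.length - k)) := by
  have := heightPathAux_spec (pre := []) (w := w) (m := w.length + 1) (n := w.length) (h := 0)
    h.1 rfl h.2 (Or.inl ⟨rfl, rfl⟩) (by simp) (by simp)
  simp only [List.length_nil, Nat.zero_add, List.nil_append] at this
  exact this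

theorem heightPathAux_append {L R : Word} {n h : ℕ} (hLR : ∀ l ∈ L, ∀ r ∈ R, r < l)
    (hL : ∀ l ∈ L, l < n) (hR : ∀ r ∈ R, r < n) (hh : L = [] → h = 0) :
    heightPathAux (h + 1) (L ++ n :: R) = heightPathAux h L ++ .D :: heightPathAux 0 R := by
  induction L generalizing h with
  | nil =>
    have : R.countP (n < ·) = 0 := by
      rw [List.countP_eq_zero]
      intro r hr
      have := hR r hr
      simp; omega
    simp [heightPathAux, this, hh rfl]
  | cons x L ih =>
    have hc : (L ++ n :: R).countP (x < ·) = L.countP (x < ·) + 1 := by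
      have h1 : R.countP (x < ·) = 0 := by
        rw [List.countP_eq_zero]
        intro r hr
        have := hLR x (by simp) r hr
        simp; omega
      have h2 := hL x (by simp)
      simp [List.countP_append, h1, h2]
    simp only [List.cons_append, heightPathAux, hc]
    rw [ih (fun l hl => hLR l (by simp [hl])) (fun l hl => hL l (by simp [hl]))
      (fun e => by simp [e])]
    simp

theorem heightPath_append {L R : Word} {n : ℕ} (hLR : ∀ l ∈ L, ∀ r ∈ R, r < l)
    (hL : ∀ l ∈ L, l < n) (hR : ∀ r ∈ R, r < n) :
    heightPath (L ++ n :: R) = .U :: heightPath L ++ .D :: heightPath R := by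
  have h0 : ∀ w : Word, w ≠ [] → heightPathAux 0 w = .U :: heightPathAux 1 w := by
    intro w hw
    cases w with
    | nil => exact absurd rfl hw
    | cons x w => simp [heightPathAux, List.replicate_succ]
  unfold heightPath
  rw [h0 _ (by simp), heightPathAux_append hLR hL hR fun _ => rfl]
  simp

theorem foldr_max_spec (a : ℕ) (v : Word) :
    (a :: v).foldr max 0 ∈ a :: v ∧ ∀ x ∈ a :: v, x ≤ (a :: v).foldr max 0 := by
  induction v generalizing a with
  | nil => simp
  | cons b v ih =>
    obtain ⟨h1, h2⟩ := ih b
    rw [List.foldr_cons]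
    constructor
    · rcases le_total a ((b :: v).foldr max 0) with h | h
      · rw [max_eq_right h]; exact List.mem_cons_of_mem _ h1
      · rw [max_eq_left h]; simp
    · intro x hx
      rcases List.mem_cons.1 hx with rfl | hx
      · exact le_max_left _ _
      · exact (h2 x hx).trans (le_max_right _ _)

/-- The standard decomposition of a nonempty word at its largest letter. -/
theorem takeWhile_dropWhile_max {w : Word} {m : ℕ} (h : m ∈ w) :
    w = w.takeWhile (· ≠ m) ++ m :: (w.dropWhile (· ≠ m)).tail := by
  induction w with
  | nil => simp at h
  | cons a w ih =>
    rcases eq_or_ne a m with rfl | hne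
    · simp
    · have := ih (by simpa [hne.symm] using h)
      simp only [List.takeWhile_cons, List.dropWhile_cons, hne, ne_eq, not_false_eq_true,
        decide_true, if_true, List.cons_append]
      congr 1

theorem stdPathAux_eq_heightPath {w : Word} {k : ℕ} (hnd : w.Nodup) (ha : Avoids [1, 3, 2] w)
    (hk : w.length ≤ k) : stdPathAux k w = heightPath w := by
  induction k generalizing w with
  | zero =>
    have : w = [] := List.length_eq_zero_iff.1 (by omega)
    subst this
    rfl
  | succ k ih =>
    cases w with
    | nil => rfl
    | cons a v =>
      obtain ⟨h1, h2⟩ := foldr_max_spec a v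
      have hdec := takeWhile_dropWhile_max h1
      simp only [stdPathAux]
      generalize (a :: v).foldr max 0 = m at *
      generalize (a :: v).takeWhile (· ≠ m) = L at *
      generalize ((a :: v).dropWhile (· ≠ m)).tail = R at *
      rw [hdec] at hnd h2 ha hk ⊢
      have hsL : L.Sublist (L ++ m :: R) := List.sublist_append_left _ _
      have hsR : R.Sublist (L ++ m :: R) :=
        (List.sublist_cons_self _ _).trans (List.sublist_append_right _ _)
      rw [avoids_iff_132] at ha
      rw [List.nodup_append] at hnd
      obtain ⟨n1, n2, n3⟩ := hnd
      rw [List.nodup_cons] at n2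
      have hL : ∀ l ∈ L, l < m := fun l hl =>
        lt_of_le_of_ne (h2 l (by simp [hl])) (n3 l hl m (by simp))
      have hR : ∀ r ∈ R, r < m := fun r hr =>
        lt_of_le_of_ne (h2 r (by simp [hr])) fun e => n2.1 (e ▸ hr)
      simp only [List.length_append, List.length_cons] at hk
      rw [ih n1 (avoids_iff_132.2 fun x y z h => ha x y z (h.trans hsL)) (by omega),
        ih n2.2 (avoids_iff_132.2 fun x y z h => ha x y z (h.trans hsR)) (by omega),
        heightPath_append ?_ hL hR]
      intro l hl r hr
      by_contra hlr
      have : l ≠ r := n3 l hl r (by simp [hr])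
      exact ha l m r (three_sublist_of_mem hl hr) (by omega) (hR r hr)

theorem stdPath_eq_heightPath {w : Word} (h : w ∈ Av [1, 3, 2]) : stdPath w = heightPath w :=
  stdPathAux_eq_heightPath h.1.nodup h.2 le_rfl

theorem NE_iff_of_box {w w' : Word} (h : IsPerm w) (h' : IsPerm w') (hl : w'.length = w.length)
    (hNE : ∀ k j, k < w.length → j < w.length →
      (NE w (j + 1) (w.length - k) ↔ NE w' (j + 1) (w.length - k))) :
    ∀ i v, NE w i v ↔ NE w' i v := by
  refine NE_iff_of_bounded h (S := NE w') (fun i v hi hin hv => ?_) h' hl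
    (fun _ _ _ _ _ => Iff.rfl)
  have hbig : ∀ u : Word, IsPerm u → u.length = w.length → w.length ≤ v →
      (NE u i v ↔ NE u i w.length) := by
    intro u hu hul hv
    constructor
    · rintro ⟨x, hx, -⟩
      exact ⟨x, hx, hul ▸ (hu.mem.1 (List.mem_of_mem_take hx)).2⟩
    · rintro ⟨x, hx, hxv⟩
      exact ⟨x, hx, hxv.trans hv⟩
  rcases le_or_gt v w.length with hvn | hvn
  · have := hNE (w.length - v) (i - 1) (by omega) (by omega)
    rwa [show i - 1 + 1 = i by omega, show w.length - (w.length - v) = v by omega] at this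
  · rw [hbig w h rfl hvn.le, hbig w' h' hl hvn.le]
    have := hNE 0 (i - 1) (by omega) (by omega)
    rwa [show i - 1 + 1 = i by omega, Nat.sub_zero] at this

/-! ### Krattenthaler -/

theorem krattenthalerAux_count {m N : ℕ} {w : Word} (hw : ∀ u ∈ w, u ≤ N) (hm : m ≤ N)
    (hN : N ∈ w ∨ m = N) :
    (krattenthalerAux m w).count .D = w.length ∧ m + (krattenthalerAux m w).count .U = N := by
  induction w generalizing m with
  | nil => simpa [krattenthalerAux] using hN
  | cons x w ih =>
    have hx := hw x (by simp)
    obtain ⟨h1, h2⟩ := ih (m := max m x) (fun u hu => hw u (by simp [hu])) (by omega) (by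
      simp only [List.mem_cons] at hN
      rcases hN with (h | h) | h
      · right; omega
      · exact Or.inl h
      · right; omega)
    simp only [krattenthalerAux, List.count_append, List.count_cons, List.count_replicate]
    simp
    omega

theorem precedes_krattenthalerAux {m k j : ℕ} {w : Word} (hj : j < w.length) :
    Precedes (krattenthalerAux m w) k j ↔ ∃ u ∈ w.take (j + 1), m + k < u := by
  induction w generalizing m k j with
  | nil => simp at hj
  | cons x w ih =>
    simp only [krattenthalerAux, precedes_replicate_U, Precedes]
    cases j with
    | zero =>
      simp
      omega
    | succ j =>
      simp only [List.length_cons] at hj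
      rw [Nat.add_sub_cancel, ih (by omega)]
      simp only [List.take_succ_cons, List.mem_cons, exists_eq_or_imp]
      rcases Nat.lt_or_ge k (x - m) with h | h
      · exact iff_of_true (Or.inl h) (Or.inl (by omega))
      · rw [show max m x + (k - (x - m)) = m + k by omega]
        exact or_congr (by omega) (and_iff_right (by omega))

/-- Krattenthaler's path of the reversed inverse of `π` is the boundary of the region given by the
right-to-left minima of `π`. -/
theorem krattenthaler_precedes {π : Word} (h : IsPerm π) {k j : ℕ} (hk : k < π.length)
    (hj : j < π.length) :
    Precedes (reflect (krattenthalerAux 0 (PermBij.inverse π))) k j ↔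
      NE π.reverse (j + 1) (π.length - k) := by
  obtain ⟨c1, c2⟩ := krattenthalerAux_count (m := 0) (N := π.length) (w := PermBij.inverse π)
    (fun u hu => by simpa using (h.inverse.mem.1 hu).2) (Nat.zero_le _)
    (Or.inl (h.inverse.mem.2 (by simp; omega)))
  simp only [length_inverse, Nat.zero_add] at c1 c2
  rw [precedes_reflect (by omega) (by omega), c1, c2, precedes_krattenthalerAux (by simp; omega),
    NE_reverse, SE_iff_getElem]
  constructor
  · rintro ⟨u, hu, hlt⟩
    obtain ⟨q, hq, rfl⟩ := List.mem_take_iff_getElem.1 hu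
    simp only [length_inverse] at hq
    obtain ⟨h1, e1⟩ := h.getElem_of_inverse (v := q) (by omega)
    exact ⟨_, h1, by omega, by omega⟩
  · rintro ⟨p, hp, hle, hv⟩
    have hb := h.getElem_bounds hp
    have := (h.inverse_getElem_eq_iff (j := p) (v := π[p] - 1) hp (by omega)).2 (by omega)
    refine ⟨p + 1, List.mem_take_iff_getElem.2 ⟨π[p] - 1, by simp; omega, this⟩, by omega⟩

theorem krattenthaler_path_eq_iff {π ρ : Word} (h : IsPerm π) (hρ : ρ ∈ Av [1, 3, 2]) :
    reflect (krattenthalerAux 0 (PermBij.inverse π)) = heightPath ρ ↔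
      π.length = ρ.length ∧ ∀ i v, NE π.reverse i v ↔ NE ρ i v := by
  obtain ⟨s1, s2, s3⟩ := heightPath_spec hρ
  have c : (krattenthalerAux 0 (PermBij.inverse π)).count .D = π.length ∧
      (krattenthalerAux 0 (PermBij.inverse π)).count .U = π.length := by
    have := krattenthalerAux_count (m := 0) (N := π.length) (w := PermBij.inverse π)
      (fun u hu => by simpa using (h.inverse.mem.1 hu).2) (Nat.zero_le _) (by
        rcases Nat.eq_zero_or_pos π.length with h0 | h0
        · exact Or.inr h0.symm
        · exact Or.inl (h.inverse.mem.2 (by simp; omega)))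
    simpa using this
  have cr := count_reflect (krattenthalerAux 0 (PermBij.inverse π))
  constructor
  · intro e
    have hl : π.length = ρ.length := by rw [← s2, ← e, cr.1, c.1]
    refine ⟨hl, NE_iff_of_box h.reverse hρ.1 (by simp [hl]) fun k j hk hj => ?_⟩
    simp only [List.length_reverse] at *
    rw [← krattenthaler_precedes h hk hj, e, s3 k j (by omega) (by omega), hl]
  · rintro ⟨hl, hNE⟩
    refine path_ext (by rw [cr.1, c.1, s2, hl]) (by rw [cr.2, c.2, s1, hl]) fun k j hk hj => ?_
    rw [cr.1, c.1] at hk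
    rw [cr.2, c.2] at hj
    rw [krattenthaler_precedes h hk hj, s3 k j (by omega) (by omega), hNE, hl]

theorem holds_krattenthaler_iff (π σ : Word) :
    Composite.graph ⟨[.i], .Krattenthaler, false, [.r, .i]⟩ π σ ↔ SameMinima π σ := by
  have hpath : ∀ ρ, KrattenthalerGraph (PermBij.inverse π).reverse ρ ↔
      ((PermBij.inverse π).reverse ∈ Av [1, 2, 3] ∧ ρ ∈ Av [1, 3, 2] ∧
        reflect (krattenthalerAux 0 (PermBij.inverse π)) = heightPath ρ) := by
    intro ρ
    simp [KrattenthalerGraph, krattenthalerPath]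
  constructor
  · rintro ⟨h1, ρ, rfl, h2⟩
    obtain ⟨h3, h4, h5⟩ := (hpath ρ).1 h2
    obtain ⟨hl, hNE⟩ := (krattenthaler_path_eq_iff h1 h4).1 h5
    have h6 := inverse_mem_Av_321 (reverse_mem_Av_123.1 h3)
    rw [inverse_inverse h1] at h6
    refine ⟨h6, inverse_mem_Av_132 h4, by simpa [act, Sym.act] using hl, fun i v => ?_⟩
    exact (hNE i v).trans (NE_inverse h4.1).symm
  · intro h
    refine ⟨h.1.1, PermBij.inverse σ, (inverse_inverse h.2.1.1).symm, ?_⟩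
    refine (hpath _).2 ⟨reverse_mem_Av_123.2 (inverse_mem_Av_321 h.1),
      inverse_mem_Av_132 h.2.1, ?_⟩
    rw [krattenthaler_path_eq_iff h.1.1 (inverse_mem_Av_132 h.2.1)]
    exact ⟨by simpa using h.2.2.1, fun i v => (h.2.2.2 i v).trans (NE_inverse h.2.1.1).symm⟩

/-! ### Knuth–Rotem and Reifegerste -/

theorem barPath_count {n h : ℕ} {b : List ℕ} (hb : ∀ x ∈ b, h ≤ x) (hs : b.Pairwise (· ≤ ·))
    (hn : ∀ x ∈ b, x ≤ n) :
    (barPath n h b).count .D = b.length ∧ (barPath n h b).count .U = n - h := by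
  induction b generalizing h with
  | nil => simp [barPath, List.count_replicate]
  | cons x b ih =>
    rw [List.pairwise_cons] at hs
    obtain ⟨h1, h2⟩ := ih hs.1 hs.2 (fun y hy => hn y (by simp [hy]))
    have := hb x (by simp)
    have := hn x (by simp)
    simp [barPath, List.count_replicate, h1, h2]
    omega

theorem precedes_barPath {n h k j : ℕ} {b : List ℕ} (hb : ∀ x ∈ b, h ≤ x)
    (hs : b.Pairwise (· ≤ ·)) (hj : j < b.length) :
    Precedes (barPath n h b) k j ↔ h + k < b[j] := by
  induction b generalizing h k j with
  | nil => simp at hj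
  | cons x b ih =>
    rw [List.pairwise_cons] at hs
    have hx := hb x (by simp)
    simp only [barPath, precedes_replicate_U, Precedes]
    cases j with
    | zero => simp; omega
    | succ j =>
      simp only [List.length_cons] at hj
      rw [Nat.add_sub_cancel, ih hs.1 hs.2 (by omega)]
      have := hs.1 _ (List.getElem_mem (show j < b.length by omega))
      simp
      omega

/-- The ballot-sequence of a 321-avoiding permutation records the largest deficient letter (the
letters `p_q < q` are those which are not left-to-right maxima). -/
theorem ballotAux_spec {pre w : Word} {mx b : ℕ} (hp : IsPerm (pre ++ w))
    (ha : Avoids [3, 2, 1] (pre ++ w)) (hmx : ∀ u ∈ pre, u ≤ mx)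
    (hmx' : mx ∈ pre ∨ mx = 0)
    (hb : ∀ a, b ≤ a ↔ ∀ q (hq : q < pre.length), pre[q] ≤ q → pre[q] ≤ a) :
    (ballotAux mx b w).length = w.length ∧
    ∀ j (hj : j < (ballotAux mx b w).length) a, (ballotAux mx b w)[j] ≤ a ↔
      ∀ q (hq : q < (pre ++ w).length), q ≤ pre.length + j →
        (pre ++ w)[q] ≤ q → (pre ++ w)[q] ≤ a := by
  induction w generalizing pre mx b with
  | nil => simp [ballotAux]
  | cons p w ih =>
    have happ : pre ++ p :: w = (pre ++ [p]) ++ w := by simp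
    have hpb := hp.mem.1 (show p ∈ pre ++ p :: w by simp)
    have hnd := hp.nodup
    have hndpre : (pre ++ [p]).Nodup := by
      rw [happ] at hnd; exact (List.nodup_append.1 hnd).1
    have hppre : p ∉ pre := fun h => by
      have := List.disjoint_of_nodup_append hndpre h
      simp at this
    have hlast : (pre ++ [p])[pre.length]'(by simp) = p := by simp
    -- the value of the ballot-sequence at this position, whichever case applies
    have main : ∀ mx' b', (∀ u ∈ pre ++ [p], u ≤ mx') → (mx' ∈ pre ++ [p] ∨ mx' = 0) →
        (∀ a, b' ≤ a ↔ ∀ q (hq : q < (pre ++ [p]).length), (pre ++ [p])[q] ≤ q →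
          (pre ++ [p])[q] ≤ a) →
        (b' :: ballotAux mx' b' w).length = (p :: w).length ∧
        ∀ j (hj : j < (b' :: ballotAux mx' b' w).length) a,
          (b' :: ballotAux mx' b' w)[j] ≤ a ↔
          ∀ q (hq : q < (pre ++ p :: w).length), q ≤ pre.length + j →
            (pre ++ p :: w)[q] ≤ q → (pre ++ p :: w)[q] ≤ a := by
      intro mx' b' m1 m2 m3
      obtain ⟨i1, i2⟩ := ih (happ ▸ hp) (happ ▸ ha) m1 m2 m3
      refine ⟨by simp [i1], fun j hj a => ?_⟩
      simp only [happ]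
      cases j with
      | zero =>
        rw [List.getElem_cons_zero, m3 a]
        constructor
        · intro H q hq hq1 hq2
          have hq' : q < (pre ++ [p]).length := by simp; omega
          rw [List.getElem_append_left hq'] at hq2 ⊢
          exact H q hq' hq2
        · intro H q hq hq2
          have hq' : q ≤ pre.length + 0 := by simp at hq; omega
          have := H q (by simp at hq ⊢; omega) hq'
          rw [List.getElem_append_left hq] at this
          exact this hq2
      | succ j =>
        rw [List.getElem_cons_succ, i2 j (by simpa using hj) a]
        simp only [List.length_append, List.length_cons, List.length_nil]
        constructor
        · intro H q hq hq1
          exact H q (by simpa using hq) (by omega)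
        · intro H q hq hq1
          exact H q (by simpa using hq) (by omega)
    have split : ∀ a, (∀ q (hq : q < (pre ++ [p]).length), (pre ++ [p])[q] ≤ q →
          (pre ++ [p])[q] ≤ a) ↔ (∀ q (hq : q < pre.length), pre[q] ≤ q → pre[q] ≤ a) ∧
          (p ≤ pre.length → p ≤ a) := by
      intro a
      constructor
      · intro H
        refine ⟨fun q hq h => ?_, fun h => ?_⟩
        · have := H q (by simp; omega)
          rw [List.getElem_append_left hq] at this
          exact this h
        · have := H pre.length (by simp)
          rw [hlast] at this
          exact this h
      · rintro ⟨H1, H2⟩ q hq h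
        rcases Nat.lt_or_ge q pre.length with hlt | hge
        · rw [List.getElem_append_left hlt] at h ⊢
          exact H1 q hlt h
        · have : q = pre.length := by simp at hq; omega
          subst this
          rw [hlast] at h ⊢
          exact H2 h
    unfold ballotAux
    split_ifs with hlt
    · refine main p b ?_ (by simp) ?_
      · intro u hu
        rcases List.mem_append.1 hu with hu | hu
        · exact (hmx u hu).trans hlt.le
        · simp at hu; omega
      · intro a
        have hdef : ¬ p ≤ pre.length := by
          intro hle
          have : pre.Subperm (List.range' 1 (p - 1)) :=
            List.subperm_of_subset (List.nodup_append.1 hndpre).1 fun u hu => by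
              have h1 := hmx u hu
              have h2 := (hp.mem.1 (List.mem_append_left (p :: w) hu)).1
              rw [List.mem_range'_1]; omega
          have := this.length_le
          simp at this
          omega
        rw [split, hb a]
        exact ⟨fun H => ⟨H, fun h => absurd h hdef⟩, fun H => H.1⟩
    · have hmem : mx ∈ pre := hmx'.resolve_right (by omega)
      have hne : p < mx := lt_of_le_of_ne (by omega) fun e => hppre (e ▸ hmem)
      refine main mx p ?_ (by simp [hmem]) ?_
      · intro u hu
        rcases List.mem_append.1 hu with hu | hu
        · exact hmx u hu
        · simp at hu; omega
      · intro a
        have hdef : p ≤ pre.length := by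
          have : (mx :: List.range' 1 (p - 1)).Subperm pre := by
            refine List.subperm_of_subset ?_ fun u hu => ?_
            · rw [List.nodup_cons]
              refine ⟨?_, List.nodup_range'⟩
              rw [List.mem_range'_1]; omega
            · rcases List.mem_cons.1 hu with rfl | hu
              · exact hmem
              · rw [List.mem_range'_1] at hu
                have h1 : u ∈ pre ++ p :: w := hp.mem.2 (by omega)
                rcases List.mem_append.1 h1 with h1 | h1
                · exact h1
                · rcases List.mem_cons.1 h1 with h1 | h1
                  · omega
                  · exact (avoids_iff_321.1 ha mx p u (three_sublist_of_mem hmem h1) hne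
                      (by omega)).elim
          have := this.length_le
          simp at this
          omega
        rw [split]
        refine ⟨fun h => ⟨fun q hq hqd => ?_, fun _ => h⟩, fun H => H.2 hdef⟩
        by_contra hgt
        -- the deficient letter `pre[q]` has a larger letter to its left and `p` to its right
        obtain ⟨i, hi, hiq⟩ : ∃ (i : ℕ) (hi : i < q), pre[q] < pre[i] := by
          by_contra! hc
          have : (pre.take (q + 1)).Subperm (List.range' 1 pre[q]) := by
            refine List.subperm_of_subset ((List.nodup_append.1 hndpre).1.sublist
              (List.take_sublist _ _)) fun u hu => ?_
            obtain ⟨i, hi, rfl⟩ := List.mem_take_iff_getElem.1 hu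
            have h1 := (hp.mem.1 (List.mem_append_left (p :: w)
              (List.getElem_mem (show i < pre.length by omega)))).1
            rw [List.mem_range'_1]
            rcases Nat.lt_or_ge i q with h2 | h2
            · have := hc i h2; omega
            · have : i = q := by omega
              subst this; omega
          have := this.length_le
          simp at this
          omega
        refine avoids_iff_321.1 ha pre[i] pre[q] p (three_sublist_iff.2
          ⟨i, q, pre.length, hi, hq, by simp, ?_, ?_, ?_⟩) hiq (by omega)
        · rw [List.getElem_append_left]
        · rw [List.getElem_append_left]
        · simp

theorem ballot_spec {w : Word} (h : w ∈ Av [3, 2, 1]) :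
    (ballot w).length = w.length ∧ ∀ j (hj : j < (ballot w).length) a, (ballot w)[j] ≤ a ↔
      ∀ q (hq : q < w.length), q ≤ j → w[q] ≤ q → w[q] ≤ a := by
  have := ballotAux_spec (pre := []) (w := w) (mx := 0) (b := 0) h.1 h.2 (by simp) (by simp)
    (by simp)
  simpa [ballot] using this

theorem rotemPath_spec {w : Word} (h : w ∈ Av [3, 2, 1]) :
    (rotemPath w).count .D = w.length ∧ (rotemPath w).count .U = w.length ∧
    ∀ k j, k < w.length → j < w.length → (Precedes (rotemPath w) k j ↔
      ∀ q (hq : q < w.length), q + j < w.length → w[q] ≤ q → w[q] + k < w.length) := by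
  obtain ⟨h1, h2⟩ := ballot_spec h
  have hs : (ballot w).Pairwise (· ≤ ·) := by
    refine List.pairwise_iff_getElem.2 fun i j hi hj hij => ?_
    rw [h2 i hi]
    exact fun q hq hqi hd => (h2 j hj _).1 le_rfl q hq (by omega) hd
  have hn : ∀ x ∈ ballot w, x ≤ w.length := by
    intro x hx
    obtain ⟨j, hj, rfl⟩ := List.mem_iff_getElem.1 hx
    rw [h2 j hj]
    exact fun q hq _ _ => (h.1.getElem_bounds hq).2
  obtain ⟨c1, c2⟩ := barPath_count (n := w.length) (h := 0) (b := ballot w) (by simp) hs hn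
  unfold rotemPath
  refine ⟨by rw [List.count_reverse, c1, h1], by rw [List.count_reverse, c2]; rfl, ?_⟩
  intro k j hk hj
  rw [precedes_reverse (by omega) (by omega), c1, c2,
    precedes_barPath (by simp) hs (by omega), not_lt, h2]
  refine forall_congr' fun q => forall_congr' fun hq => ?_
  constructor
  · intro H h3 h4
    have := H (by omega) h4
    omega
  · intro H h3 h4
    have := H (by omega) h4
    omega

theorem isRegion_shaded {w : Word} (h : IsPerm w) : IsRegion w.length (Shaded w) where
  mono := by
    rintro i i' v v' hi hv hS ⟨j, h1, h2, h3, h4⟩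
    exact hS ⟨j, h1, h2, by omega, by omega⟩
  antidiagonal := by
    rintro k hk ⟨j, h1, h2, h3, h4⟩
    rw [List.mem_range'_1] at h1
    have hj : j - 1 < w.length := by omega
    rw [List.getD_eq_getElem _ _ hj] at h2 h4
    have := h.getElem_bounds hj
    omega

theorem reifegerste_steps {w : Word} (h : IsPerm w) (m : ℕ) (pre : List ℕ)
    (hm : pre.length + m = w.length) :
    ∃ r, (List.range' (pre.length + 1) m).foldl (fun cols a =>
      cols ++ [((List.range' 1 w.length).find? fun b => b ∉ cols ∧ Shaded w a b).getD 0]) pre =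
      pre ++ r ∧ r.length = m ∧ StepsFrom (LeastStep w.length (Shaded w)) pre r := by
  induction m generalizing pre with
  | zero => exact ⟨[], by simp, rfl, trivial⟩
  | succ m ih =>
    have hreg := isRegion_shaded h
    have hk : pre.length < w.length := by omega
    obtain ⟨b, hb1, hb2, hb3⟩ := exists_not_mem_of_length_lt (l := pre)
      (lo := w.length - pre.length) (m := pre.length + 1) (by omega)
    obtain ⟨c, hc⟩ : ∃ c, (List.range' 1 w.length).find?
        (fun b => decide (b ∉ pre ∧ Shaded w (pre.length + 1) b)) = some c := by
      rw [← Option.isSome_iff_exists, List.find?_isSome]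
      refine ⟨b, by rw [List.mem_range'_1]; omega, ?_⟩
      simp only [decide_eq_true_eq]
      exact ⟨hb3, hreg.mono le_rfl hb1 (hreg.antidiagonal hk)⟩
    obtain ⟨r, hr1, hr2, hr3⟩ := ih (pre ++ [c]) (by simp; omega)
    refine ⟨c :: r, ?_, by simp [hr2], ?_, hr3⟩
    · rw [List.range'_succ, List.foldl_cons, hc, Option.getD_some]
      simpa using hr1
    · rw [List.find?_range'_eq_some] at hc
      obtain ⟨hc1, hc2, hc3⟩ := hc
      rw [List.mem_range'_1] at hc2
      simp only [decide_eq_true_eq] at hc1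
      refine ⟨hc2.1, by omega, hc1.1, hc1.2, fun b h1 h2 h3 => ?_⟩
      have := hc3 b h1 h2
      by_contra hb
      simp [hb, h3] at this

/-- Reifegerste's dots form the 132-avoiding permutation whose left-to-right minima bound the
shaded region. -/
theorem reifegerste_spec {w : Word} (h : IsPerm w) :
    reifegerste w ∈ Av [1, 3, 2] ∧ (reifegerste w).length = w.length ∧
      ∀ i v, 1 ≤ i → i ≤ w.length → 1 ≤ v → (NE (reifegerste w) i v ↔ Shaded w i v) := by
  obtain ⟨r, h1, h2, h3⟩ := reifegerste_steps h w.length [] (by simp)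
  have e : reifegerste w = r := h1
  rw [e]
  obtain ⟨h4, h5⟩ := leastSteps_spec (isRegion_shaded h) h2 h3
  exact ⟨h4, h2, h5⟩

theorem shaded_iff {π : Word} (h : IsPerm π) {k j : ℕ} (hk : k < π.length) :
    Shaded π (π.length - k) (j + 1) ↔
      ∀ q (hq : q < (PermBij.inverse π).length), q + j < π.length →
        (PermBij.inverse π)[q] ≤ q → (PermBij.inverse π)[q] + k < π.length := by
  unfold Shaded
  constructor
  · intro H q hq h1 h2
    simp only [length_inverse] at hq
    by_contra hlt
    obtain ⟨hv, e⟩ := h.getElem_of_inverse hq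
    have hb := h.inverse.getElem_bounds (i := q) (by simpa using hq)
    refine H ⟨(PermBij.inverse π)[q]'(by simpa using hq), ?_, ?_⟩
    · rw [List.mem_range'_1]
      simp at hb
      omega
    · rw [List.getD_eq_getElem _ _ hv, e]
      omega
  · rintro H ⟨i, h1, h2, h3, h4⟩
    rw [List.mem_range'_1] at h1
    have hi : i - 1 < π.length := by omega
    rw [List.getD_eq_getElem _ _ hi] at h2 h4
    have hb := h.getElem_bounds hi
    have := (h.inverse_getElem_eq_iff (j := i - 1) (v := π[i - 1] - 1) hi (by omega)).2 (by omega)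
    have := H (π[i - 1] - 1) (by simp; omega) (by omega) (by omega)
    omega

theorem rotemPath_eq_stdPath_iff {π ρ : Word} (h : π ∈ Av [3, 2, 1]) (hρ : ρ ∈ Av [1, 3, 2]) :
    rotemPath (PermBij.inverse π) = stdPath ρ ↔ PermBij.inverse ρ = reifegerste π := by
  obtain ⟨r1, r2, r3⟩ := rotemPath_spec (inverse_mem_Av_321 h)
  obtain ⟨s1, s2, s3⟩ := heightPath_spec hρ
  obtain ⟨t1, t2, t3⟩ := reifegerste_spec h.1
  simp only [length_inverse] at r1 r2 r3
  rw [stdPath_eq_heightPath hρ]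
  have key : ∀ k j, k < π.length → j < π.length →
      (Precedes (rotemPath (PermBij.inverse π)) k j ↔
        NE (reifegerste π) (π.length - k) (j + 1)) := by
    intro k j hk hj
    rw [t3 _ _ (by omega) (by omega) (by omega), shaded_iff h.1 hk, r3 k j hk hj]
    simp
  constructor
  · intro e
    have hl : π.length = ρ.length := by rw [← r2, e, s2]
    refine eq_of_NE_eq_132 (inverse_mem_Av_132 hρ) t1 (by simp [t2, hl]) ?_
    have := NE_iff_of_box hρ.1 t1.1.inverse (by simp [t2, hl]) fun k j hk hj => ?_
    · exact fun i v => by rw [NE_inverse hρ.1, this, NE_inverse t1.1]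
    · rw [NE_inverse t1.1, ← s3 k j hj hk, ← e, key k j (by omega) (by omega), hl]
  · intro e
    have hl : ρ.length = π.length := by rw [← t2, ← e, length_inverse]
    refine path_ext (by rw [r2, s2, hl]) (by rw [r1, s1, hl]) fun k j hk hj => ?_
    rw [r2] at hk
    rw [r1] at hj
    rw [key k j hk hj, s3 k j (by omega) (by omega), ← e, NE_inverse hρ.1, hl]

/-- Reifegerste's bijection is the conjugate of the Knuth–Rotem bijection by the inverse. -/
theorem holds_reifegerste :
    Holds ⟨[], .Reifegerste, false, []⟩ ⟨[.i], .KnuthRotem, false, [.i]⟩ := by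
  intro π σ
  constructor
  · rintro ⟨h1, _, rfl, h2, rfl⟩
    have hr := (reifegerste_spec h1).1
    refine ⟨h1, PermBij.inverse (reifegerste π), (inverse_inverse hr.1).symm, inverse_mem_Av_321 h2,
      inverse_mem_Av_132 hr, ?_⟩
    exact (rotemPath_eq_stdPath_iff h2 (inverse_mem_Av_132 hr)).2 (inverse_inverse hr.1)
  · rintro ⟨h1, ρ, rfl, h2, h3, h4⟩
    have h5 := inverse_mem_Av_321 h2
    rw [show act [PermBij.Sym.i] π = PermBij.inverse π from rfl, inverse_inverse h1] at h5
    exact ⟨h1, _, rfl, h5, (rotemPath_eq_stdPath_iff h5 h3).1 h4⟩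

/-! ### Knuth–Richards -/

theorem nextUnset_spec {a : ℕ → ℕ} {r b : ℕ} (hb : b < r) (hab : a b = 0) :
    b ≤ nextUnset a r ∧ nextUnset a r < r ∧ a (nextUnset a r) = 0 ∧
      ∀ v, nextUnset a r < v → v < r → a v ≠ 0 := by
  induction r with
  | zero => omega
  | succ r ih =>
    unfold nextUnset
    split_ifs with h
    · exact ⟨by omega, by omega, h, fun v h1 h2 => by omega⟩
    · have hbr : b < r := lt_of_le_of_ne (by omega) fun e => h (e ▸ hab)
      obtain ⟨h1, h2, h3, h4⟩ := ih hbr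
      refine ⟨h1, by omega, h3, fun v hv1 hv2 => ?_⟩
      rcases Nat.lt_or_ge v r with hv | hv
      · exact h4 v hv1 hv
      · have : v = r := by omega
        rwa [this]

theorem richardsAux_replicate (l i r s : ℕ) (a : ℕ → ℕ) (up : Bool) (P : Path) :
    richardsAux i r s a up (List.replicate l .U ++ P) =
      richardsAux i r (s - l) a (up || decide (0 < l)) P := by
  induction l generalizing s up with
  | zero => simp
  | succ l ih =>
    simp only [List.replicate_succ, List.cons_append, richardsAux, ih]
    rw [Nat.sub_sub, Nat.add_comm 1]
    simp

/-- The array `a` records the positions of the list `p`: `a` is its inverse as far as it is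
defined, and `0` elsewhere. -/
def Records (a : ℕ → ℕ) (p : List ℕ) : Prop :=
  ∀ v, 1 ≤ v → a v = if v ∈ p then p.idxOf v + 1 else 0

theorem Records.eq_zero_iff {a : ℕ → ℕ} {p : List ℕ} (h : Records a p) {v : ℕ} (hv : 1 ≤ v) :
    a v = 0 ↔ v ∉ p := by
  rw [h v hv]
  split_ifs with h1 <;> simp [h1]

theorem Records.update {a : ℕ → ℕ} {p : List ℕ} (h : Records a p) {c : ℕ} (hc : c ∉ p) :
    Records (Function.update a c (p.length + 1)) (p ++ [c]) := by
  intro v hv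
  rcases eq_or_ne v c with rfl | hne
  · simp [List.idxOf_append, hc]
  · rw [Function.update_of_ne hne, h v hv]
    by_cases hvp : v ∈ p
    · simp [hvp, List.idxOf_append]
    · simp [hvp, hne]

/-- Richards' algorithm places the down-steps in the positions given by the greedy filling with
largest letters of the region of `pre ++ w`. Here `pre` is the part of the word whose path has
been read, `m` its least letter, `h` the height reached, `p` the list of the positions filled so
far, and all positions from `r` on are filled. -/
theorem richardsAux_spec {pre w : Word} {m n h r : ℕ} {p : List ℕ} {a : ℕ → ℕ}
    (hp : IsPerm (pre ++ w)) (hn : (pre ++ w).length = n) (ha : Avoids [1, 3, 2] (pre ++ w))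
    (hm : (pre = [] ∧ m = n + 1) ∨ m ∈ pre) (hle : ∀ u ∈ pre, m ≤ u)
    (hh : h + pre.length + m = n + 1) (hpl : p.length = pre.length) (hpm : ∀ u ∈ p, m ≤ u)
    (hrec : Records a p) (hrn : r ≤ n + 1)
    (hr : ∀ v, r ≤ v → v ≤ n → v ∈ p) :
    ∃ q, q.length = w.length ∧ StepsFrom (LargestStep n (NE (pre ++ w))) p q ∧
      Records (richardsAux (pre.length + 1) r m a false (heightPathAux h w)) (p ++ q) := by
  induction w generalizing pre m h r p a with
  | nil => exact ⟨[], rfl, trivial, by simpa [heightPathAux, richardsAux] using hrec⟩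
  | cons x w ih =>
    obtain ⟨s1, s2⟩ := heightPathAux_step hp hn ha hm hle hh
    have hx := hp.mem.1 (show x ∈ pre ++ x :: w by simp)
    have happ : pre ++ x :: w = (pre ++ [x]) ++ w := by simp
    have hmem : min m x ∈ pre ++ [x] := by
      rcases hm with ⟨h1, h2⟩ | hm
      · rw [min_eq_right (by omega)]; simp
      · rcases le_total m x with h | h
        · rw [min_eq_left h]; simp [hm]
        · rw [min_eq_right h]; simp
    have hle' : ∀ u ∈ pre ++ [x], min m x ≤ u := by
      intro u hu
      rcases List.mem_append.1 hu with hu | hu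
      · exact (min_le_left _ _).trans (hle u hu)
      · simp at hu; simp [hu]
    have hmin1 : 1 ≤ min m x := (hp.mem.1 (happ ▸ List.mem_append_left w hmem)).1
    have ht : (pre ++ x :: w).take (pre.length + 1) = pre ++ [x] := by
      rw [List.take_append]; simp [List.take_of_length_le]
    have ht0 : (pre ++ x :: w).take pre.length = pre := by simp
    have next : ∀ c r', r' ≤ n + 1 → min m x ≤ c → c ∉ p → (∀ v, r' ≤ v → v ≤ n → v ∈ p ++ [c]) →
        LargestStep n (NE (pre ++ x :: w)) p c →
        ∃ q, q.length = (x :: w).length ∧ StepsFrom (LargestStep n (NE (pre ++ x :: w))) p q ∧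
        Records (richardsAux (pre.length + 1 + 1) r' (min m x)
          (Function.update a c (pre.length + 1)) false
          (heightPathAux (w.countP (x < ·)) w)) (p ++ q) := by
      intro c r' hrn' hc hcp hr' hstep
      obtain ⟨q, h1, h2, h3⟩ := ih (pre := pre ++ [x]) (m := min m x) (h := w.countP (x < ·))
        (p := p ++ [c]) (r := r') (a := Function.update a c (pre.length + 1))
        (happ ▸ hp) (happ ▸ hn) (happ ▸ ha) (Or.inr hmem) hle' s2 (by simp [hpl])
        (by
          intro u hu
          rcases List.mem_append.1 hu with hu | hu
          · exact (min_le_left _ _).trans (hpm u hu)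
          · simp at hu; omega)
        (hpl ▸ hrec.update hcp) hrn' hr'
      rw [← happ] at h2
      refine ⟨c :: q, by simp [h1], ⟨hstep, h2⟩, by simpa using h3⟩
    simp only [heightPathAux, richardsAux_replicate, Bool.false_or, richardsAux,
      decide_eq_true_eq]
    have hs : m - (w.countP (x < ·) + 1 - h) = min m x := by omega
    rw [hs]
    split_ifs with hl
    · -- up-steps precede this down-step, so that `x` is a new minimum
      have hxm : min m x = x := by omega
      have hxm' : x < m := by omega
      refine next (min m x) r hrn le_rfl (fun h => ?_) (fun v h1 h2 => ?_)
        ⟨hmin1, by omega, fun h => ?_, ?_, ?_, Or.inl ?_⟩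
      · have := hpm _ h; omega
      · exact List.mem_append_left _ (hr v h1 h2)
      · have := hpm _ h; omega
      · rw [hpl]
        exact ⟨x, by rw [ht]; simp, by omega⟩
      · rw [hpl]
        rintro v ⟨u, hu, huv⟩
        rw [ht] at hu
        rcases List.mem_append.1 hu with hu | hu
        · exact Or.inl ⟨u, by rwa [ht0], huv⟩
        · simp at hu; right; omega
      · rw [hpl]
        rintro ⟨u, hu, huv⟩
        rw [ht0] at hu
        have := hle u hu
        omega
    · have hxm : min m x = m := by omega
      have hmx : m ≤ x := by omega
      have hmpre : m ∈ pre := by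
        rcases hm with ⟨-, h⟩ | h
        · omega
        · exact h
      simp only [List.length_append, List.length_cons, List.length_nil] at s2
      obtain ⟨b, hb1, hb2, hb3⟩ := exists_not_mem_of_length_lt (l := p) (lo := m)
        (m := pre.length + 1) (by omega)
      have hbr : b < r := by
        by_contra hc
        exact hb3 (hr b (by omega) (by omega))
      obtain ⟨k1, k2, k3, k4⟩ := nextUnset_spec hbr ((hrec.eq_zero_iff (by omega)).2 hb3)
      generalize nextUnset a r = k at *
      have hkp : k ∉ p := (hrec.eq_zero_iff (by omega)).1 k3
      have hkn : k ≤ n := by omega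
      refine next k k (by omega) (by omega) hkp (fun v h1 h2 => ?_)
        ⟨by omega, hkn, hkp, ?_, ?_, Or.inr fun b' h1 h2 h3 => ?_⟩
      · rcases h1.eq_or_lt with rfl | h1
        · simp
        · refine List.mem_append_left _ ?_
          rcases Nat.lt_or_ge v r with hv | hv
          · by_contra hc
            exact k4 v h1 hv ((hrec.eq_zero_iff (by omega)).2 hc)
          · exact hr v hv h2
      · rw [hpl]
        exact ⟨m, by rw [ht]; simp [hmpre], by omega⟩
      · rw [hpl]
        rintro v ⟨u, hu, huv⟩
        rw [ht] at hu
        rcases List.mem_append.1 hu with hu | hu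
        · exact Or.inl ⟨u, by rwa [ht0], huv⟩
        · simp at hu
          exact Or.inl ⟨m, by rwa [ht0], by omega⟩
      · by_contra hc
        have hbr' : b' < r := by
          by_contra hc'
          exact h3 (hr b' (by omega) h2)
        exact k4 b' (by omega) hbr' ((hrec.eq_zero_iff h1).2 h3)

/-- The Knuth–Richards bijection turns the left-to-right minima into those of the inverse. -/
theorem richards_spec {ρ : Word} (h : ρ ∈ Av [1, 3, 2]) :
    richards (stdPath ρ) ∈ Av [1, 2, 3] ∧ (richards (stdPath ρ)).length = ρ.length ∧
      ∀ i v, NE (richards (stdPath ρ)) i v ↔ NE ρ v i := by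
  obtain ⟨s1, s2, -⟩ := heightPath_spec h
  obtain ⟨p, hl, hsteps, hrec⟩ := richardsAux_spec (pre := []) (w := ρ) (m := ρ.length + 1)
    (n := ρ.length) (h := 0) (r := ρ.length + 1) (p := []) (a := fun _ => 0) h.1 rfl h.2
    (Or.inl ⟨rfl, rfl⟩) (by simp) (by simp) rfl (by simp) (fun v _ => by simp) le_rfl
    (fun v h1 h2 => by omega)
  simp only [List.nil_append] at hsteps hrec
  obtain ⟨hav, hNE⟩ := largestSteps_spec h.1.isRegion_NE (by simp [NE]) hl hsteps
  have hlen : (stdPath ρ).length = 2 * ρ.length := by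
    rw [stdPath_eq_heightPath h]
    have : ∀ P : Path, P.length = P.count .U + P.count .D := by
      intro P
      induction P with
      | nil => rfl
      | cons s P ih => cases s <;> simp [ih] <;> omega
    rw [this, s1, s2]; omega
  have e : richards (stdPath ρ) = PermBij.inverse p := by
    unfold richards PermBij.inverse
    rw [hlen, Nat.mul_div_cancel_left _ (by omega), hl]
    refine List.map_congr_left fun v hv => ?_
    rw [List.mem_range'_1] at hv
    have hvp : v ∈ p := hav.1.mem.2 (by omega)
    have := hrec v hv.1
    rw [if_pos hvp] at this
    rw [stdPath_eq_heightPath h]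
    exact this
  rw [e]
  refine ⟨inverse_mem_Av_123 hav, by simp [hl], fun i v => ?_⟩
  rw [NE_inverse hav.1]
  exact NE_iff_of_box hav.1 h.1 hl.symm (fun k j hk hj => hNE _ _ (by omega)) v i

theorem sameMinima_of_richards {σ : Word} (h : σ ∈ Av [1, 3, 2]) :
    SameMinima (richards (stdPath σ)).reverse σ := by
  obtain ⟨h1, h2, h3⟩ := richards_spec h
  refine ⟨reverse_mem_Av_123.1 (by simpa using h1), h, by simp [h2], fun i v => ?_⟩
  rw [List.reverse_reverse, h3]

theorem holds_knuthRichards_iff (π σ : Word) :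
    Composite.graph ⟨[], .KnuthRichards, true, [.r]⟩ π σ ↔ SameMinima π σ := by
  constructor
  · rintro ⟨-, ρ, rfl, h1, h2⟩
    have := sameMinima_of_richards h1
    rw [← h2] at this
    simpa [act, Sym.act] using this
  · intro h
    refine ⟨h.1.1, σ, rfl, h.2.1, ?_⟩
    rw [h.left_unique (sameMinima_of_richards h.2.1)]
    simp [act, Sym.act]

/-! ### Suffix minima of sums -/

@[simp] theorem length_osum (σ τ : Word) : (osum σ τ).length = σ.length + τ.length := by
  simp [osum]

@[simp] theorem length_alpha (σ : Word) : (alpha σ).length = σ.length + 1 := by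
  simp [alpha]

theorem IsPerm.osum {σ τ : Word} (h : IsPerm σ) (h' : IsPerm τ) : IsPerm (osum σ τ) := by
  refine isPerm_of_nodup (length_osum σ τ) ?_ ?_
  · refine List.nodup_append.2 ⟨h.nodup, h'.nodup.map (fun a b e => by simpa using e), ?_⟩
    intro a ha b hb e
    obtain ⟨c, hc, rfl⟩ := List.mem_map.1 hb
    have := h.mem.1 ha
    have := h'.mem.1 hc
    omega
  · intro x hx
    rcases List.mem_append.1 hx with hx | hx
    · have := h.mem.1 hx; omega
    · obtain ⟨c, hc, rfl⟩ := List.mem_map.1 hx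
      have := h'.mem.1 hc
      omega

theorem IsPerm.alpha {σ : Word} (h : IsPerm σ) : IsPerm (alpha σ) := by
  refine isPerm_of_nodup (length_alpha σ) ?_ ?_
  · refine List.nodup_cons.2 ⟨fun hm => ?_, h.nodup⟩
    have := h.mem.1 hm
    omega
  · intro x hx
    rcases List.mem_cons.1 hx with rfl | hx
    · omega
    · have := h.mem.1 hx; omega

theorem SE_osum {σ τ : Word} {i v : ℕ} :
    SE (osum σ τ) i v ↔ SE σ i v ∨ (σ.length ≤ v ∧ SE τ (i - σ.length) (v - σ.length)) := by
  unfold SE osum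
  rw [List.drop_append, ← List.map_drop]
  constructor
  · rintro ⟨u, hu, huv⟩
    rcases List.mem_append.1 hu with hu | hu
    · exact Or.inl ⟨u, hu, huv⟩
    · obtain ⟨c, hc, rfl⟩ := List.mem_map.1 hu
      exact Or.inr ⟨by omega, c, hc, by omega⟩
  · rintro (⟨u, hu, huv⟩ | ⟨h1, c, hc, h2⟩)
    · exact ⟨u, List.mem_append_left _ hu, huv⟩
    · exact ⟨c + σ.length, List.mem_append_right _ (List.mem_map.2 ⟨c, hc, rfl⟩), by omega⟩

theorem SE_alpha_zero {σ : Word} {v : ℕ} : SE (alpha σ) 0 v ↔ σ.length + 1 ≤ v ∨ SE σ 0 v := by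
  simp [SE, alpha]

theorem SE_alpha_succ {σ : Word} {i v : ℕ} : SE (alpha σ) (i + 1) v ↔ SE σ i v := by
  simp [SE, alpha]

theorem not_SE_of_le {w : Word} {i v : ℕ} (h : w.length ≤ i) : ¬ SE w i v := by
  simp [SE, List.drop_eq_nil_of_le h]

theorem IsPerm.not_SE_zero {w : Word} (h : IsPerm w) (i : ℕ) : ¬ SE w i 0 := by
  rintro ⟨u, hu, hu0⟩
  have := (h.mem.1 (List.mem_of_mem_drop hu)).1
  omega

theorem IsPerm.SE_of_length_le {w : Word} (h : IsPerm w) {i v : ℕ} (hi : i < w.length)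
    (hv : w.length ≤ v) : SE w i v :=
  SE_iff_getElem.2 ⟨i, hi, le_rfl, (h.getElem_bounds hi).2.trans hv⟩

theorem IsPerm.SE_zero_left {w : Word} (h : IsPerm w) {v : ℕ} (hw : 0 < w.length) (hv : 1 ≤ v) :
    SE w 0 v := ⟨1, by simpa using h.mem.2 ⟨le_rfl, hw⟩, hv⟩

theorem IsPerm.SE_min_length {w : Word} (h : IsPerm w) {i v : ℕ} :
    SE w i v ↔ SE w i (min v w.length) := by
  constructor
  · rintro ⟨u, hu, huv⟩
    have := h.mem.1 (List.mem_of_mem_drop hu)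
    exact ⟨u, hu, by omega⟩
  · rintro ⟨u, hu, huv⟩
    exact ⟨u, hu, by omega⟩

theorem IsPerm.NE_clamp {w : Word} (h : IsPerm w) {i v : ℕ} :
    NE w i v ↔ NE w (min i w.length) (min v w.length) := by
  have h1 : NE w i v ↔ NE w (min i w.length) v := by
    rcases le_total i w.length with hi | hi
    · rw [min_eq_left hi]
    · rw [min_eq_right hi, NE_length_le hi]
  rw [h1]
  constructor
  · rintro ⟨u, hu, huv⟩
    have := h.mem.1 (List.mem_of_mem_take hu)
    exact ⟨u, hu, by omega⟩
  · rintro ⟨u, hu, huv⟩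
    exact ⟨u, hu, by omega⟩

/-- An occurrence of a pattern whose first letter exceeds its last one lies within one of the
summands. -/
theorem sublist_osum {σ τ : Word} (h : IsPerm σ) (h' : IsPerm τ) {x y z : ℕ}
    (hs : [x, y, z].Sublist (osum σ τ)) (hzx : z < x) :
    [x, y, z].Sublist σ ∨ ∃ x' y' z', [x', y', z'].Sublist τ ∧
      x = x' + σ.length ∧ y = y' + σ.length ∧ z = z' + σ.length := by
  obtain ⟨l₁, l₂, e, h1, h2⟩ := List.sublist_append_iff.1 hs
  obtain ⟨l', hl', e'⟩ := List.sublist_map_iff.1 h2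
  have hbad : ∀ z', z = z' + σ.length → z' ∈ l' → x ∈ l₁ → False := by
    intro z' hz hz' hx
    have := h.mem.1 (h1.subset hx)
    have := h'.mem.1 (hl'.subset hz')
    omega
  have hlast : l₂ ≠ [] → ∃ z', z = z' + σ.length ∧ z' ∈ l' := by
    intro hne
    have : z ∈ l₂ := by
      have h3 := congrArg List.getLast? e
      rw [List.getLast?_append_of_ne_nil _ hne] at h3
      exact List.mem_of_getLast? (by simpa using h3.symm)
    rw [e'] at this
    obtain ⟨z', hz', rfl⟩ := List.mem_map.1 this
    exact ⟨z', rfl, hz'⟩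
  cases l₁ with
  | nil =>
    right
    rw [List.nil_append] at e
    rw [e'] at e
    match l', e with
    | [x', y', z'], e =>
      simp only [List.map_cons, List.map_nil, List.cons.injEq, and_true] at e
      exact ⟨x', y', z', hl', e.1, e.2.1, e.2.2⟩
  | cons a l₁ =>
    rcases eq_or_ne l₂ [] with rfl | hne
    · left
      rw [List.append_nil] at e
      rw [e]; exact h1
    · obtain ⟨z', hz, hz'⟩ := hlast hne
      simp only [List.cons_append, List.cons.injEq] at e
      exact (hbad z' hz hz' (by simp [e.1])).elim

theorem osum_mem_Av_231 {σ τ : Word} (h : σ ∈ Av [2, 3, 1]) (h' : τ ∈ Av [2, 3, 1]) :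
    osum σ τ ∈ Av [2, 3, 1] := by
  refine ⟨h.1.osum h'.1, avoids_iff_231.2 fun x y z hs hxy hzx => ?_⟩
  rcases sublist_osum h.1 h'.1 hs hzx with h1 | ⟨x', y', z', h1, rfl, rfl, rfl⟩
  · exact avoids_iff_231.1 h.2 _ _ _ h1 hxy hzx
  · exact avoids_iff_231.1 h'.2 _ _ _ h1 (by omega) (by omega)

theorem osum_mem_Av_321 {σ τ : Word} (h : σ ∈ Av [3, 2, 1]) (h' : τ ∈ Av [3, 2, 1]) :
    osum σ τ ∈ Av [3, 2, 1] := by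
  refine ⟨h.1.osum h'.1, avoids_iff_321.2 fun x y z hs hxy hzx => ?_⟩
  rcases sublist_osum h.1 h'.1 hs (by omega) with h1 | ⟨x', y', z', h1, rfl, rfl, rfl⟩
  · exact avoids_iff_321.1 h.2 _ _ _ h1 hxy hzx
  · exact avoids_iff_321.1 h'.2 _ _ _ h1 (by omega) (by omega)

theorem alpha_mem_Av_231 {σ : Word} (h : σ ∈ Av [2, 3, 1]) : alpha σ ∈ Av [2, 3, 1] := by
  refine ⟨h.1.alpha, avoids_iff_231.2 fun x y z hs hxy hzx => ?_⟩
  rcases List.sublist_cons_iff.1 hs with h1 | ⟨r, hr, h1⟩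
  · exact avoids_iff_231.1 h.2 _ _ _ h1 hxy hzx
  · simp only [List.cons.injEq] at hr
    have := h.1.mem.1 (h1.subset (hr.2 ▸ List.mem_cons_self : y ∈ r))
    omega

/-- A word whose letters fall into two increasing subwords avoids 321. -/
theorem avoids_321_of_filter {w : Word} (q : ℕ → Bool) (h1 : (w.filter q).Pairwise (· < ·))
    (h2 : (w.filter (fun x => !q x)).Pairwise (· < ·)) : Avoids [3, 2, 1] w := by
  rw [avoids_iff_321]
  intro x y z hs hyx hzy
  have two : ∀ a b, [a, b].Sublist w → b < a → q a = !q b := by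
    intro a b hab hlt
    by_contra hq
    cases ha : q a with
    | true =>
      have hb : q b = true := by revert hq; cases q b <;> simp [ha]
      have := hab.filter q
      simp [ha, hb] at this
      have := h1.sublist this
      simp at this; omega
    | false =>
      have hb : q b = false := by revert hq; cases q b <;> simp [ha]
      have := hab.filter (fun x => !q x)
      simp [ha, hb] at this
      have := h2.sublist this
      simp at this; omega
  have e1 := two x y (List.Sublist.trans (by simp) hs) hyx
  have e2 := two y z (List.Sublist.trans (by simp) hs) hzy
  have e3 := two x z (List.Sublist.trans (by simp) hs) (by omega)
  revert e1 e2 e3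
  cases q x <;> cases q y <;> cases q z <;> simp

/-! ### The map `β` -/

theorem map_formPerm_cons (x : ℕ) (l : List ℕ) (h : (x :: l).Nodup) :
    (x :: l).map (x :: l).formPerm = l ++ [x] := by
  refine List.ext_getElem (by simp) fun i h1 h2 => ?_
  simp only [List.length_map, List.length_cons] at h1
  rw [List.getElem_map, List.formPerm_apply_getElem _ h]
  rcases Nat.lt_or_ge i l.length with hi | hi
  · simp only [List.length_cons, Nat.mod_eq_of_lt (show i + 1 < l.length + 1 by omega),
      List.getElem_cons_succ, List.getElem_append_left hi]
  · have : i = l.length := by omega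
    subst this
    simp

theorem isRLMin_iff {A B : Word} {y : ℕ} (hy : y ∉ A) :
    IsRLMin (A ++ y :: B) y ↔ ∀ z ∈ B, y ≤ z := by
  have : (A ++ y :: B).dropWhile (· ≠ y) = y :: B := by
    rw [List.dropWhile_append_of_pos fun a ha => by simp; rintro rfl; exact hy ha]
    simp
  unfold IsRLMin
  rw [this]
  simp

theorem isLRMax_iff {A B : Word} {y : ℕ} (hy : y ∉ A) :
    IsLRMax (A ++ y :: B) y ↔ ∀ z ∈ A, z < y := by
  have : (A ++ y :: B).takeWhile (· ≠ y) = A := by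
    rw [List.takeWhile_append_of_pos fun a ha => by simp; rintro rfl; exact hy ha]
    simp
  unfold IsLRMax
  rw [this]

/-- Splitting a nonempty 321-avoiding permutation at the letter `1`, together with its letters
that are not right-to-left minima, which increase. Such letters are left-to-right maxima, so that
the boxed letters `xs` are simply those to the right of `1` that are not right-to-left minima. -/
theorem beta_decomposition {w : Word} (h : w ∈ Av [3, 2, 1]) (hw : 0 < w.length) :
    ∃ before rest xs : Word, w = before ++ 1 :: rest ∧
      beta w = (before ++ (w.length + 1) :: 1 :: rest).map ((w.length + 1) :: xs).formPerm ∧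
      xs = (1 :: rest).filter (fun x => ¬ IsRLMin w x) ∧
      w.filter (fun x => ¬ IsRLMin w x) = before ++ xs ∧
      (∀ x ∈ before, ¬ IsRLMin w x) ∧
      (before ++ xs).Pairwise (· < ·) ∧
      (w.filter (fun x => IsRLMin w x)).Pairwise (· < ·) := by
  have h1 : 1 ∈ w := h.1.mem.2 ⟨le_rfl, hw⟩
  have hnd := h.1.nodup
  have ha := avoids_iff_321.1 h.2
  have hd' := takeWhile_dropWhile_max h1
  have hdw : w.dropWhile (· ≠ 1) = 1 :: (w.dropWhile (· ≠ 1)).tail :=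
    List.append_cancel_left (List.takeWhile_append_dropWhile.trans hd')
  have hbeta : beta w = (w.takeWhile (· ≠ 1) ++ (w.length + 1) :: w.dropWhile (· ≠ 1)).map
      ((w.length + 1) :: (w.dropWhile (· ≠ 1)).filter
        (fun x => IsLRMax w x ∧ ¬ IsRLMin w x)).formPerm := rfl
  rw [hdw] at hbeta
  generalize w.takeWhile (· ≠ 1) = before at hd' hbeta
  generalize (w.dropWhile (· ≠ 1)).tail = rest at hd' hbeta
  clear hdw
  have hbef : ∀ x ∈ before, ¬ IsRLMin w x := by
    intro x hx hmin
    obtain ⟨s, t, rfl⟩ := List.append_of_mem hx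
    have e : w = s ++ x :: (t ++ 1 :: rest) := by rw [hd']; simp
    rw [e] at hnd hmin
    rw [isRLMin_iff fun hm => by simpa using List.disjoint_of_nodup_append hnd hm] at hmin
    have h2 := hmin 1 (by simp)
    have h3 := (h.1.mem.1 (show x ∈ w by rw [e]; simp)).1
    have : x = 1 := by omega
    subst this
    have := (List.nodup_append.1 hnd).2.1
    simp at this
  have hnotmin : ∀ {A B : Word} {x : ℕ}, w = A ++ x :: B → ¬ IsRLMin w x →
      ∃ z ∈ B, z < x := by
    intro A B x e hx
    rw [e] at hx hnd
    rw [isRLMin_iff fun hm => by simpa using List.disjoint_of_nodup_append hnd hm] at hx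
    push Not at hx
    exact hx
  have hmax : ∀ x ∈ w, ¬ IsRLMin w x → IsLRMax w x := by
    intro x hx hmin
    obtain ⟨s, t, e⟩ := List.append_of_mem hx
    obtain ⟨z, hz, hzx⟩ := hnotmin e hmin
    have hxs : x ∉ s := fun hm => by
      rw [e] at hnd
      simpa using List.disjoint_of_nodup_append hnd hm
    rw [e, isLRMax_iff hxs]
    intro y hy
    by_contra hyx
    have hne : y ≠ x := fun e' => hxs (e' ▸ hy)
    exact ha y x z (e ▸ three_sublist_of_mem hy hz) (by omega) hzx
  have hxs : (1 :: rest).filter (fun x => decide (IsLRMax w x ∧ ¬ IsRLMin w x)) =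
      (1 :: rest).filter (fun x => decide (¬ IsRLMin w x)) := by
    refine List.filter_congr fun x hx => ?_
    refine decide_eq_decide.2 ⟨And.right, fun h => ⟨hmax x ?_ h, h⟩⟩
    rw [hd']; exact List.mem_append_right _ hx
  rw [hxs] at hbeta
  have hsplit : w.filter (fun x => decide (¬ IsRLMin w x)) =
      before ++ (1 :: rest).filter (fun x => decide (¬ IsRLMin w x)) := by
    conv_lhs => arg 2; rw [hd']
    rw [List.filter_append]
    congr 1
    rw [List.filter_eq_self]
    intro x hx
    simpa using hbef x hx
  have hpw : w.Pairwise (fun x y => (¬ IsRLMin w x → ¬ IsRLMin w y → x < y) ∧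
      (IsRLMin w x → IsRLMin w y → x < y)) := by
    rw [List.pairwise_iff_forall_sublist]
    intro x y hs
    have hne : x ≠ y := by
      rintro rfl
      have := hnd.sublist hs
      simp at this
    have hs' : ([x] ++ [y]).Sublist w := hs
    obtain ⟨A, B, e1, e2, e3⟩ := List.append_sublist_iff.1 hs'
    obtain ⟨s, t, rfl⟩ := List.append_of_mem (List.singleton_sublist.1 e2)
    have hy : y ∈ B := List.singleton_sublist.1 e3
    have e : w = s ++ x :: (t ++ B) := by rw [e1]; simp
    constructor
    · intro _ hy'
      by_contra hlt
      obtain ⟨C, D, e4⟩ := List.append_of_mem hy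
      obtain ⟨z, hz, hzy⟩ := hnotmin (A := s ++ x :: (t ++ C)) (x := y) (B := D)
        (by rw [e, e4]; simp) hy'
      refine ha x y z ?_ (by omega) hzy
      have : w = (s ++ x :: (t ++ C)) ++ y :: D := by rw [e, e4]; simp
      rw [this]
      exact three_sublist_of_mem (by simp) hz
    · intro hx _
      rw [e] at hx hnd
      rw [isRLMin_iff fun hm => by simpa using List.disjoint_of_nodup_append hnd hm] at hx
      exact lt_of_le_of_ne (hx y (by simp [hy])) hne
  refine ⟨before, rest, _, hd', hbeta, rfl, hsplit, hbef, ?_, ?_⟩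
  · rw [← hsplit, List.pairwise_filter]
    exact hpw.imp fun h hx hy => h.1 (by simpa using hx) (by simpa using hy)
  · rw [List.pairwise_filter]
    exact hpw.imp fun h hx hy => h.2 (by simpa using hx) (by simpa using hy)

/-- `β` shifts the right-to-left minima from `1` on, that is, all of them, one position to the
right, and puts the other letters, among them the new largest one, in increasing order. -/
theorem beta_spec {w : Word} (h : w ∈ Av [3, 2, 1]) (hw : 0 < w.length) :
    beta w ∈ Av [3, 2, 1] ∧ (beta w).length = w.length + 1 ∧
      ∀ i v, v ≤ w.length → (SE (beta w) i v ↔ SE w (i - 1) v) := by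
  obtain ⟨before, rest, xs, hd, hbeta, hxs, hfilt, hbef, hsort, hsort'⟩ :=
    beta_decomposition h hw
  generalize hM : w.length + 1 = M at hbeta
  have hlt : ∀ x ∈ w, x < M := fun x hx => by have := h.1.mem.1 hx; omega
  have hmemxs : ∀ x ∈ before ++ xs, x ∈ w := fun x hx => by
    rw [← hfilt] at hx; exact List.mem_of_mem_filter hx
  have hMw : M ∉ w := fun hm => by have := hlt _ hm; omega
  have hsortM : (before ++ (xs ++ [M])).Pairwise (· < ·) := by
    rw [← List.append_assoc, List.pairwise_append]
    refine ⟨hsort, by simp, fun x hx y hy => ?_⟩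
    simp only [List.mem_singleton] at hy
    rw [hy]; exact hlt x (hmemxs x hx)
  have hndM : (M :: xs).Nodup := by
    have := (List.pairwise_append.1 hsortM).2.1
    have h2 : (xs ++ [M]).Nodup := this.imp fun h => ne_of_lt h
    exact (List.perm_append_singleton M xs).nodup_iff.1 h2
  have hmap := map_formPerm_cons M xs hndM
  set f := (M :: xs).formPerm with hf
  have hfix : ∀ y, y ∉ M :: xs → f y = y := fun y hy => List.formPerm_apply_of_notMem hy
  have hbox : ∀ y ∈ M :: xs, f y ∈ M :: xs := fun y hy => List.formPerm_apply_mem_of_mem hy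
  have hxsnot : ∀ y ∈ xs, ¬ IsRLMin w y := fun y hy => by
    rw [hxs] at hy; simpa using (List.mem_filter.1 hy).2
  -- letters that are right-to-left minima are fixed
  have hfixmin : ∀ y ∈ w, IsRLMin w y → f y = y := by
    intro y hy hmin
    refine hfix y fun hm => ?_
    rcases List.mem_cons.1 hm with rfl | hm
    · exact hMw hy
    · exact hxsnot y hm hmin
  have hbefnot : ∀ y ∈ before, y ∉ M :: xs := by
    intro y hy hm
    rcases List.mem_cons.1 hm with rfl | hm
    · exact hMw (hmemxs _ (List.mem_append_left _ hy))
    · have := (List.pairwise_append.1 hsort).2.2 y hy y hm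
      omega
  -- no old letter is replaced by a smaller one
  have hge : ∀ y ∈ w, y ≤ f y := by
    intro y hy
    by_cases hyb : y ∈ M :: xs
    · have hyx : y ∈ xs := by
        rcases List.mem_cons.1 hyb with rfl | hm
        · exact absurd hy hMw
        · exact hm
      obtain ⟨k, hk, rfl⟩ := List.mem_iff_getElem.1 hyx
      have e1 : f xs[k] = (xs ++ [M])[k + 1]'(by simp; omega) := by
        have : ((M :: xs).map f)[k + 1]'(by simp; omega) = f xs[k] := by simp
        rw [← this]
        congr 1
      have e2 := List.pairwise_iff_getElem.1 (List.pairwise_append.1 hsortM).2.1 k (k + 1)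
        (by simp; omega) (by simp; omega) (by omega)
      rw [List.getElem_append_left hk] at e2
      rw [e1]; exact e2.le
    · rw [hfix y hyb]
  set W := before ++ M :: 1 :: rest with hW
  have hWlen : W.length = M := by
    have := congrArg List.length hd
    simp at this
    simp [hW]; omega
  have hWmem : ∀ y ∈ W, y = M ∨ y ∈ w := by
    intro y hy
    rw [hd]
    simp only [hW, List.mem_append, List.mem_cons] at hy ⊢
    tauto
  have hWnd : W.Nodup := by
    have : W.Perm (M :: w) := by rw [hd]; exact List.perm_middle
    exact this.nodup_iff.2 (List.nodup_cons.2 ⟨hMw, h.1.nodup⟩)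
  have hfMem : ∀ y ∈ W, f y = M ∨ f y ∈ w := by
    intro y hy
    by_cases hyb : y ∈ M :: xs
    · rcases List.mem_cons.1 (hbox y hyb) with h1 | h1
      · exact Or.inl h1
      · exact Or.inr (hmemxs _ (List.mem_append_right _ h1))
    · rw [hfix y hyb]; exact hWmem y hy
  have hlen : (beta w).length = M := by rw [hbeta, List.length_map, hWlen]
  have hperm : IsPerm (beta w) := by
    refine isPerm_of_nodup hlen ?_ fun x hx => ?_
    · rw [hbeta]; exact hWnd.map f.injective
    · rw [hbeta] at hx
      obtain ⟨y, hy, rfl⟩ := List.mem_map.1 hx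
      rcases hfMem y hy with h1 | h1
      · omega
      · have := h.1.mem.1 h1; omega
  have hone : IsRLMin w 1 := by
    have : 1 ∉ before := fun hm => by
      have h2 := h.1.nodup
      rw [hd] at h2
      simpa using List.disjoint_of_nodup_append h2 hm
    rw [hd, isRLMin_iff this]
    intro z hz
    exact (h.1.mem.1 (show z ∈ w by rw [hd]; simp [hz])).1
  have h1w : 1 ∈ w := by rw [hd]; simp
  refine ⟨⟨hperm, ?_⟩, hlen, fun i v hv => ?_⟩
  · -- right-to-left minima of `w` on one side, all other letters on the other
    let q : ℕ → Bool := fun x => decide (x ∈ w ∧ IsRLMin w x)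
    have hqf : ∀ y ∈ W, q (f y) = q y := by
      intro y hy
      by_cases hyb : y ∈ M :: xs
      · have hno : ∀ x ∈ M :: xs, q x = false := by
          intro x hx
          rcases List.mem_cons.1 hx with rfl | hx
          · simp [q, hMw]
          · simp [q, hxsnot x hx]
        rw [hno y hyb, hno _ (hbox y hyb)]
      · rw [hfix y hyb]
    have hMq : q M = false := by simp [q, hMw]
    have hqw : ∀ y ∈ w, q y = decide (IsRLMin w y) := fun y hy => by simp [q, hy]
    have e1 : (beta w).filter q = w.filter (fun x => decide (IsRLMin w x)) := by
      rw [hbeta, List.filter_map]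
      have : W.filter (q ∘ f) = w.filter (fun x => decide (IsRLMin w x)) := by
        rw [List.filter_congr (p := q ∘ f) (q := q) fun y hy => hqf y hy, hW, List.filter_append,
          List.filter_cons_of_neg (by simp [hMq]), ← List.filter_append, ← hd]
        exact List.filter_congr hqw
      rw [this]
      conv_rhs => rw [← List.map_id (w.filter (fun x => decide (IsRLMin w x)))]
      refine List.map_congr_left fun y hy => ?_
      obtain ⟨h1, h2⟩ := List.mem_filter.1 hy
      exact hfixmin y h1 (by simpa using h2)
    have e2 : (beta w).filter (fun x => !q x) = before ++ (xs ++ [M]) := by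
      rw [hbeta, List.filter_map]
      have : W.filter ((fun x => !q x) ∘ f) = before ++ (M :: xs) := by
        rw [List.filter_congr (p := (fun x => !q x) ∘ f) (q := fun x => !q x) fun y hy => by simp [hqf y hy], hW,
          List.filter_append, List.filter_cons_of_pos (by simp [hMq])]
        congr 1
        · rw [List.filter_eq_self]
          intro x hx
          simp [q, hbef x hx]
        · congr 1
          rw [hxs]
          refine List.filter_congr fun x hx => ?_
          have : x ∈ w := by rw [hd]; exact List.mem_append_right _ hx
          simp [q, this]
      rw [this, List.map_append, hmap]
      congr 1
      conv_rhs => rw [← List.map_id before]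
      exact List.map_congr_left fun y hy => hfix y (hbefnot y hy)
    refine avoids_321_of_filter q ?_ ?_
    · rw [e1]; exact hsort'
    · rw [e2]; exact hsortM
  · unfold SE
    rw [hbeta, ← List.map_drop]
    constructor
    · rintro ⟨z, hz, hzv⟩
      obtain ⟨y, hy, rfl⟩ := List.mem_map.1 hz
      have hyM : i ≤ before.length → ∃ u ∈ w.drop (i - 1), u ≤ v := by
        intro hi
        refine ⟨1, ?_, ?_⟩
        · rw [hd, List.drop_append]
          rw [show i - 1 - before.length = 0 by omega]
          simp
        · rcases hfMem y (List.mem_of_mem_drop hy) with h1 | h1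
          · omega
          · have := h.1.mem.1 h1; omega
      rcases Nat.lt_or_ge before.length i with hi | hi
      · have : W.drop i = w.drop (i - 1) := by
          rw [hW, hd, List.drop_append, List.drop_append, List.drop_eq_nil_of_le hi.le,
            List.drop_eq_nil_of_le (show before.length ≤ i - 1 by omega),
            show i - before.length = (i - 1 - before.length) + 1 by omega, List.drop_succ_cons]
        rw [this] at hy
        exact ⟨y, hy, (hge y (List.mem_of_mem_drop hy)).trans hzv⟩
      · exact hyM hi
    · rintro ⟨u, hu, huv⟩
      have h1v : 1 ≤ v := by
        have := (h.1.mem.1 (List.mem_of_mem_drop hu)).1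
        omega
      rcases Nat.lt_or_ge before.length i with hi | hi
      · have : W.drop i = w.drop (i - 1) := by
          rw [hW, hd, List.drop_append, List.drop_append, List.drop_eq_nil_of_le hi.le,
            List.drop_eq_nil_of_le (show before.length ≤ i - 1 by omega),
            show i - before.length = (i - 1 - before.length) + 1 by omega, List.drop_succ_cons]
        rw [this]
        -- the least letter of the suffix is a right-to-left minimum
        obtain ⟨y, hy, hmin⟩ : ∃ y ∈ w.drop (i - 1), ∀ z ∈ w.drop (i - 1), y ≤ z := by
          obtain ⟨y, hy, hmin⟩ := Finset.exists_min_image (w.drop (i - 1)).toFinset id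
            ⟨u, by simpa using hu⟩
          exact ⟨y, by simpa using hy, fun z hz => hmin z (by simpa using hz)⟩
        have hyw := List.mem_of_mem_drop hy
        refine ⟨y, List.mem_map.2 ⟨y, hy, hfixmin y hyw ?_⟩, (hmin u hu).trans huv⟩
        obtain ⟨s, t, e⟩ := List.append_of_mem hy
        have e' : w = (w.take (i - 1) ++ s) ++ y :: t := by
          rw [List.append_assoc, ← e, List.take_append_drop]
        have hnot : y ∉ w.take (i - 1) ++ s := fun hm => by
          have h2 := h.1.nodup
          rw [e'] at h2
          simpa using List.disjoint_of_nodup_append h2 hm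
        rw [e', isRLMin_iff hnot]
        exact fun z hz => hmin z (by rw [e]; simp [hz])
      · refine ⟨1, List.mem_map.2 ⟨1, ?_, hfixmin 1 h1w hone⟩, h1v⟩
        rw [hW, List.drop_append, show i - before.length = 0 by omega]
        simp

/-! ### The recursive bijection -/

/-- The right-to-left minima of `Φ(ρ)` are those of `ρ`, reflected in the antidiagonal. -/
theorem phiGraph_spec {ρ π : Word} (h : PhiGraph ρ π) :
    ρ ∈ Av [2, 3, 1] ∧ π ∈ Av [3, 2, 1] ∧ ρ.length = π.length ∧
      ∀ i v, i ≤ π.length → v ≤ π.length →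
        (SE π i v ↔ SE ρ (π.length - v) (π.length - i)) := by
  induction h with
  | nil =>
    refine ⟨⟨by simp [IsPerm], avoids_iff_231.2 fun x y z h => by simp at h⟩,
      ⟨by simp [IsPerm], avoids_iff_321.2 fun x y z h => by simp at h⟩, rfl, by simp [SE]⟩
  | @alpha σ σ₁ _ ih =>
    obtain ⟨h1, h2, h3, h4⟩ := ih
    rcases Nat.eq_zero_or_pos σ₁.length with h0 | hpos
    · have e1 : σ₁ = [] := List.length_eq_zero_iff.1 h0
      have e : σ = [] := List.length_eq_zero_iff.1 (h3.trans h0)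
      subst e1 e
      have hb : beta [] = [1] := by simp [beta]
      rw [hb]
      refine ⟨alpha_mem_Av_231 h1, ⟨by decide, by decide⟩, rfl, fun i v hi hv => ?_⟩
      simp only [List.length_cons, List.length_nil] at hi hv ⊢
      interval_cases i <;> interval_cases v <;> simp [SE, PermBij.alpha]
    · obtain ⟨b1, b2, b3⟩ := beta_spec h2 hpos
      refine ⟨alpha_mem_Av_231 h1, b1, by simp [b2, h3], fun i v hi hv => ?_⟩
      rw [b2] at hi hv ⊢
      rcases Nat.lt_or_ge σ₁.length v with hvn | hvn
      · have : v = σ₁.length + 1 := by omega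
        subst this
        rw [Nat.sub_self, SE_alpha_zero]
        rcases Nat.lt_or_ge σ₁.length i with hin | hin
        · refine iff_of_false (not_SE_of_le (by omega)) ?_
          rw [show σ₁.length + 1 - i = 0 by omega]
          rintro (h | h)
          · omega
          · exact h1.1.not_SE_zero _ h
        · exact iff_of_true (b1.1.SE_of_length_le (by omega) (by omega))
            (Or.inr (h1.1.SE_zero_left (by omega) (by omega)))
      · rw [b3 i v hvn, show σ₁.length + 1 - v = (σ₁.length - v) + 1 by omega, SE_alpha_succ]
        rcases Nat.eq_zero_or_pos i with rfl | hi0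
        · rw [Nat.sub_zero, h1.1.SE_min_length, h3, min_eq_right (by omega)]
          simpa using h4 0 v (by omega) hvn
        · rw [h4 (i - 1) v (by omega) hvn,
            show σ₁.length - (i - 1) = σ₁.length + 1 - i by omega]
  | @osum σ σ₁ τ τ₁ _ _ ih1 ih2 =>
    obtain ⟨a1, a2, a3, a4⟩ := ih1
    obtain ⟨b1, b2, b3, b4⟩ := ih2
    refine ⟨osum_mem_Av_231 a1 b1, osum_mem_Av_321 b2 a2, by simp [a3, b3, Nat.add_comm],
      fun i v hi hv => ?_⟩
    simp only [length_osum] at hi hv ⊢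
    rw [SE_osum, SE_osum, a3]
    rcases Nat.lt_or_ge τ₁.length v with hvl | hvl
    · rcases Nat.lt_or_ge i τ₁.length with hil | hil
      · refine iff_of_true (Or.inl (b2.1.SE_of_length_le hil hvl.le)) (Or.inr ⟨by omega, ?_⟩)
        rw [show τ₁.length + σ₁.length - v - σ₁.length = 0 by omega]
        exact b1.1.SE_zero_left (by omega) (by omega)
      · have e1 : ¬ SE τ₁ i v := not_SE_of_le hil
        have e2 : ¬ (σ₁.length ≤ τ₁.length + σ₁.length - i ∧
            SE τ (τ₁.length + σ₁.length - v - σ₁.length)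
              (τ₁.length + σ₁.length - i - σ₁.length)) := by
          rintro ⟨h5, h6⟩
          rw [show τ₁.length + σ₁.length - i - σ₁.length = 0 by omega] at h6
          exact b1.1.not_SE_zero _ h6
        rw [or_iff_right e1, or_iff_left e2, a4 _ _ (by omega) (by omega),
          show σ₁.length - (v - τ₁.length) = τ₁.length + σ₁.length - v by omega,
          show σ₁.length - (i - τ₁.length) = τ₁.length + σ₁.length - i by omega]
        exact and_iff_right hvl.le
    · have e1 : ¬ (τ₁.length ≤ v ∧ SE σ₁ (i - τ₁.length) (v - τ₁.length)) := by
        rintro ⟨h5, h6⟩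
        rw [show v - τ₁.length = 0 by omega] at h6
        exact a2.1.not_SE_zero _ h6
      have e2 : ¬ SE σ (τ₁.length + σ₁.length - v) (τ₁.length + σ₁.length - i) :=
        not_SE_of_le (by omega)
      rw [or_iff_left e1, or_iff_right e2]
      rcases Nat.lt_or_ge τ₁.length i with hil | hil
      · exact iff_of_false (not_SE_of_le hil.le) fun h => by omega
      · rw [b4 i v hil hvl, and_iff_right (by omega),
          show τ₁.length + σ₁.length - v - σ₁.length = τ₁.length - v by omega,
          show τ₁.length + σ₁.length - i - σ₁.length = τ₁.length - i by omega]

theorem exists_osum_alpha {w : Word} (h : w ∈ Av [2, 3, 1]) (hw : 0 < w.length) :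
    ∃ L R, L ∈ Av [2, 3, 1] ∧ R ∈ Av [2, 3, 1] ∧ w = osum L (alpha R) := by
  have ha := avoids_iff_231.1 h.2
  have hnd := h.1.nodup
  obtain ⟨L, R, e⟩ := List.append_of_mem (h.1.mem.2 ⟨hw, le_rfl⟩)
  have hlen : w.length = L.length + R.length + 1 := by
    have := congrArg List.length e
    simp at this; omega
  generalize hN : w.length = N at *
  rw [e, List.nodup_append] at hnd
  obtain ⟨n1, n2, n3⟩ := hnd
  rw [List.nodup_cons] at n2
  have hLw : ∀ l ∈ L, 1 ≤ l ∧ l < N := fun l hl => by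
    have h1 := h.1.mem.1 (show l ∈ w by rw [e]; simp [hl])
    have h2 := n3 l hl N (by simp)
    omega
  have hRw : ∀ r ∈ R, 1 ≤ r ∧ r < N := fun r hr => by
    have h1 := h.1.mem.1 (show r ∈ w by rw [e]; simp [hr])
    have h2 : r ≠ N := fun e' => n2.1 (e' ▸ hr)
    omega
  have hlt : ∀ l ∈ L, ∀ r ∈ R, l < r := by
    intro l hl r hr
    by_contra hc
    have := n3 l hl r (by simp [hr])
    exact ha l N r (e ▸ three_sublist_of_mem hl hr) (hLw l hl).2 (by omega)
  have hLp : IsPerm L := by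
    refine isPerm_of_nodup rfl n1 fun x hx => ⟨(hLw x hx).1, ?_⟩
    have : (List.range' 1 x).Subperm L := by
      refine List.subperm_of_subset List.nodup_range' fun y hy => ?_
      rw [List.mem_range'_1] at hy
      have hyN := (hLw x hx).2
      have h1 : y ∈ w := h.1.mem.2 (by omega)
      rw [e] at h1
      simp only [List.mem_append, List.mem_cons] at h1
      rcases h1 with h1 | h1 | h1
      · exact h1
      · omega
      · have := hlt x hx y h1; omega
    simpa using this.length_le
  have hRgt : ∀ r ∈ R, L.length < r := by
    intro r hr
    by_contra hc
    have : r ∈ L := hLp.mem.2 ⟨(hRw r hr).1, by omega⟩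
    exact n3 r this r (by simp [hr]) rfl
  refine ⟨L, R.map (· - L.length), ⟨hLp, ?_⟩, ⟨?_, ?_⟩, ?_⟩
  · rw [avoids_iff_231]
    intro x y z hs
    exact ha x y z (hs.trans (e ▸ List.sublist_append_left _ _))
  · refine isPerm_of_nodup (List.length_map _) (List.Nodup.map_on ?_ n2.2) fun x hx => ?_
    · intro x hx y hy hxy
      have := hRgt x hx
      have := hRgt y hy
      omega
    · obtain ⟨r, hr, rfl⟩ := List.mem_map.1 hx
      have := hRgt r hr
      have := hRw r hr
      omega
  · rw [avoids_iff_231]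
    intro x y z hs hxy hzx
    obtain ⟨l, hl, e'⟩ := List.sublist_map_iff.1 hs
    match l, e' with
    | [x', y', z'], e' =>
      simp only [List.map_cons, List.map_nil, List.cons.injEq, and_true] at e'
      obtain ⟨rfl, rfl, rfl⟩ := e'
      refine ha x' y' z' ?_ (by omega) (by
        have := hRgt z' (hl.subset (by simp))
        have := hRgt x' (hl.subset (by simp))
        omega)
      rw [e]
      exact hl.trans ((List.sublist_cons_self _ _).trans (List.sublist_append_right _ _))
  · unfold osum alpha
    rw [e]
    congr 1
    simp only [List.map_cons, List.length_map, List.map_map]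
    congr 1
    · omega
    · conv_lhs => rw [← List.map_id R]
      refine List.map_congr_left fun r hr => ?_
      have := hRgt r hr
      simp; omega

theorem exists_phiGraph {ρ : Word} (h : ρ ∈ Av [2, 3, 1]) : ∃ π, PhiGraph ρ π := by
  generalize hn : ρ.length = n
  induction n using Nat.strong_induction_on generalizing ρ with
  | _ n ih =>
    rcases Nat.eq_zero_or_pos n with h0 | hpos
    · have : ρ = [] := List.length_eq_zero_iff.1 (hn.trans h0)
      subst this
      exact ⟨_, .nil⟩
    · obtain ⟨L, R, hL, hR, rfl⟩ := exists_osum_alpha h (by omega)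
      simp only [length_osum, length_alpha] at hn
      obtain ⟨L', hL'⟩ := ih L.length (by omega) hL rfl
      obtain ⟨R', hR'⟩ := ih R.length (by omega) hR rfl
      exact ⟨_, .osum hL' (.alpha hR')⟩

theorem sameMinima_of_phiGraph {ρ π : Word} (h : PhiGraph ρ π) : SameMinima π ρ.reverse := by
  obtain ⟨h1, h2, h3, h4⟩ := phiGraph_spec h
  refine ⟨h2, reverse_mem_Av_132.2 h1, by simp [h3], fun i v => ?_⟩
  rw [h2.1.reverse.NE_clamp, h1.1.reverse.NE_clamp (i := v)]
  simp only [List.length_reverse, NE_reverse, h3]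
  rw [h4 _ _ (by omega) (by omega), Nat.sub_sub_self (by omega)]

theorem holds_phi_iff (π σ : Word) :
    Composite.graph ⟨[.r], .Phi, true, []⟩ π σ ↔ SameMinima π σ := by
  constructor
  · rintro ⟨-, ρ, rfl, h⟩
    exact sameMinima_of_phiGraph h
  · intro h
    obtain ⟨π', hπ'⟩ := exists_phiGraph (ρ := σ.reverse)
      (reverse_mem_Av_132.1 (by simpa using h.2.1))
    have h' := sameMinima_of_phiGraph hπ'
    rw [List.reverse_reverse] at h'
    rw [h.left_unique h']
    exact ⟨h'.1.1, σ.reverse, by simp [act, Sym.act], hπ'⟩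

/-! ### Dyck paths without consecutive up-steps -/

/-- No two consecutive steps are up-steps. -/
def NoUU (P : Path) : Prop := P.IsChain fun s t => s = .U → t = .D

theorem essentialCells_eq_empty_iff {P : DyckWord} : essentialCells P = ∅ ↔ NoUU P.toList := by
  unfold NoUU
  rw [List.isChain_iff_getElem]
  constructor
  · intro h i hi hU
    by_contra hD
    have hU' := (DyckStep.dichotomy _).resolve_right hD
    have : (i + 1, height P.toList (i + 1)) ∈ essentialCells P := by
      refine ⟨by simp, ?_, ?_, rfl⟩
      · simp only [Nat.add_sub_cancel]
        rw [List.getElem?_eq_getElem (by omega), hU]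
      · simp only
        rw [List.getElem?_eq_getElem hi, hU']
    rw [h] at this
    exact this
  · intro h
    rw [Set.eq_empty_iff_forall_notMem]
    rintro c ⟨h1, h2, h3, -⟩
    obtain ⟨h4, h5⟩ := List.getElem?_eq_some_iff.1 h2
    obtain ⟨h6, h7⟩ := List.getElem?_eq_some_iff.1 h3
    have := h (c.1 - 1) (by omega) h5
    simp only [show c.1 - 1 + 1 = c.1 by omega, h7] at this
    cases this

theorem NoUU.right {P Q : Path} (h : NoUU (P ++ Q)) : NoUU Q := (List.isChain_append.1 h).2.1

theorem NoUU.left {P Q : Path} (h : NoUU (P ++ Q)) : NoUU P := (List.isChain_append.1 h).1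

theorem toList_add (P Q : DyckWord) : (P + Q).toList = P.toList ++ Q.toList := rfl

theorem toList_nest (P : DyckWord) : P.nest.toList = .U :: (P.toList ++ [.D]) := rfl

/-- A Dyck path without consecutive up-steps is `ud⋯ud`. -/
theorem exists_of_noUU {P : DyckWord} (h : NoUU P.toList) (hP : P ≠ 0) :
    ∃ Q : DyckWord, P = DyckWord.nest 0 + Q ∧ NoUU Q.toList ∧
      P.semilength = Q.semilength + 1 := by
  have hd := P.nest_insidePart_add_outsidePart hP
  have hin : P.insidePart = 0 := by
    by_contra hne
    rw [← hd, toList_add, toList_nest] at h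
    have h1 : P.insidePart.toList ≠ [] := DyckWord.toList_ne_nil.2 hne
    have h2 := P.insidePart.head_eq_U h1
    obtain ⟨s, t, e⟩ := List.exists_cons_of_ne_nil h1
    simp only [e, List.head_cons] at h2
    rw [e, h2] at h
    have := (List.isChain_cons_cons.1 h).1 rfl
    cases this
  rw [hin] at hd
  refine ⟨P.outsidePart, hd.symm, ?_, ?_⟩
  · rw [← hd, toList_add] at h
    exact h.right
  · rw [← hd]
    simp [Nat.add_comm]

/-! ### Words that fit a Dyck path -/

/-- The right-to-left minima of the permutation `w` are given by the peaks of the path `P`: if the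
up-step number `k` and the down-step number `v` form a peak, then the letter `v + 1` stands at
position `k`, where steps and positions are counted from zero. -/
structure Fits (w : Word) (P : DyckWord) : Prop where
  isPerm : IsPerm w
  length_eq : w.length = P.semilength
  iff : ∀ k v, SE w k (v + 1) ↔ Precedes P.toList k v

theorem Fits.of_box {w : Word} {P : DyckWord} (h : IsPerm w) (hl : w.length = P.semilength)
    (hiff : ∀ k v, k < w.length → v < w.length → (SE w k (v + 1) ↔ Precedes P.toList k v)) :
    Fits w P := by
  refine ⟨h, hl, fun k v => ?_⟩
  have hD : P.toList.count .D = w.length := by rw [hl, P.semilength_eq_count_D]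
  have hU : P.toList.count .U = w.length := by rw [hl]; rfl
  rcases Nat.lt_or_ge k w.length with hk | hk
  · rcases Nat.lt_or_ge v w.length with hv | hv
    · exact hiff k v hk hv
    · exact iff_of_true (h.SE_of_length_le hk (by omega))
        (precedes_of_lt (by omega) (by omega))
  · exact iff_of_false (not_SE_of_le hk) (not_precedes_of_le (by omega))

theorem Fits.osum {σ τ : Word} {P Q : DyckWord} (h : Fits σ P) (h' : Fits τ Q) :
    Fits (osum σ τ) (P + Q) := by
  refine ⟨h.isPerm.osum h'.isPerm, by simp [h.length_eq, h'.length_eq], fun k v => ?_⟩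
  have hD : P.toList.count .D = σ.length := by rw [h.length_eq, P.semilength_eq_count_D]
  have hU : P.toList.count .U = σ.length := by rw [h.length_eq]; rfl
  rw [SE_osum, toList_add, precedes_append, hD, hU, h.iff]
  constructor
  · rintro (h1 | ⟨h1, h2⟩)
    · exact Or.inl h1
    · have hv : σ.length ≤ v := by
        by_contra hc
        rw [show v + 1 - σ.length = 0 by omega] at h2
        exact h'.isPerm.not_SE_zero _ h2
      rcases Nat.lt_or_ge k σ.length with hk | hk
      · exact Or.inl (precedes_of_lt (by omega) (by omega))
      · refine Or.inr ⟨hk, hv, ?_⟩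
        rwa [show v + 1 - σ.length = (v - σ.length) + 1 by omega, h'.iff] at h2
  · rintro (h1 | ⟨h1, h2, h3⟩)
    · exact Or.inl h1
    · refine Or.inr ⟨by omega, ?_⟩
      rwa [show v + 1 - σ.length = (v - σ.length) + 1 by omega, h'.iff]

theorem Fits.alpha {σ : Word} {P : DyckWord} (h : Fits σ P) : Fits (alpha σ) P.nest := by
  refine ⟨h.isPerm.alpha, by simp [h.length_eq], fun k v => ?_⟩
  rw [toList_nest]
  cases k with
  | zero =>
    refine iff_of_true (SE_alpha_zero.2 ?_) (Or.inl rfl)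
    rcases Nat.eq_zero_or_pos σ.length with h0 | h0
    · left; omega
    · exact Or.inr (h.isPerm.SE_zero_left h0 (by omega))
  | succ k =>
    rw [SE_alpha_succ, h.iff]
    simp [Precedes, precedes_append]

theorem Fits.nil : Fits [] 0 :=
  ⟨by simp [IsPerm], rfl, fun k v => by simp [SE, Precedes]⟩

theorem range'_map_add (s n c : ℕ) :
    (List.range' s n).map (· + c) = List.range' (s + c) n := by
  have : (List.range' s n).map (· + c) = (List.range' s n).map (c + ·) :=
    List.map_congr_left fun a _ => Nat.add_comm a c
  rw [this, List.map_add_range', Nat.add_comm]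

theorem range'_add_eq_osum (m n : ℕ) :
    List.range' 1 (m + n) = osum (List.range' 1 m) (List.range' 1 n) := by
  unfold PermBij.osum
  rw [List.length_range', ← List.range'_append, range'_map_add, Nat.one_mul]

theorem fits_range'_of_noUU {P : DyckWord} (h : NoUU P.toList) :
    Fits (List.range' 1 P.semilength) P := by
  generalize hn : P.semilength = n
  induction n generalizing P with
  | zero =>
    have : P = 0 := by
      by_contra hne
      obtain ⟨Q, -, -, h2⟩ := exists_of_noUU h hne
      omega
    subst this
    exact Fits.nil
  | succ n ih =>
    have hP : P ≠ 0 := by rintro rfl; simp at hn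
    obtain ⟨Q, rfl, h1, h2⟩ := exists_of_noUU h hP
    rw [Nat.add_comm, range'_add_eq_osum]
    exact Fits.nil.alpha.osum (ih h1 (by omega))

/-! ### The action of runs -/

theorem swapAt_append (X C : Word) (x c : ℕ) :
    swapAt (X ++ x :: c :: C) (X.length + 1) = X ++ c :: x :: C := by
  simp [swapAt]

/-- The run `s_b ⋯ s_a` moves the letter in position `b + 1` to position `a`. -/
theorem foldl_swapAt_run (A B C : Word) (c a b : ℕ) (ha : A.length + 1 = a)
    (hb : A.length + B.length = b) :
    (run b a).foldl swapAt (A ++ B ++ c :: C) = A ++ c :: (B ++ C) := by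
  induction B using List.reverseRecOn generalizing b C with
  | nil =>
    have : run b a = [] := by
      unfold run
      rw [show b + 1 - a = 0 by simp at hb; omega]; rfl
    simp [this]
  | append_singleton B x ih =>
    simp only [List.length_append, List.length_cons, List.length_nil] at hb
    have hrun : run b a = b :: run (b - 1) a := by
      unfold run
      rw [show b + 1 - a = (b - 1 + 1 - a) + 1 by omega, List.range'_concat, List.reverse_append]
      simp
      omega
    have hs : swapAt (A ++ (B ++ [x]) ++ c :: C) b = A ++ B ++ c :: (x :: C) := by
      have := swapAt_append (A ++ B) C x c
      rw [List.length_append, show A.length + B.length + 1 = b by omega] at this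
      simpa using this
    rw [hrun, List.foldl_cons, hs, ih (x :: C) (b - 1) (by omega)]
    simp

/-! ### The trapezoidal decomposition -/

/-- The word of a trapezoidal decomposition, acting on the letters `c + 1, …, c + n` that stand
in the positions after `pre`. The label of a part that starts at `(x, y)` exceeds the label inside
the part by `(x - y) / 2`, which is the number of letters to its left. -/
theorem trapezoidal_spec {x y : ℕ} {P : DyckWord} {σ : List (List ℕ)} (h : Trapezoidal x y P σ)
    (hyx : y ≤ x) (hev : Even (x - y)) :
    ∃ t, t ∈ Av [2, 3, 1] ∧ Fits t P ∧ ∀ (pre suf : Word) (c : ℕ), pre.length = (x - y) / 2 →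
      σ.flatten.foldl swapAt (pre ++ List.range' (c + 1) P.semilength ++ suf) =
        pre ++ t.map (· + c) ++ suf := by
  induction h with
  | @nil x y P hP =>
    have hf := fits_range'_of_noUU (essentialCells_eq_empty_iff.1 hP)
    refine ⟨List.range' 1 P.semilength, ⟨hf.isPerm, ?_⟩, hf, fun pre suf c _ => ?_⟩
    · rw [avoids_iff_231]
      intro a b d hs hab hda
      have := (List.pairwise_lt_range' (s := 1) (n := P.semilength)).sublist hs
      simp at this
      omega
    · simp only [List.flatten_nil, List.foldl_nil, range'_map_add, Nat.add_comm c 1]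
  | @strip x y Q₁ Q₂ R σ τ hQ₂ hR h1 h2 ih1 ih2 =>
    obtain ⟨t₁, a1, f1, w1⟩ := ih1 hyx hev
    have l1 := Q₁.two_mul_semilength_eq_length
    have l2 := Q₂.two_mul_semilength_eq_length
    obtain ⟨t₂, a2, f2, w2⟩ := ih2 (by omega) (by
      rw [show x + Q₁.toList.length + 1 - (y + 1) = (x - y) + Q₁.toList.length by omega]
      exact hev.add ⟨Q₁.semilength, by omega⟩)
    have hpos : 0 < Q₂.semilength := by
      rw [Nat.pos_iff_ne_zero]
      intro h0
      rw [h0] at l2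
      exact hQ₂ (DyckWord.toList_eq_nil.1 (List.length_eq_zero_iff.1 (by omega)))
    have f3 := fits_range'_of_noUU (essentialCells_eq_empty_iff.1 hR)
    obtain ⟨d, hd⟩ := hev
    have a3 : List.range' 1 R.semilength ∈ Av [2, 3, 1] := by
      refine ⟨f3.isPerm, avoids_iff_231.2 fun a b d hs hab hda => ?_⟩
      have := (List.pairwise_lt_range' (s := 1) (n := R.semilength)).sublist hs
      simp at this
      omega
    refine ⟨osum (osum t₁ (alpha t₂)) (List.range' 1 R.semilength),
      osum_mem_Av_231 (osum_mem_Av_231 a1 (alpha_mem_Av_231 a2)) a3,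
      (f1.osum f2.alpha).osum f3, fun pre suf c hpre => ?_⟩
    have e1 : t₁.length = Q₁.semilength := f1.length_eq
    have e2 : t₂.length = Q₂.semilength := f2.length_eq
    have hsl : (Q₁ + Q₂.nest + R).semilength =
        Q₁.semilength + (Q₂.semilength + (1 + R.semilength)) := by
      simp only [DyckWord.semilength_add, DyckWord.semilength_nest]
      omega
    have hr := foldl_swapAt_run (pre ++ t₁.map (· + c))
      (t₂.map (· + (c + Q₁.semilength)))
      (List.range' (c + Q₁.semilength + Q₂.semilength + 2) R.semilength ++ suf)
      (c + Q₁.semilength + Q₂.semilength + 1)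
      (diffLabel (x + Q₁.toList.length + 1, y + 1))
      (diffLabel (x + Q₁.toList.length + Q₂.toList.length - 1, y + 1))
      (by simp only [List.length_append, List.length_map, diffLabel]; omega)
      (by simp only [List.length_append, List.length_map, diffLabel]; omega)
    have hw1 := w1 pre (List.range' (c + Q₁.semilength + 1) Q₂.semilength ++
      (c + Q₁.semilength + Q₂.semilength + 1) ::
        (List.range' (c + Q₁.semilength + Q₂.semilength + 2) R.semilength ++ suf)) c hpre
    have hw2 := w2 (pre ++ t₁.map (· + c)) ((c + Q₁.semilength + Q₂.semilength + 1) ::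
        (List.range' (c + Q₁.semilength + Q₂.semilength + 2) R.semilength ++ suf))
      (c + Q₁.semilength) (by simp only [List.length_append, List.length_map]; omega)
    have hsplit : pre ++ List.range' (c + 1) (Q₁ + Q₂.nest + R).semilength ++ suf =
        pre ++ List.range' (c + 1) Q₁.semilength ++
          (List.range' (c + Q₁.semilength + 1) Q₂.semilength ++
            (c + Q₁.semilength + Q₂.semilength + 1) ::
              (List.range' (c + Q₁.semilength + Q₂.semilength + 2) R.semilength ++ suf)) := by
      rw [hsl, ← List.range'_append, ← List.range'_append, ← List.range'_append]
      simp only [Nat.one_mul, List.append_assoc, List.range'_one, List.cons_append,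
        List.nil_append, Nat.add_assoc, Nat.reduceAdd,
        Nat.add_comm 1]
    simp only [List.flatten_append, List.flatten_cons, List.flatten_nil, List.append_nil,
      List.foldl_append]
    rw [hsplit, hw1, ← List.append_assoc (pre ++ t₁.map (· + c)), hw2, hr]
    simp only [PermBij.osum, PermBij.alpha, List.map_append, List.map_cons, List.map_map,
      List.append_assoc, List.cons_append, range'_map_add, List.length_append, List.length_cons,
      List.length_map, e1, e2, Function.comp_def, Nat.add_assoc]
    congr 2
    congr 1
    · omega
    congr 1
    · exact List.map_congr_left fun a _ => by omega
    congr 2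
    omega

/-- The decomposition `P = Q₁ u Q₂ d R` at the rightmost essential cell touching the axis. -/
theorem exists_add_nest_add {P : DyckWord} (h : essentialCells P ≠ ∅) :
    ∃ Q₁ Q₂ R : DyckWord, P = Q₁ + Q₂.nest + R ∧ Q₂ ≠ 0 ∧ essentialCells R = ∅ := by
  generalize hn : P.semilength = n
  induction n using Nat.strong_induction_on generalizing P with
  | _ n ih =>
    have hP : P ≠ 0 := by
      rintro rfl
      exact h (essentialCells_eq_empty_iff.2 List.IsChain.nil)
    have hd := DyckWord.nest_insidePart_add_outsidePart hP
    rcases eq_or_ne (essentialCells P.outsidePart) ∅ with hS | hS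
    · refine ⟨0, P.insidePart, P.outsidePart, by rw [zero_add, hd], fun h0 => h ?_, hS⟩
      rw [essentialCells_eq_empty_iff] at hS ⊢
      rw [← hd, toList_add, h0]
      exact List.isChain_cons_cons.2 ⟨fun _ => rfl, List.IsChain.cons hS (by simp)⟩
    · obtain ⟨Q₁, Q₂, R, e, h1, h2⟩ :=
        ih _ (hn ▸ DyckWord.semilength_outsidePart_lt hP) hS rfl
      exact ⟨P.insidePart.nest + Q₁, Q₂, R,
        hd.symm.trans (by rw [e]; simp only [add_assoc]), h1, h2⟩

theorem exists_trapezoidal (P : DyckWord) (x y : ℕ) : ∃ σ, Trapezoidal x y P σ := by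
  generalize hn : P.semilength = n
  induction n using Nat.strong_induction_on generalizing P x y with
  | _ n ih =>
    rcases eq_or_ne (essentialCells P) ∅ with hP | hP
    · exact ⟨_, .nil hP⟩
    · obtain ⟨Q₁, Q₂, R, rfl, h1, h2⟩ := exists_add_nest_add hP
      simp only [DyckWord.semilength_add, DyckWord.semilength_nest] at hn
      obtain ⟨σ, hσ⟩ := ih Q₁.semilength (by omega) Q₁ x y rfl
      obtain ⟨τ, hτ⟩ := ih Q₂.semilength (by omega) Q₂ (x + Q₁.toList.length + 1) (y + 1) rfl
      exact ⟨_, .strip h1 h2 hσ hτ⟩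

/-! ### Cells below a Dyck path -/

theorem precedes_iff_count_take {P : Path} {k v : ℕ} :
    Precedes P k v ↔ k < (P.take (k + v + 1)).count .U := by
  induction P generalizing k v with
  | nil => simp [Precedes]
  | cons s P ih =>
    cases s with
    | U =>
      rw [List.take_succ_cons, List.count_cons_self]
      cases k with
      | zero => simp [Precedes]
      | succ k =>
        simp only [Precedes, Nat.add_sub_cancel, ih, Nat.add_right_comm k 1 v]
        omega
    | D =>
      have e : ∀ L : Path, (DyckStep.D :: L).count .U = L.count .U := fun L => by simp
      rw [List.take_succ_cons, e]
      cases v with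
      | zero =>
        have : (P.take k).count .U ≤ k := List.count_le_length.trans (by simp)
        simp only [Precedes, Nat.add_zero]
        omega
      | succ v =>
        simp only [Precedes, Nat.add_sub_cancel, ih, ne_eq, Nat.add_one_ne_zero,
          not_false_eq_true, true_and]
        rfl

theorem count_take_add_count_take (P : Path) {x : ℕ} (hx : x ≤ P.length) :
    (P.take x).count .U + (P.take x).count .D = x := by
  have h : ∀ L : Path, L.count .U + L.count .D = L.length := by
    intro L
    induction L with
    | nil => rfl
    | cons s L ih => cases s <;> simp <;> omega
  rw [h, List.length_take, min_eq_left hx]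

theorem count_U_add_count_D (P : Path) : P.count .U + P.count .D = P.length := by
  simpa using count_take_add_count_take P le_rfl

theorem height_add_count_D (P : DyckWord) (x : ℕ) :
    height P.toList x + (P.toList.take x).count .D = (P.toList.take x).count .U :=
  Nat.sub_add_cancel (P.count_D_le_count_U x)

/-- The cells correspond to the pairs of an up-step and a later down-step whose numbers are in
the opposite order. -/
theorem mem_cells_iff_precedes {P : DyckWord} {k v : ℕ} (h : v < k) :
    (k + v, k - v) ∈ cells P ↔ Precedes P.toList k v := by
  rw [precedes_iff_count_take]
  have h1 := height_add_count_D P (k + v + 1)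
  simp only [cells, Set.mem_ofPred_eq]
  have hev : Even (k + v + (k - v)) := ⟨k, by omega⟩
  have hl := count_U_add_count_D P.toList
  have he := P.count_U_eq_count_D
  rcases le_or_gt (k + v + 1) P.toList.length with hx | hx
  · have h2 := count_take_add_count_take P.toList hx
    constructor
    · rintro ⟨-, -, h3⟩
      omega
    · intro h3
      exact ⟨by omega, hev, by omega⟩
  · rw [List.take_of_length_le hx.le] at h1 ⊢
    constructor
    · rintro ⟨-, -, h3⟩
      omega
    · intro h3
      omega

/-- A Dyck path is determined by its semilength and its cells. -/
theorem eq_of_cells_eq {P Q : DyckWord} (hl : P.semilength = Q.semilength)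
    (h : cells P = cells Q) : P = Q := by
  have hP := P.semilength_eq_count_D
  have hQ := Q.semilength_eq_count_D
  have hP' : P.semilength = P.toList.count .U := rfl
  have hQ' : Q.semilength = Q.toList.count .U := rfl
  refine DyckWord.ext (path_ext (by omega) (by omega) fun k v hk hv => ?_)
  rcases lt_or_ge v k with hvk | hvk
  · rw [← mem_cells_iff_precedes hvk, ← mem_cells_iff_precedes hvk, h]
  · have key : ∀ R : DyckWord, k < R.semilength → Precedes R.toList k v := by
      intro R hR
      rw [precedes_iff_count_take]
      have h1 := R.count_D_le_count_U (k + v + 1)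
      have h3 := R.semilength_eq_count_D
      have h4 : R.semilength = R.toList.count .U := rfl
      rcases le_or_gt (k + v + 1) R.toList.length with hx | hx
      · have h2 := count_take_add_count_take R.toList hx
        omega
      · rw [List.take_of_length_le hx.le]
        omega
    exact iff_of_true (key P (by omega)) (key Q (by omega))

theorem NoUU.height_le_one {P : DyckWord} (h : NoUU P.toList) (x : ℕ) : height P.toList x ≤ 1 := by
  generalize hn : P.semilength = n
  induction n generalizing P x with
  | zero =>
    rw [DyckWord.semilength] at hn
    have := (List.take_sublist x P.toList).count_le .U
    unfold height
    omega
  | succ n ih =>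
    have hP : P ≠ 0 := by rintro rfl; simp at hn
    obtain ⟨Q, rfl, h1, h2⟩ := exists_of_noUU h hP
    have e : (DyckWord.nest 0 + Q).toList = .U :: .D :: Q.toList := rfl
    rw [e]
    match x with
    | 0 => simp [height]
    | 1 => simp [height]
    | x + 2 =>
      have := ih h1 x (by omega)
      simpa [height] using this

/-! ### The rightmost pair of consecutive up-steps -/

theorem exists_last_UU {L : Path} (h : ¬ NoUU L) :
    ∃ A T : Path, L = A ++ .U :: .U :: T ∧ NoUU (.U :: T) := by
  induction L with
  | nil => exact absurd List.IsChain.nil h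
  | cons s L ih =>
    by_cases hL : NoUU L
    · cases L with
      | nil => exact absurd (List.IsChain.singleton s) h
      | cons t L =>
        have h' : ¬ (s = .U → t = .D) := fun h' => h (List.isChain_cons_cons.2 ⟨h', hL⟩)
        cases s <;> cases t <;> simp at h'
        exact ⟨[], L, rfl, hL⟩
    · obtain ⟨A, T, rfl, hT⟩ := ih hL
      exact ⟨s :: A, T, rfl, hT⟩

/-- The first return to the axis of a path that starts at height `h`. -/
theorem exists_first_return {T : Path} {h : ℕ} (h0 : 0 < h)
    (hT : h + T.count .U = T.count .D) :
    ∃ X Z : Path, T = X ++ .D :: Z ∧ h + X.count .U = X.count .D + 1 ∧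
      ∀ j ≤ X.length, (X.take j).count .D < h + (X.take j).count .U := by
  induction T generalizing h with
  | nil => simp at hT; omega
  | cons s T ih =>
    cases s with
    | U =>
      have hT' : h + 1 + T.count .U = T.count .D := by
        simp at hT
        omega
      obtain ⟨X, Z, rfl, h1, h2⟩ := ih (by omega) hT'
      refine ⟨.U :: X, Z, rfl, by simp; omega, fun j hj => ?_⟩
      cases j with
      | zero => simpa using h0
      | succ j =>
        have := h2 j (by simpa using hj)
        simp
        omega
    | D =>
      have hT' : h - 1 + T.count .U = T.count .D := by
        simp at hT
        omega
      rcases Nat.lt_or_ge 1 h with h1 | h1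
      · obtain ⟨X, Z, rfl, h1, h2⟩ := ih (by omega) hT'
        refine ⟨.D :: X, Z, rfl, by simp; omega, fun j hj => ?_⟩
        cases j with
        | zero => simpa using h0
        | succ j =>
          have := h2 j (by simpa using hj)
          simp
          omega
      · exact ⟨[], T, rfl, by simp; omega, fun j _ => by simpa using h0⟩

/-- `P = A u u X d Z` where the two up-steps displayed are the rightmost consecutive ones and the
down-step displayed is the first one behind them that reaches the axis. -/
structure LastUU (P : DyckWord) (A X Z : Path) : Prop where
  eq : P.toList = A ++ .U :: .U :: (X ++ .D :: Z)
  noUU : NoUU (.U :: (X ++ .D :: Z))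
  count_eq : A.count .U + 2 + X.count .U = A.count .D + X.count .D + 1
  pos : ∀ j ≤ X.length, A.count .D + (X.take j).count .D < A.count .U + 2 + (X.take j).count .U

theorem exists_lastUU {P : DyckWord} (h : ¬ NoUU P.toList) : ∃ A X Z, LastUU P A X Z := by
  obtain ⟨A, T, hA, hT⟩ := exists_last_UU h
  have hle := P.count_D_le_count_U A.length
  have heq := P.count_U_eq_count_D
  rw [hA] at hle heq
  simp at hle heq
  obtain ⟨X, Z, rfl, h1, h2⟩ := exists_first_return (T := T) (h := A.count .U + 2 - A.count .D)
    (by omega) (by omega)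
  refine ⟨A, X, Z, hA, hT, by omega, fun j hj => ?_⟩
  have := h2 j hj
  omega

namespace LastUU

variable {P : DyckWord} {A X Z : Path}

theorem count_le (h : LastUU P A X Z) : A.count .D ≤ A.count .U := by
  have := P.count_D_le_count_U A.length
  rw [h.eq] at this
  simpa using this

theorem noUU_X (h : LastUU P A X Z) : NoUU (.U :: X) := by
  have := h.noUU
  rw [← List.cons_append] at this
  exact this.left

/-- The path in which the border strip is removed. -/
theorem exists_deletion (h : LastUU P A X Z) :
    ∃ Q : DyckWord, Q.toList = A ++ .U :: (X ++ .U :: .D :: Z) := by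
  have hP := P.count_D_le_count_U
  have he := P.count_U_eq_count_D
  have hc := h.count_eq
  rw [h.eq] at hP he
  refine ⟨⟨A ++ .U :: (X ++ .U :: .D :: Z), ?_, fun i => ?_⟩, rfl⟩
  · simp at he ⊢
    omega
  · rcases Nat.le_total i A.length with hi | hi
    · have := hP i
      rwa [List.take_append_of_le_length hi] at this ⊢
    · obtain ⟨i, rfl⟩ := Nat.exists_eq_add_of_le hi
      rw [List.take_length_add_append]
      cases i with
      | zero => simpa using h.count_le
      | succ i =>
        rw [List.take_succ_cons]
        rcases Nat.le_total i X.length with hx | hx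
        · have := h.pos i hx
          rw [List.take_append_of_le_length hx]
          simp
          omega
        · obtain ⟨i, rfl⟩ := Nat.exists_eq_add_of_le hx
          rw [List.take_length_add_append]
          match i with
          | 0 => simp; omega
          | 1 => simp; omega
          | i + 2 =>
            have := hP (A.length + (X.length + (i + 1) + 1 + 1))
            rw [List.take_length_add_append, List.take_succ_cons, List.take_succ_cons,
              List.take_length_add_append, List.take_succ_cons] at this
            rw [List.take_succ_cons, List.take_succ_cons]
            simp at this ⊢
            omega

end LastUU

/-! ### The border strip of the zigzag decomposition -/

namespace LastUU

variable {P Q : DyckWord} {A X Z : Path}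

theorem take_add (h : LastUU P A X Z) (i : ℕ) :
    P.toList.take (A.length + 2 + i) = A ++ .U :: .U :: (X ++ .D :: Z).take i := by
  rw [h.eq, Nat.add_assoc, List.take_length_add_append, Nat.add_comm 2]
  rfl

theorem height_add (h : LastUU P A X Z) {j : ℕ} (hj : j ≤ X.length) :
    height P.toList (A.length + 2 + j) + (A.count .D + (X.take j).count .D) =
      A.count .U + 2 + (X.take j).count .U := by
  have := h.pos j hj
  rw [height, h.take_add, List.take_append_of_le_length hj]
  simp
  omega

theorem height_deletion_add (h : LastUU P A X Z) (hQ : Q.toList = A ++ .U :: (X ++ .U :: .D :: Z))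
    {j : ℕ} (hj : j ≤ X.length) :
    height Q.toList (A.length + 1 + j) + (A.count .D + (X.take j).count .D) =
      A.count .U + 1 + (X.take j).count .U := by
  have := h.pos j hj
  have e : Q.toList.take (A.length + 1 + j) = A ++ .U :: X.take j := by
    rw [hQ, Nat.add_assoc, List.take_length_add_append, Nat.add_comm 1, List.take_succ_cons,
      List.take_append_of_le_length hj]
  rw [height, e]
  simp
  omega

theorem height_deletion_of_le (h : LastUU P A X Z)
    (hQ : Q.toList = A ++ .U :: (X ++ .U :: .D :: Z)) {x : ℕ} (hx : x ≤ A.length + 1) :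
    height Q.toList x = height P.toList x := by
  obtain ⟨B, hB⟩ : ∃ B : Path, B = A ++ [.U] := ⟨_, rfl⟩
  have e : ∀ T : Path, A ++ .U :: T = B ++ T := fun T => by simp [hB]
  have hx' : x ≤ B.length := by simpa [hB] using hx
  rw [height, height, hQ, h.eq, e, e, List.take_append_of_le_length hx',
    List.take_append_of_le_length hx']

theorem height_deletion_of_ge (h : LastUU P A X Z)
    (hQ : Q.toList = A ++ .U :: (X ++ .U :: .D :: Z)) (i : ℕ) :
    height Q.toList (A.length + 2 + (X.length + i)) =
      height P.toList (A.length + 2 + (X.length + i)) := by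
  have e : Q.toList.take (A.length + 2 + (X.length + i)) =
      A ++ .U :: (X ++ .U :: (.D :: Z).take i) := by
    rw [hQ, show A.length + 2 + (X.length + i) = A.length + (X.length + (i + 1) + 1) by omega,
      List.take_length_add_append, List.take_succ_cons, List.take_length_add_append,
      List.take_succ_cons]
  rw [height, height, e, h.take_add, List.take_length_add_append]
  simp
  omega

/-- Behind the part `X` the path has no cells. -/
theorem height_le_one (h : LastUU P A X Z) (i : ℕ) :
    height P.toList (A.length + 2 + (X.length + i)) ≤ 1 := by
  have hc := h.count_eq
  cases i with
  | zero =>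
    have := h.height_add (j := X.length) le_rfl
    simp at this ⊢
    omega
  | succ i =>
    obtain ⟨B, hB⟩ : ∃ B : Path, B = A ++ .U :: .U :: (X ++ [.D]) := ⟨_, rfl⟩
    have hl : P.toList = B ++ Z := by simp [hB, h.eq]
    have ht : P.toList.take B.length = B := by rw [hl, List.take_left']; rfl
    have hd : P.toList.drop B.length = Z := by rw [hl, List.drop_left']; rfl
    have hBc : B.count .U = B.count .D := by simp [hB]; omega
    have hZ : NoUU (P.drop B.length (by rw [ht, hBc])).toList := by
      change NoUU (P.toList.drop B.length)
      rw [hd]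
      have := h.noUU
      rw [show DyckStep.U :: (X ++ .D :: Z) = (.U :: (X ++ [.D])) ++ Z by simp] at this
      exact this.right
    have := hZ.height_le_one i
    change height (P.toList.drop B.length) i ≤ 1 at this
    rw [hd, height] at this
    rw [height, h.take_add, List.take_length_add_append, List.take_succ_cons]
    simp
    omega

theorem mem_essentialCells (h : LastUU P A X Z) :
    (A.length + 1, height P.toList (A.length + 1)) ∈ essentialCells P :=
  ⟨by simp, by simp [h.eq], by simp [h.eq], rfl⟩

theorem fst_le (h : LastUU P A X Z) {c : ℕ × ℕ} (hc : c ∈ essentialCells P) :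
    c.1 ≤ A.length + 1 := by
  by_contra hlt
  obtain ⟨-, h2, h3, -⟩ := hc
  obtain ⟨k, hk⟩ : ∃ k, c.1 = A.length + (k + 1 + 1) := ⟨c.1 - A.length - 2, by omega⟩
  rw [hk, h.eq] at h2 h3
  rw [show A.length + (k + 1 + 1) - 1 = A.length + (k + 1) by omega,
    List.getElem?_append_right (by omega), Nat.add_sub_cancel_left, List.getElem?_cons_succ] at h2
  rw [List.getElem?_append_right (by omega), Nat.add_sub_cancel_left,
    List.getElem?_cons_succ] at h3
  obtain ⟨_, h5⟩ := List.getElem?_eq_some_iff.1 h2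
  obtain ⟨h6, h7⟩ := List.getElem?_eq_some_iff.1 h3
  have := List.isChain_iff_getElem.1 h.noUU k h6 h5
  rw [h7] at this
  cases this

theorem getElem_D_of_getElem_U (h : LastUU P A X Z) {j : ℕ} (hj : j < X.length)
    (hU : X[j] = .U) : ∃ k, ∃ hk : k + 1 = j, X[k] = .D := by
  have h1 := List.isChain_iff_getElem.1 h.noUU_X j (by simpa using hj)
  rw [List.getElem_cons_succ, hU] at h1
  cases j with
  | zero => cases h1 rfl
  | succ j =>
    refine ⟨j, rfl, (DyckStep.dichotomy _).resolve_left fun h2 => ?_⟩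
    cases h1 h2

/-- The strip consists of one cell for each down-step of `X`. -/
theorem mem_zigzagStrip_iff (h : LastUU P A X Z) {e : ℕ × ℕ} (he : e.1 = A.length + 1)
    {x y : ℕ} : (x, y) ∈ zigzagStrip P e ↔ ∃ j, ∃ hj : j < X.length, X[j] = .D ∧
      x = A.length + 1 + j ∧ height P.toList (x + 1) = y + 1 := by
  constructor
  · rintro ⟨⟨h1, h2, h3⟩, h4, h5, h6⟩
    simp only at h1 h2 h3 h4 h5 h6
    obtain ⟨j, rfl⟩ : ∃ j, x = A.length + 1 + j := Nat.exists_eq_add_of_le (by omega)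
    have hj : j < X.length := by
      by_contra hc
      have := h.height_le_one (j - X.length)
      rw [show A.length + 2 + (X.length + (j - X.length)) = A.length + 1 + j + 1 by omega] at this
      omega
    refine ⟨j, hj, (DyckStep.dichotomy _).resolve_left fun hU => ?_, rfl, h5⟩
    obtain ⟨k, rfl, hk⟩ := h.getElem_D_of_getElem_U hj hU
    have e1 := h.height_add (j := k) (by omega)
    have e2 := h.height_add (j := k + 1) (by omega)
    have e3 := h.height_add (j := k + 1 + 1) hj
    have t1 : X.take (k + 1) = X.take k ++ [.D] := by rw [← hk]; simp
    have t2 : X.take (k + 1 + 1) = X.take (k + 1) ++ [.U] := by rw [← hU]; simp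
    rw [t2, t1] at e3
    rw [t1] at e2
    simp at e1 e2 e3
    rw [show A.length + 1 + (k + 1) + 1 = A.length + 2 + (k + 1) by omega] at h5
    rw [show A.length + 1 + (k + 1) = A.length + 2 + k by omega,
      show A.length + 2 + k + 2 = A.length + 2 + (k + 1 + 1) by omega] at h6
    omega
  · rintro ⟨j, hj, hD, rfl, h1⟩
    have e2 := h.height_add (j := j) (by omega)
    have e3 := h.height_add (j := j + 1) hj
    have t2 : X.take (j + 1) = X.take j ++ [.D] := by rw [← hD]; simp
    have hp := h.pos (j + 1) hj
    rw [t2] at e3 hp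
    simp at e2 e3 hp
    have cA := count_U_add_count_D A
    have cX := count_take_add_count_take X hj.le
    rw [show A.length + 1 + j + 1 = A.length + 2 + j by omega] at h1
    refine ⟨⟨by simp only; omega, ?_, ?_⟩, by simp only; omega, ?_, Or.inr ?_⟩
    · exact ⟨A.count .U + 1 + (X.take j).count .U, by simp only; omega⟩
    · simp only [show A.length + 1 + j + 1 = A.length + 2 + j by omega]
      omega
    · simp only [show A.length + 1 + j + 1 = A.length + 2 + j by omega]
      omega
    · simp only [show A.length + 1 + j + 2 = A.length + 2 + (j + 1) by omega]
      omega

/-- Moving the last up-step of the pair behind `X` removes exactly the cells of the strip. -/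
theorem cells_deletion (h : LastUU P A X Z) (hQ : Q.toList = A ++ .U :: (X ++ .U :: .D :: Z))
    {e : ℕ × ℕ} (he : e.1 = A.length + 1) : cells Q = cells P \ zigzagStrip P e := by
  ext ⟨x, y⟩
  rw [Set.mem_sdiff, h.mem_zigzagStrip_iff he]
  simp only [cells, Set.mem_ofPred_eq]
  rcases Nat.lt_or_ge x (A.length + 1) with hx | hx
  · rw [h.height_deletion_of_le hQ (by omega)]
    refine (and_iff_left ?_).symm
    rintro ⟨j, hj, -, rfl, -⟩
    omega
  obtain ⟨j, rfl⟩ := Nat.exists_eq_add_of_le hx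
  rcases Nat.lt_or_ge j X.length with hj | hj
  · have e1 := h.height_add (j := j) (by omega)
    have e2 := h.height_deletion_add hQ (j := j + 1) hj
    rw [show A.length + 1 + (j + 1) = A.length + 1 + j + 1 by omega] at e2
    rw [show A.length + 2 + j = A.length + 1 + j + 1 by omega] at e1
    have cA := count_U_add_count_D A
    have cX := count_take_add_count_take X hj.le
    rcases hs : X[j] with _ | _
    · have t2 : X.take (j + 1) = X.take j ++ [.U] := by rw [← hs]; simp
      rw [t2] at e2
      simp at e2
      rw [show height Q.toList (A.length + 1 + j + 1) = height P.toList (A.length + 1 + j + 1)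
        by omega]
      refine (and_iff_left ?_).symm
      rintro ⟨j', hj', hD, hjj, -⟩
      obtain rfl : j' = j := by omega
      rw [hs] at hD
      cases hD
    · have t2 : X.take (j + 1) = X.take j ++ [.D] := by rw [← hs]; simp
      rw [t2] at e2
      simp at e2
      constructor
      · rintro ⟨h1, h2, h3⟩
        refine ⟨⟨h1, h2, by omega⟩, ?_⟩
        rintro ⟨j', hj', hD, hjj, h4⟩
        omega
      · rintro ⟨⟨h1, h2, h3⟩, h4⟩
        have : height P.toList (A.length + 1 + j + 1) ≠ y + 1 := fun h5 =>
          h4 ⟨j, hj, hs, rfl, h5⟩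
        obtain ⟨z, hz⟩ := h2
        exact ⟨h1, ⟨z, hz⟩, by omega⟩
  · obtain ⟨i, rfl⟩ := Nat.exists_eq_add_of_le hj
    rw [show A.length + 1 + (X.length + i) + 1 = A.length + 2 + (X.length + i) by omega,
      h.height_deletion_of_ge hQ]
    refine (and_iff_left ?_).symm
    rintro ⟨j, hj, -, h1, -⟩
    omega

theorem X_ends_with_D (h : LastUU P A X Z) : ∃ Y, X = Y ++ [.D] := by
  have hc := h.count_eq
  have hA := h.count_le
  rcases List.eq_nil_or_concat' X with rfl | ⟨Y, s, rfl⟩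
  · simp at hc
    omega
  · refine ⟨Y, ?_⟩
    cases s with
    | D => rfl
    | U =>
      have := h.pos Y.length (by simp)
      simp at this hc
      omega

theorem exists_count_take_eq (h : LastUU P A X Z) {t : ℕ} (ht : t ≤ X.count .U) :
    ∃ j, ∃ hj : j < X.length, X[j] = .D ∧ (X.take j).count .U = t := by
  have key : ∀ T : Path, NoUU (.U :: T) → ∀ t < T.count .U,
      ∃ j, ∃ hj : j < T.length, T[j] = .D ∧ (T.take j).count .U = t := by
    intro T
    induction T using List.reverseRecOn with
    | nil => simp
    | append_singleton T s ih =>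
      intro hT t ht
      rw [← List.cons_append] at hT
      have step : t < T.count .U → ∃ j, ∃ hj : j < (T ++ [s]).length,
          (T ++ [s])[j] = .D ∧ ((T ++ [s]).take j).count .U = t := by
        intro ht
        obtain ⟨j, hj, h1, h2⟩ := ih hT.left t ht
        refine ⟨j, by simp; omega, by rw [List.getElem_append_left hj, h1], ?_⟩
        rw [List.take_append_of_le_length hj.le, h2]
      cases s with
      | D => exact step (by simpa using ht)
      | U =>
        rcases Nat.lt_or_ge t (T.count .U) with h1 | h1
        · exact step h1
        · have h2 : t = T.count .U := by simp at ht; omega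
          rcases List.eq_nil_or_concat' T with rfl | ⟨T', s', rfl⟩
          · cases (List.isChain_cons_cons.1 hT).1 rfl
          · have hs' : s' = .D := by
              refine s'.dichotomy.resolve_left fun hU => ?_
              rw [hU] at hT
              have := NoUU.right (P := .U :: T') (Q := [.U, .U]) (by simpa using hT)
              cases (List.isChain_cons_cons.1 this).1 rfl
            subst hs'
            exact ⟨T'.length, by simp, by simp, by simp [h2]⟩
  rcases Nat.lt_or_ge t (X.count .U) with h1 | h1
  · exact key X h.noUU_X t h1
  · obtain ⟨Y, rfl⟩ := h.X_ends_with_D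
    exact ⟨Y.length, by simp, by simp, by simp at ht h1 ⊢; omega⟩

/-- The labels of the strip form an interval, with end points counted by the up-steps in `A` and
`X`. -/
theorem image_sumLabel (h : LastUU P A X Z) {e : ℕ × ℕ} (he : e.1 = A.length + 1) :
    sumLabel '' zigzagStrip P e =
      Set.Icc (A.count .U + 1) (A.count .U + 1 + X.count .U) := by
  have key : ∀ j < X.length, ∀ y, height P.toList (A.length + 1 + j + 1) = y + 1 →
      sumLabel (A.length + 1 + j, y) = A.count .U + 1 + (X.take j).count .U := by
    intro j hj y hy
    have e1 := h.height_add (j := j) (by omega)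
    rw [show A.length + 2 + j = A.length + 1 + j + 1 by omega] at e1
    have cA := count_U_add_count_D A
    have cX := count_take_add_count_take X hj.le
    simp only [sumLabel]
    omega
  ext t
  rw [Set.mem_image, Set.mem_Icc]
  constructor
  · rintro ⟨⟨x, y⟩, hc, rfl⟩
    obtain ⟨j, hj, -, rfl, h1⟩ := (h.mem_zigzagStrip_iff he).1 hc
    have := (List.take_sublist j X).count_le .U
    rw [key j hj y h1]
    omega
  · rintro ⟨h1, h2⟩
    obtain ⟨j, hj, hD, h3⟩ := h.exists_count_take_eq (t := t - (A.count .U + 1)) (by omega)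
    have e1 := h.height_add (j := j) (by omega)
    rw [show A.length + 2 + j = A.length + 1 + j + 1 by omega] at e1
    have hp := h.pos j hj.le
    have hy : height P.toList (A.length + 1 + j + 1) =
      height P.toList (A.length + 1 + j + 1) - 1 + 1 := by omega
    refine ⟨(A.length + 1 + j, height P.toList (A.length + 1 + j + 1) - 1),
      (h.mem_zigzagStrip_iff he).2 ⟨j, hj, hD, rfl, hy⟩, ?_⟩
    rw [key j hj _ hy]
    omega

end LastUU

/-! ### Permutations and border strips -/

/-- A permutation whose letters in the positions after `α` up to `b` are right-to-left minima, and
that has the letter `b + 1` as a fixed point separating the smaller letters from the larger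
ones. -/
theorem exists_blocks {w : Word} (hw : IsPerm w) {α b : ℕ} (hαb : α ≤ b) (h1 : ¬ SE w b b)
    (h2 : SE w b (b + 1)) (h3 : ¬ SE w (b + 1) (b + 1))
    (h4 : ∀ k, α ≤ k → k < b → ∃ v, SE w k v ∧ ¬ SE w (k + 1) v) :
    ∃ A B C : Word, w = A ++ B ++ (b + 1) :: C ∧ A.length = α ∧ A.length + B.length = b ∧
      (∀ x ∈ A, x ≤ b) ∧ (∀ x ∈ B, x ≤ b) ∧ (∀ x ∈ C, b + 1 < x) ∧ B.Pairwise (· < ·) := by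
  have hb : b < w.length := by
    by_contra hc
    exact not_SE_of_le (by omega) h2
  have hwb : w[b] = b + 1 := by
    obtain ⟨j, hj, hbj, hjb⟩ := SE_iff_getElem.1 h2
    have hj' : j = b := by
      by_contra hne
      exact h3 (SE_iff_getElem.2 ⟨j, hj, by omega, hjb⟩)
    subst hj'
    refine le_antisymm hjb ?_
    by_contra hc
    exact h1 (SE_iff_getElem.2 ⟨j, hj, le_rfl, by omega⟩)
  have hsmall : ∀ x ∈ w.take b, x ≤ b := by
    have hsub : List.range' 1 b ⊆ w.take b := by
      intro x hx
      have hx' : 1 ≤ x ∧ x ≤ b := by simp at hx; omega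
      have hxw : x ∈ w.take b ++ w.drop b := by
        rw [List.take_append_drop]
        exact hw.mem.2 ⟨hx'.1, by omega⟩
      rcases List.mem_append.1 hxw with h | h
      · exact h
      · exact absurd ⟨x, h, hx'.2⟩ h1
    have hperm : (List.range' 1 b).Perm (w.take b) :=
      ((List.subperm_of_subset List.nodup_range' hsub)).perm_of_length_le (by simp)
    intro x hx
    have := hperm.mem_iff.2 hx
    simp at this
    omega
  have hsplit : w = w.take α ++ (w.drop α).take (b - α) ++ (b + 1) :: w.drop (b + 1) := by
    have hd : (b + 1) :: w.drop (b + 1) = w.drop b := by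
      rw [← List.getElem_cons_drop hb, hwb]
    rw [hd, ← List.take_add, Nat.add_sub_cancel' hαb,
      List.take_append_drop]
  have htake : w.take b = w.take α ++ (w.drop α).take (b - α) := by
    rw [← List.take_add, Nat.add_sub_cancel' hαb]
  refine ⟨_, _, _, hsplit, by simp; omega, by simp; omega, fun x hx => hsmall x ?_,
    fun x hx => hsmall x ?_, fun x hx => ?_, ?_⟩
  · rw [htake]
    exact List.mem_append_left _ hx
  · rw [htake]
    exact List.mem_append_right _ hx
  · by_contra hc
    exact h3 ⟨x, hx, by omega⟩
  · rw [List.pairwise_iff_getElem]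
    intro i j hi hj hij
    simp only [List.length_take, List.length_drop] at hi hj
    simp only [List.getElem_take, List.getElem_drop]
    obtain ⟨v, hv, hv'⟩ := h4 (α + i) (by omega) (by omega)
    obtain ⟨l, hl, h5, h6⟩ := SE_iff_getElem.1 hv
    have hl' : l = α + i := by
      by_contra hne
      exact hv' (SE_iff_getElem.2 ⟨l, hl, by omega, h6⟩)
    subst hl'
    refine h6.trans_lt ?_
    by_contra hc
    exact hv' (SE_iff_getElem.2 ⟨α + j, by omega, by omega, by omega⟩)

theorem sublist_of_cons_sublist_append {x : ℕ} {l L M : Word} (hx : x ∉ L)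
    (h : (x :: l).Sublist (L ++ M)) : (x :: l).Sublist M := by
  obtain ⟨l₁, l₂, e, s1, s2⟩ := List.sublist_append_iff.1 h
  cases l₁ with
  | nil =>
    rw [List.nil_append] at e
    rwa [e]
  | cons u l₁ =>
    obtain ⟨rfl, -⟩ := List.cons.inj e
    exact absurd (s1.subset (by simp)) hx

/-- Moving the letter `m` to the left across an increasing word of smaller letters creates no
occurrence of 321. -/
theorem avoids_321_of_move {A B C : Word} {m : ℕ} (hA : ∀ x ∈ A, x < m) (hB : ∀ x ∈ B, x < m)
    (hC : ∀ x ∈ C, m < x) (hinc : B.Pairwise (· < ·)) (h : Avoids [3, 2, 1] (A ++ B ++ m :: C)) :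
    Avoids [3, 2, 1] (A ++ m :: (B ++ C)) := by
  rw [avoids_iff_321] at h ⊢
  intro x y z hs hyx hzy
  have fA : ∀ q : ℕ → Bool, (∀ x, x < m → q x = true) → A.filter q = A := fun q hq =>
    List.filter_eq_self.2 fun x hx => hq x (hA x hx)
  have fB : ∀ q : ℕ → Bool, (∀ x, x < m → q x = true) → B.filter q = B := fun q hq =>
    List.filter_eq_self.2 fun x hx => hq x (hB x hx)
  rcases lt_trichotomy x m with hxm | rfl | hxm
  · have h1 := hs.filter (fun u => decide (u ≠ m))
    refine h x y z (List.Sublist.trans ?_ (?_ : (A ++ (B ++ C)).Sublist _)) hyx hzy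
    · have e1 : (A ++ m :: (B ++ C)).filter (fun u => decide (u ≠ m)) = A ++ (B ++ C) := by
        have fC : C.filter (fun u => decide (u ≠ m)) = C :=
          List.filter_eq_self.2 fun x hx => by have := hC x hx; simp; omega
        rw [List.filter_append, fA _ (fun x hx => by simp; omega), List.filter_cons_of_neg (by simp),
          List.filter_append, fB _ (fun x hx => by simp; omega), fC]
      have e2 : [x, y, z].filter (fun u => decide (u ≠ m)) = [x, y, z] := by
        rw [List.filter_eq_self]
        intro u hu
        simp at hu
        simp
        omega
      rwa [e1, e2] at h1
    · rw [List.append_assoc]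
      exact ((List.sublist_cons_self m C).append_left B).append_left A
  · -- the letters after the moved one that are smaller form the increasing word `B`
    have h1 := hs.filter (fun u => decide (u ≤ x))
    have e1 : (A ++ x :: (B ++ C)).filter (fun u => decide (u ≤ x)) = A ++ x :: B := by
      have fC : C.filter (fun u => decide (u ≤ x)) = [] :=
        List.filter_eq_nil_iff.2 fun u hu => by have := hC u hu; simp; omega
      rw [List.filter_append, fA _ (fun u hu => by simp; omega), List.filter_cons_of_pos (by simp),
        List.filter_append, fB _ (fun u hu => by simp; omega), fC, List.append_nil]
    have e2 : [x, y, z].filter (fun u => decide (u ≤ x)) = [x, y, z] := by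
      rw [List.filter_eq_self]
      intro u hu
      simp at hu
      simp
      omega
    rw [e1, e2] at h1
    have h2 : [y, z].Sublist B := by
      have hx : x ∉ A := fun hx => lt_irrefl _ (hA x hx)
      exact List.cons_sublist_cons.1 (sublist_of_cons_sublist_append hx h1)
    have := hinc.sublist h2
    simp at this
    omega
  · have hx : x ∉ A ++ m :: B := by
      intro hx
      simp only [List.mem_append, List.mem_cons] at hx
      rcases hx with h1 | h1 | h1
      · exact absurd (hA x h1) (by omega)
      · omega
      · exact absurd (hB x h1) (by omega)
    rw [show A ++ m :: (B ++ C) = (A ++ m :: B) ++ C by simp] at hs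
    refine h x y z ((sublist_of_cons_sublist_append hx hs).trans ?_) hyx hzy
    exact (List.sublist_cons_self m C).trans (List.sublist_append_right _ _)

/-- Each up-step that is followed by another one later on forms a peak with a down-step. -/
theorem exists_precedes_of_noUU {Y : Path} (h : NoUU Y) {k : ℕ} (hk : k + 1 < Y.count .U) :
    ∃ v, Precedes Y k v ∧ ¬ Precedes Y (k + 1) v := by
  induction Y generalizing k with
  | nil => simp at hk
  | cons s Y ih =>
    have hY : NoUU Y := NoUU.right (P := [s]) h
    cases s with
    | D =>
      obtain ⟨v, h1, h2⟩ := ih hY (by simpa using hk)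
      exact ⟨v + 1, by simpa [Precedes] using h1, by simpa [Precedes] using h2⟩
    | U =>
      cases k with
      | zero =>
        refine ⟨0, Or.inl rfl, ?_⟩
        cases Y with
        | nil => simp at hk
        | cons t Y =>
          cases (List.isChain_cons_cons.1 h).1 rfl
          simp [Precedes]
      | succ k =>
        obtain ⟨v, h1, h2⟩ := ih hY (by simpa using hk)
        exact ⟨v, by simpa [Precedes] using h1, by simpa [Precedes] using h2⟩

namespace LastUU

variable {P Q : DyckWord} {A X Z : Path}

theorem precedes_of_le (h : LastUU P A X Z) (hQ : Q.toList = A ++ .U :: (X ++ .U :: .D :: Z))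
    {k v : ℕ} (hk : k ≤ A.count .U) : Precedes P.toList k v ↔ Precedes Q.toList k v := by
  rw [h.eq, hQ, precedes_append, precedes_append]
  refine or_congr_right (and_congr_right fun h1 => and_congr_right fun _ => ?_)
  rw [show k - A.count .U = 0 by omega]
  simp [Precedes]

theorem precedes_succ (h : LastUU P A X Z) (hQ : Q.toList = A ++ .U :: (X ++ .U :: .D :: Z))
    {k v : ℕ} (h1 : A.count .U ≤ k) (h2 : k ≤ A.count .U + X.count .U) :
    Precedes P.toList (k + 1) v ↔ Precedes Q.toList k v := by
  obtain ⟨k, rfl⟩ := Nat.exists_eq_add_of_le h1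
  rw [h.eq, hQ, precedes_append, precedes_append]
  refine or_congr (iff_of_false (not_precedes_of_le (by omega)) (not_precedes_of_le h1)) ?_
  refine and_congr (iff_of_true (by omega) h1) (and_congr_right fun _ => ?_)
  rw [show A.count .U + k + 1 - A.count .U = k + 1 by omega, Nat.add_sub_cancel_left]
  cases k with
  | zero => simp [Precedes]
  | succ k =>
    simp only [Precedes, Nat.add_one_ne_zero, Nat.add_sub_cancel, false_or]
    rw [precedes_append, precedes_append]
    refine or_congr_right (iff_of_false ?_ ?_) <;> rintro ⟨h3, -⟩ <;> omega

theorem precedes_of_gt (h : LastUU P A X Z) (hQ : Q.toList = A ++ .U :: (X ++ .U :: .D :: Z))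
    {k v : ℕ} (hk : A.count .U + 1 + X.count .U < k) :
    Precedes P.toList k v ↔ Precedes Q.toList k v := by
  obtain ⟨k, rfl⟩ := Nat.exists_eq_add_of_lt hk
  rw [h.eq, hQ, precedes_append, precedes_append]
  refine or_congr_right (and_congr_right fun _ => and_congr_right fun _ => ?_)
  rw [show A.count .U + 1 + X.count .U + k + 1 - A.count .U = X.count .U + k + 1 + 1 by omega]
  simp only [Precedes, Nat.add_one_ne_zero, Nat.add_sub_cancel, false_or]
  rw [precedes_append, precedes_append]
  refine or_congr (iff_of_false (not_precedes_of_le (by omega)) (not_precedes_of_le (by omega))) ?_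
  refine and_congr (iff_of_true (by omega) (by omega)) (and_congr_right fun _ => ?_)
  rw [show X.count .U + k + 1 - X.count .U = k + 1 by omega, Nat.add_sub_cancel_left]
  simp [Precedes]

/-- Undoing the deletion of a strip in the path amounts to applying the run of the strip to the
permutation. -/
theorem fits_foldl (h : LastUU P A X Z) (hQ : Q.toList = A ++ .U :: (X ++ .U :: .D :: Z))
    {w : Word} (hw : Fits w Q) (hav : Avoids [3, 2, 1] w) :
    (run (A.count .U + 1 + X.count .U) (A.count .U + 1)).foldl swapAt w ∈ Av [3, 2, 1] ∧
      Fits ((run (A.count .U + 1 + X.count .U) (A.count .U + 1)).foldl swapAt w) P := by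
  have hc := h.count_eq
  have hA := h.count_le
  obtain ⟨b, hb⟩ : ∃ b, b = A.count .U + 1 + X.count .U := ⟨_, rfl⟩
  have hQ' : Q.toList = (A ++ .U :: X) ++ .U :: .D :: Z := by simp [hQ]
  have cU : (A ++ .U :: X).count .U = b := by simp; omega
  have cD : (A ++ .U :: X).count .D = b := by simp; omega
  obtain ⟨A', B, C, rfl, l1, l2, bA, bB, bC, hinc⟩ := exists_blocks hw.isPerm
    (α := A.count .U) (b := b) (by omega)
    (by
      rw [show b = b - 1 + 1 by omega, hw.iff, hQ', precedes_append, cU, cD]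
      rintro (h1 | ⟨-, h1, -⟩)
      · exact not_precedes_of_le (by omega) h1
      · omega)
    (by
      rw [hw.iff, hQ', precedes_append, cU, cD]
      exact Or.inr ⟨le_rfl, le_rfl, Or.inl (by omega)⟩)
    (by
      rw [hw.iff, hQ', precedes_append, cU, cD]
      rintro (h1 | ⟨-, -, h1⟩)
      · exact not_precedes_of_le (by omega) h1
      · simp [Precedes] at h1)
    (by
      intro k h1 h2
      obtain ⟨k, rfl⟩ := Nat.exists_eq_add_of_le h1
      obtain ⟨W, hW⟩ := h.X_ends_with_D
      have hY : NoUU (.U :: X ++ [.U]) := by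
        have := h.noUU_X
        rw [hW] at this ⊢
        unfold NoUU at this ⊢
        rw [List.isChain_append]
        exact ⟨this, List.IsChain.singleton _, by
          rw [← List.cons_append, List.getLast?_concat]
          simp⟩
      obtain ⟨v, h3, h4⟩ := exists_precedes_of_noUU hY (k := k) (by simp; omega)
      have hQ2 : Q.toList = A ++ ((.U :: X ++ [.U]) ++ .D :: Z) := by simp [hQ]
      refine ⟨A.count .D + v + 1, ?_, ?_⟩
      · rw [hw.iff, hQ2, precedes_append, precedes_append]
        refine Or.inr ⟨by omega, by omega, Or.inl ?_⟩
        rwa [Nat.add_sub_cancel_left, Nat.add_sub_cancel_left]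
      · rw [hw.iff, hQ2, precedes_append, precedes_append, Nat.add_sub_cancel_left,
          show A.count .U + k + 1 - A.count .U = k + 1 by omega]
        rintro (h5 | ⟨-, -, h5 | ⟨h5, -⟩⟩)
        · exact not_precedes_of_le (by omega) h5
        · exact h4 h5
        · simp at h5
          omega)
  have hrun := foldl_swapAt_run A' B C (b + 1) (A.count .U + 1) b (by omega) l2
  rw [← hb, hrun]
  have hperm : (A' ++ (b + 1) :: (B ++ C)).Perm (A' ++ B ++ (b + 1) :: C) := by
    rw [List.append_assoc]
    exact (List.perm_middle.symm).append_left A'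
  have hlen := hperm.length_eq
  have hP : IsPerm (A' ++ (b + 1) :: (B ++ C)) := by
    unfold IsPerm
    rw [hlen]
    exact hperm.trans hw.isPerm
  have hsl : P.semilength = Q.semilength := by
    rw [DyckWord.semilength, DyckWord.semilength, h.eq, hQ]
    simp
    omega
  refine ⟨⟨hP, avoids_321_of_move (fun x hx => Nat.lt_succ_of_le (bA x hx))
    (fun x hx => Nat.lt_succ_of_le (bB x hx)) bC hinc hav⟩, hP, by
      rw [hlen, hw.length_eq, hsl], fun k v => ?_⟩
  rcases Nat.lt_or_ge (A.count .U) k with h1 | h1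
  · rcases Nat.lt_or_ge b k with h2 | h2
    · rw [h.precedes_of_gt hQ (by omega), ← hw.iff]
      obtain ⟨j, rfl⟩ := Nat.exists_eq_add_of_lt h2
      have e1 : (A' ++ (b + 1) :: (B ++ C)).drop (b + j + 1) = C.drop j := by
        rw [show A' ++ (b + 1) :: (B ++ C) = (A' ++ (b + 1) :: B) ++ C by simp,
          show b + j + 1 = (A' ++ (b + 1) :: B).length + j by simp; omega, List.drop_length_add_append]
      have e2 : (A' ++ B ++ (b + 1) :: C).drop (b + j + 1) = C.drop j := by
        rw [show A' ++ B ++ (b + 1) :: C = (A' ++ B ++ [b + 1]) ++ C by simp,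
          show b + j + 1 = (A' ++ B ++ [b + 1]).length + j by simp; omega,
          List.drop_length_add_append]
      unfold SE
      rw [e1, e2]
    · obtain ⟨j, rfl⟩ := Nat.exists_eq_add_of_lt h1
      rw [h.precedes_succ hQ (by omega) (by omega), ← hw.iff]
      have e1 : (A' ++ (b + 1) :: (B ++ C)).drop (A.count .U + j + 1) = B.drop j ++ C := by
        rw [Nat.add_assoc, ← l1, List.drop_length_add_append, List.drop_succ_cons,
          List.drop_append_of_le_length (by omega)]
      have e2 : (A' ++ B ++ (b + 1) :: C).drop (A.count .U + j) = B.drop j ++ (b + 1) :: C := by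
        rw [List.append_assoc, ← l1, List.drop_length_add_append,
          List.drop_append_of_le_length (by omega)]
      unfold SE
      rw [e1, e2]
      constructor
      · rintro ⟨u, hu, huv⟩
        refine ⟨u, ?_, huv⟩
        simp only [List.mem_append, List.mem_cons] at hu ⊢
        tauto
      · rintro ⟨u, hu, huv⟩
        simp only [List.mem_append, List.mem_cons] at hu
        rcases hu with hu | rfl | hu
        · exact ⟨u, List.mem_append_left _ hu, huv⟩
        · -- a letter of `B` to the right of the position is smaller than `b + 1`
          obtain ⟨x, hx⟩ := List.exists_mem_of_ne_nil (B.drop j) (by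
            rw [← List.length_pos_iff, List.length_drop]
            omega)
          have := bB x (List.mem_of_mem_drop hx)
          exact ⟨x, List.mem_append_left _ hx, by omega⟩
        · exact ⟨u, List.mem_append_right _ hu, huv⟩
  · rw [h.precedes_of_le hQ h1, ← hw.iff]
    have e : ∀ T : Word, (A' ++ T).drop k = A'.drop k ++ T := fun T =>
      List.drop_append_of_le_length (by omega)
    unfold SE
    rw [List.append_assoc, e, e]
    refine exists_congr fun u => and_congr_left fun _ => ?_
    simp only [List.mem_append, List.mem_cons]
    tauto

end LastUU

/-! ### The zigzag decomposition -/

/-- The number of pairs of an up-step and a later down-step. It decreases when a border strip is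
deleted. -/
def pairCount : Path → ℕ
  | [] => 0
  | .U :: L => L.count .D + pairCount L
  | .D :: L => pairCount L

theorem pairCount_append (L M : Path) :
    pairCount (L ++ M) = pairCount L + pairCount M + L.count .U * M.count .D := by
  induction L with
  | nil => simp [pairCount]
  | cons s L ih =>
    cases s with
    | U => simp [pairCount, ih, Nat.add_mul]; omega
    | D => simp [pairCount, ih]

theorem LastUU.pairCount_lt {P Q : DyckWord} {A X Z : Path} (h : LastUU P A X Z)
    (hQ : Q.toList = A ++ .U :: (X ++ .U :: .D :: Z)) :
    pairCount Q.toList < pairCount P.toList := by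
  have hc := h.count_eq
  have hA := h.count_le
  rw [hQ, h.eq]
  simp [pairCount_append, pairCount]
  simp only [Nat.mul_add]
  omega

theorem exists_zigzag (P : DyckWord) : ∃ σ, Zigzag P σ := by
  generalize hn : pairCount P.toList = n
  induction n using Nat.strong_induction_on generalizing P with
  | _ n ih =>
    by_cases hP : NoUU P.toList
    · exact ⟨_, .nil (essentialCells_eq_empty_iff.2 hP)⟩
    · obtain ⟨A, X, Z, h⟩ := exists_lastUU hP
      obtain ⟨Q, hQ⟩ := h.exists_deletion
      obtain ⟨σ, hσ⟩ := ih _ (hn ▸ h.pairCount_lt hQ) Q rfl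
      exact ⟨_, .strip h.mem_essentialCells (fun c hc => h.fst_le hc)
        (by rw [DyckWord.semilength, DyckWord.semilength, h.eq, hQ]; simp; omega)
        (h.cells_deletion hQ rfl) (by omega) (h.image_sumLabel rfl) hσ⟩

/-- The permutation of a zigzag decomposition of `P` avoids 321, and its right-to-left minima are
given by the peaks of `P`. -/
theorem zigzag_spec {P : DyckWord} {σ : List (List ℕ)} (h : Zigzag P σ) :
    fromRuns P.semilength σ ∈ Av [3, 2, 1] ∧ Fits (fromRuns P.semilength σ) P := by
  induction h with
  | @nil P hP =>
    have hf := fits_range'_of_noUU (essentialCells_eq_empty_iff.1 hP)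
    refine ⟨⟨hf.isPerm, avoids_iff_321.2 fun x y z hs hyx hzy => ?_⟩, hf⟩
    have := (List.pairwise_lt_range' (s := 1) (n := P.semilength)).sublist hs
    simp at this
    omega
  | @strip P Q e a b σ he hm hl hc hab hI _ ih =>
    have hP : ¬ NoUU P.toList := fun hP => by
      rw [essentialCells_eq_empty_iff.2 hP] at he
      exact he
    obtain ⟨A, X, Z, h⟩ := exists_lastUU hP
    obtain ⟨R, hR⟩ := h.exists_deletion
    have he1 : e.1 = A.length + 1 := le_antisymm (h.fst_le he) (hm _ h.mem_essentialCells)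
    have hRl : R.semilength = P.semilength := by
      rw [DyckWord.semilength, DyckWord.semilength, h.eq, hR]
      simp
      omega
    obtain rfl : Q = R := eq_of_cells_eq (hl.trans hRl.symm) (by rw [hc, h.cells_deletion hR he1])
    rw [h.image_sumLabel he1] at hI
    have ha := (Set.Icc_eq_Icc_iff (by omega)).1 hI
    obtain ⟨rfl, rfl⟩ : a = A.count .U + 1 ∧ b = A.count .U + 1 + X.count .U :=
      ⟨ha.1.symm, ha.2.symm⟩
    have := h.fits_foldl hR ih.2 ih.1.2
    rw [fromRuns, hl] at this
    rwa [fromRuns, List.flatten_append, List.foldl_append, List.flatten_singleton]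

/-! ### Soundness of formal consequences -/

/-- All ten relations are relations between permutations. -/
def RelatePerms : Prop := ∀ B π σ, PermBij.graph B π σ → IsPerm π ∧ IsPerm σ

theorem Holds.symm {x y : Composite} (h : Holds x y) : Holds y x := fun π σ => (h π σ).symm

theorem Holds.trans {x y z : Composite} (h : Holds x y) (h' : Holds y z) : Holds x z :=
  fun π σ => (h π σ).trans (h' π σ)

theorem Composite.isPerm_of_graph (hB : RelatePerms) {x : Composite} {π σ : Word}
    (h : x.graph π σ) : IsPerm π ∧ IsPerm σ := by
  obtain ⟨h1, ρ, rfl, h2⟩ := h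
  refine ⟨h1, IsPerm.act ?_ _⟩
  split_ifs at h2
  · exact (hB _ _ _ h2).1
  · exact (hB _ _ _ h2).2

theorem Composite.graph_comp (x : Composite) (u v : List PermBij.Sym) (π σ : Word) :
    (x.comp u v).graph π σ ↔ IsPerm π ∧ ∃ τ, x.graph (act v π) τ ∧ σ = act u τ := by
  unfold Composite.graph Composite.comp
  simp only [act_append]
  constructor
  · rintro ⟨h1, ρ, rfl, h2⟩
    exact ⟨h1, _, ⟨h1.act v, ρ, rfl, h2⟩, rfl⟩
  · rintro ⟨h1, _, ⟨-, ρ, rfl, h2⟩, rfl⟩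
    exact ⟨h1, ρ, rfl, h2⟩

theorem Composite.graph_inverse_of_graph (hB : RelatePerms) {x : Composite} {π σ : Word}
    (h : x.graph π σ) : x.inverse.graph σ π := by
  have hp := x.isPerm_of_graph hB h
  obtain ⟨h1, ρ, rfl, h2⟩ := h
  refine ⟨hp.2, act x.right π, (act_reverse_act h1 _).symm, ?_⟩
  have hρ : IsPerm ρ := by
    split_ifs at h2
    · exact (hB _ _ _ h2).1
    · exact (hB _ _ _ h2).2
  simp only [Composite.inverse, act_reverse_act hρ]
  cases hb : x.inverted <;> simpa [hb] using h2

theorem Composite.inverse_inverse (x : Composite) : x.inverse.inverse = x := by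
  simp [Composite.inverse]

theorem Composite.graph_inverse (hB : RelatePerms) {x : Composite} {π σ : Word} :
    x.inverse.graph σ π ↔ x.graph π σ :=
  ⟨fun h => by simpa [Composite.inverse_inverse] using Composite.graph_inverse_of_graph hB h,
    Composite.graph_inverse_of_graph hB⟩

theorem Holds.inverse (hB : RelatePerms) {x y : Composite} (h : Holds x y) :
    Holds x.inverse y.inverse := fun π σ => by
  rw [Composite.graph_inverse hB, Composite.graph_inverse hB]
  exact h σ π

theorem Holds.comp {x y : Composite} (h : Holds x y) (u v : List PermBij.Sym) :
    Holds (x.comp u v) (y.comp u v) := fun π σ => by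
  rw [Composite.graph_comp, Composite.graph_comp]
  exact and_congr_right fun _ => exists_congr fun τ => and_congr_left fun _ => h _ τ

theorem holds_of_act_eq (hB : RelatePerms) {s s₁ t t₁ : List PermBij.Sym} (B : Bij) (b : Bool)
    (ht : ∀ w, IsPerm w → act t w = act t₁ w) (hs : ∀ w, IsPerm w → act s w = act s₁ w) :
    Holds ⟨t, B, b, s⟩ ⟨t₁, B, b, s₁⟩ := fun π σ => by
  unfold Composite.graph
  refine and_congr_right fun hπ => exists_congr fun ρ => ?_
  simp only [hs π hπ]
  refine and_congr_left fun h => ?_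
  rw [ht ρ ?_]
  split_ifs at h
  · exact (hB _ _ _ h).1
  · exact (hB _ _ _ h).2

/-- Every formal consequence of valid relations is valid. -/
theorem Follows.holds (hB : RelatePerms) {R : Composite → Composite → Prop}
    (hR : ∀ x y, R x y → Holds x y) {x y : Composite} (h : Follows R x y) : Holds x y := by
  induction h with
  | of h => exact hR _ _ h
  | refl => exact fun _ _ => Iff.rfl
  | symm _ ih => exact ih.symm
  | trans _ _ ih₁ ih₂ => exact ih₁.trans ih₂
  | comp u v _ ih => exact ih.comp u v
  | inverse _ ih => exact ih.inverse hB
  | trivial B b h₁ h₂ => exact holds_of_act_eq hB B b h₁ h₂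

/-! ### Reduction to five bijections -/

/-- One bijection from each class of bijections that are related by the main relations. -/
def rep : Fin 5 → Bij
  | 0 => .SimionSchmidt
  | 1 => .Knuth
  | 2 => .KnuthRotem
  | 3 => .West
  | 4 => .ElizaldeDeutsch

/-- If some composite of `B` is formally equal to one of `B'`, then so is every composite of `B`. -/
theorem Follows.transfer {R : Composite → Composite → Prop} {t₀ s₀ t₁ s₁ : List PermBij.Sym}
    {B B' : Bij} {b b' : Bool} (h : Follows R ⟨t₀, B, b, s₀⟩ ⟨t₁, B', b', s₁⟩)
    (t s : List PermBij.Sym) (c : Bool) :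
    ∃ t' c' s', Follows R ⟨t, B, c, s⟩ ⟨t', B', c', s'⟩ := by
  have key : ∀ {t₀ s₀ t₁ s₁ : List PermBij.Sym} {b b' : Bool},
      Follows R ⟨t₀, B, b, s₀⟩ ⟨t₁, B', b', s₁⟩ →
      ∃ t' c' s', Follows R ⟨t, B, b, s⟩ ⟨t', B', c', s'⟩ := by
    intro t₀ s₀ t₁ s₁ b b' h
    refine ⟨_, _, _, Follows.trans (Follows.trivial B b ?_ ?_)
      (h.comp (t ++ t₀.reverse) (s₀.reverse ++ s))⟩
    · intro w hw
      rw [act_append, act_append, act_reverse_act hw]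
    · intro w hw
      rw [act_append, act_append, act_act_reverse (hw.act s)]
  rcases eq_or_ne c b with rfl | hc
  · exact key h
  · have : c = !b := by revert hc; cases c <;> cases b <;> simp
    subst this
    exact key h.inverse

theorem exists_follows_rep {R : Composite → Composite → Prop}
    (hR : ∀ x y, MainRelation x y → R x y) (x : Composite) :
    ∃ k t b s, Follows R x ⟨t, rep k, b, s⟩ := by
  obtain ⟨t, B, b, s⟩ := x
  have hPS : Follows R _ _ := .of (hR _ _ .simionSchmidt)
  have via : ∀ {B' : Bij} {t₀ s₀ t₁ s₁ : List PermBij.Sym} {b₀ b₁ : Bool} (k : Fin 5),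
      rep k = B' → Follows R ⟨t₀, B, b₀, s₀⟩ ⟨t₁, B', b₁, s₁⟩ →
      ∃ k t' b' s', Follows R ⟨t, B, b, s⟩ ⟨t', rep k, b', s'⟩ := by
    rintro B' t₀ s₀ t₁ s₁ b₀ b₁ k rfl h
    exact ⟨k, h.transfer t s b⟩
  cases B with
  | Phi => exact via 0 rfl hPS
  | Knuth => exact ⟨1, t, b, s, .refl _⟩
  | KnuthRotem => exact ⟨2, t, b, s, .refl _⟩
  | SimionSchmidt => exact ⟨0, t, b, s, .refl _⟩
  | KnuthRichards => exact via 0 rfl ((Follows.of (hR _ _ .knuthRichards)).symm.trans hPS)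
  | West => exact ⟨3, t, b, s, .refl _⟩
  | Krattenthaler => exact via 0 rfl ((Follows.of (hR _ _ .krattenthaler)).symm.trans hPS)
  | Reifegerste => exact via 2 rfl (Follows.of (hR _ _ .reifegerste))
  | ElizaldeDeutsch => exact ⟨4, t, b, s, .refl _⟩
  | MansourDengDu => exact via 0 rfl ((Follows.of (hR _ _ .mansourDengDu)).symm.trans hPS)

/-- The normal form `rᵃ cᵇ iᵉ` of a trivial bijection. -/
def normalForm (a b e : Bool) : List PermBij.Sym :=
  (if a then [.r] else []) ++ (if b then [.c] else []) ++ (if e then [.i] else [])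

/-- The trivial bijections form a dihedral group of order eight, with `i r = c i`. -/
theorem exists_normalForm (s : List PermBij.Sym) :
    ∃ a b e, ∀ w, IsPerm w → act s w = act (normalForm a b e) w := by
  induction s with
  | nil => exact ⟨false, false, false, fun _ _ => rfl⟩
  | cons x s ih =>
    obtain ⟨a, b, e, h⟩ := ih
    have hc : ∀ w, act (x :: s) w = x.act (act s w) := fun _ => rfl
    cases x with
    | r =>
      refine ⟨!a, b, e, fun w hw => ?_⟩
      rw [hc, h w hw]
      cases a <;> cases b <;> cases e <;> simp [normalForm, act, Sym.act]
    | c =>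
      refine ⟨a, !b, e, fun w hw => ?_⟩
      rw [hc, h w hw]
      cases a <;> cases b <;> cases e <;>
        simp [normalForm, act, Sym.act, reverse_complement, complement_complement, hw, hw.inverse]
    | i =>
      refine ⟨b, a, !e, fun w hw => ?_⟩
      rw [hc, h w hw]
      cases a <;> cases b <;> cases e <;>
        simp [normalForm, act, Sym.act, reverse_complement, inverse_reverse, inverse_complement,
          inverse_inverse, hw, hw.inverse, hw.complement, hw.inverse.complement]

/-! ### Separating the five bijections -/

instance (p w : Word) : Decidable (w ∈ Av p) :=
  inferInstanceAs (Decidable (IsPerm w ∧ Avoids p w))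

instance (k : Fin 5) (π σ : Word) : Decidable (PermBij.graph (rep k) π σ) :=
  match k with
  | 0 => inferInstanceAs (Decidable (π ∈ Av [1, 2, 3] ∧ σ = simionSchmidt π))
  | 1 => inferInstanceAs (Decidable (π ∈ Av [3, 2, 1] ∧ σ ∈ Av [1, 3, 2] ∧
      knuthPath π = reflect (stdPath σ)))
  | 2 => inferInstanceAs (Decidable (π ∈ Av [3, 2, 1] ∧ σ ∈ Av [1, 3, 2] ∧
      rotemPath π = stdPath σ))
  | 3 => inferInstanceAs (Decidable (π ∈ Av [1, 2, 3] ∧ σ ∈ Av [1, 3, 2] ∧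
      signature [1, 2, 3] π = signature [1, 3, 2] σ))
  | 4 => inferInstanceAs (Decidable (π ∈ Av [3, 2, 1] ∧ σ ∈ Av [1, 3, 2] ∧
      elizaldeDeutschPsi (reflect (stdPath σ)) = diagonalPath π))

/-- Pairs of related permutations that tell `rep k` from all other composites of the five
bijections. -/
def witnesses : Fin 5 → List (Word × Word)
  | 0 => [([2, 4, 3, 1], [2, 3, 4, 1]), ([2, 1, 3], [2, 1, 3])]
  | 1 => [([2, 1, 3, 4], [4, 2, 3, 1]), ([2, 3, 1, 4], [3, 2, 4, 1]),
      ([3, 4, 1, 2], [3, 4, 1, 2])]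
  | 2 => [([3, 1, 2, 4], [3, 4, 2, 1]), ([2, 4, 1, 3], [4, 2, 1, 3])]
  | 3 => [([3, 4, 1, 2], [3, 1, 2, 4]), ([3, 2, 4, 1], [3, 2, 4, 1])]
  | 4 => [([2, 1, 3, 4], [4, 2, 3, 1]), ([2, 3, 1, 4], [4, 2, 1, 3]),
      ([2, 3, 4, 1], [3, 4, 1, 2])]

theorem graph_of_mem_witnesses :
    ∀ k, ∀ p ∈ witnesses k, PermBij.graph (rep k) p.1 p.2 ∧ IsPerm p.1 := by
  decide +kernel

/-- The composites of `rep k` that have the same domain and range as `rep k` and are equal to it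
trivially or by its self-symmetry. -/
def SelfForm (k : Fin 5) (t s : Bool × Bool × Bool) : Prop :=
  (t = (false, false, false) ∧ s = (false, false, false)) ∨
  (t = (false, false, true) ∧ ((k = 0 ∧ s = (false, false, true)) ∨
    (k = 1 ∧ s = (false, false, true)) ∨ (k = 2 ∧ s = (true, true, true))))

instance (k : Fin 5) (t s : Bool × Bool × Bool) : Decidable (SelfForm k t s) := by
  unfold SelfForm; infer_instance

/-- For every composite `t ∘ rep k' ∘ s` or `t ∘ (rep k')⁻¹ ∘ s`, with `t` and `s` in normal form,
that is not one of the exceptional ones, some witness of `rep k` does not belong to its graph.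
This is a finite verification with permutations of lengths three and four. -/
theorem separation : ∀ k k' : Fin 5, ∀ b : Bool, ∀ t s : Bool × Bool × Bool,
    (k = k' ∧ b = false ∧ SelfForm k t s) ∨
    ∃ p ∈ witnesses k,
      ¬ (if b then PermBij.graph (rep k') (act (normalForm t.1 t.2.1 t.2.2).reverse p.2)
            (act (normalForm s.1 s.2.1 s.2.2) p.1)
        else PermBij.graph (rep k') (act (normalForm s.1 s.2.1 s.2.2) p.1)
            (act (normalForm t.1 t.2.1 t.2.2).reverse p.2)) := by
  decide +kernel

/-! ### Completeness of the main relations -/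

/-- The relations from which all others follow. -/
def BaseRelation (p q : Composite) : Prop :=
  MainRelation p q ∨ (SelfRelation p q ∧ Holds p q)

theorem BaseRelation.of_main {x y : Composite} (h : MainRelation x y) : BaseRelation x y :=
  Or.inl h

theorem follows_of_holds_selfForm (hB : RelatePerms) {k : Fin 5} {t s : Bool × Bool × Bool}
    (hts : SelfForm k t s)
    (h : Holds ⟨[], rep k, false, []⟩
      ⟨normalForm t.1 t.2.1 t.2.2, rep k, false, normalForm s.1 s.2.1 s.2.2⟩) :
    Follows BaseRelation ⟨[], rep k, false, []⟩
      ⟨normalForm t.1 t.2.1 t.2.2, rep k, false, normalForm s.1 s.2.1 s.2.2⟩ := by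
  rcases hts with ⟨rfl, rfl⟩ | ⟨rfl, ⟨rfl, rfl⟩ | ⟨rfl, rfl⟩ | ⟨rfl, rfl⟩⟩
  · exact .refl _
  · exact .of (Or.inr ⟨.simionSchmidt, h⟩)
  · exact .of (Or.inr ⟨.knuth, h⟩)
  · have hs : ∀ w, IsPerm w → act (normalForm true true true) w = act [.i, .r, .c] w := by
      intro w hw
      simp [normalForm, act, Sym.act, inverse_reverse, inverse_complement, reverse_complement,
        hw, hw.complement]
    have e : Follows BaseRelation ⟨[.i], .KnuthRotem, false, [.i, .r, .c]⟩
        ⟨[.i], .KnuthRotem, false, normalForm true true true⟩ :=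
      .trivial _ _ (fun _ _ => rfl) fun w hw => (hs w hw).symm
    refine Follows.trans (.of (Or.inr ⟨.knuthRotem, ?_⟩)) e
    exact h.trans (holds_of_act_eq hB _ _ (fun _ _ => rfl) hs)

theorem follows_of_holds_rep_left (hB : RelatePerms) {k k' : Fin 5} {t s : List PermBij.Sym}
    {b : Bool} (h : Holds ⟨[], rep k, false, []⟩ ⟨t, rep k', b, s⟩) :
    Follows BaseRelation ⟨[], rep k, false, []⟩ ⟨t, rep k', b, s⟩ := by
  obtain ⟨a₁, a₂, a₃, ht⟩ := exists_normalForm t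
  obtain ⟨b₁, b₂, b₃, hs⟩ := exists_normalForm s
  have h' := h.trans (holds_of_act_eq hB (rep k') b ht hs)
  refine Follows.trans ?_ (Follows.trivial (rep k') b ht hs).symm
  rcases separation k k' b (a₁, a₂, a₃) (b₁, b₂, b₃) with ⟨rfl, rfl, hts⟩ | ⟨p, hp, hn⟩
  · exact follows_of_holds_selfForm hB hts h'
  · exfalso
    refine hn ?_
    obtain ⟨hg, hp1⟩ := graph_of_mem_witnesses k p hp
    obtain ⟨-, ρ, hρ, hg'⟩ := (h' p.1 p.2).1 ⟨hp1, p.2, rfl, by simpa [act] using hg⟩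
    have hρ' : act (normalForm a₁ a₂ a₃).reverse p.2 = ρ := by
      rw [hρ]
      refine act_reverse_act ?_ _
      split_ifs at hg'
      · exact (hB _ _ _ hg').1
      · exact (hB _ _ _ hg').2
    simpa only [hρ'] using hg'

theorem follows_of_holds_rep (hB : RelatePerms) {k k' : Fin 5} {t s t' s' : List PermBij.Sym}
    {b b' : Bool} (h : Holds ⟨t, rep k, b, s⟩ ⟨t', rep k', b', s'⟩) :
    Follows BaseRelation ⟨t, rep k, b, s⟩ ⟨t', rep k', b', s'⟩ := by
  have key : ∀ {t s t' s' : List PermBij.Sym} {b' : Bool},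
      Holds ⟨t, rep k, false, s⟩ ⟨t', rep k', b', s'⟩ →
      Follows BaseRelation ⟨t, rep k, false, s⟩ ⟨t', rep k', b', s'⟩ := by
    intro t s t' s' b' h
    have h0 : Holds ⟨[], rep k, false, []⟩
        ⟨t.reverse ++ t', rep k', b', s' ++ s.reverse⟩ := by
      refine (holds_of_act_eq hB _ _ ?_ ?_).symm.trans (h.comp t.reverse s.reverse)
      · intro w hw
        rw [act_append, act_reverse_act hw]; rfl
      · intro w hw
        rw [act_append, act_act_reverse hw]; rfl
    have h1 := (follows_of_holds_rep_left hB h0).comp t s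
    have h2 : Follows BaseRelation
        (Composite.comp t ⟨t.reverse ++ t', rep k', b', s' ++ s.reverse⟩ s)
        ⟨t', rep k', b', s'⟩ := by
      refine .trivial _ _ ?_ ?_
      · intro w hw
        rw [act_append, act_append, act_act_reverse (hw.act t')]
      · intro w hw
        rw [act_append, act_append, act_reverse_act hw]
    have h3 := h1.trans h2
    simpa [Composite.comp] using h3
  cases b with
  | false => exact key h
  | true =>
    have := (key (h.inverse hB)).inverse
    simpa [Composite.inverse] using this

/-- Once the main relations are known to hold, every relation that holds follows formally. -/
theorem follows_of_holds (hB : RelatePerms) (hM : ∀ x y, MainRelation x y → Holds x y)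
    {x y : Composite} (h : Holds x y) : Follows BaseRelation x y := by
  have hR : ∀ x y, BaseRelation x y → Holds x y := fun x y h => h.elim (hM x y) And.right
  obtain ⟨k, t, b, s, hx⟩ := exists_follows_rep (fun _ _ => BaseRelation.of_main) x
  obtain ⟨k', t', b', s', hy⟩ := exists_follows_rep (fun _ _ => BaseRelation.of_main) y
  exact hx.trans ((follows_of_holds_rep hB
    (((hx.holds hB hR).symm.trans h).trans (hy.holds hB hR))).trans hy.symm)

/-! ### The bijection of Mansour, Deng and Du -/

theorem exists_dyckWord_stdPathAux (k : ℕ) (w : Word) :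
    ∃ P : DyckWord, P.toList = stdPathAux k w := by
  induction k generalizing w with
  | zero => exact ⟨0, rfl⟩
  | succ k ih =>
    cases w with
    | nil => exact ⟨0, rfl⟩
    | cons a v =>
      obtain ⟨P, hP⟩ := ih ((a :: v).takeWhile (· ≠ (a :: v).foldr max 0))
      obtain ⟨Q, hQ⟩ := ih ((a :: v).dropWhile (· ≠ (a :: v).foldr max 0)).tail
      refine ⟨P.nest + Q, ?_⟩
      simp only [stdPathAux, toList_add, toList_nest, hP, hQ]
      simp

/-- The two permutations of a Dyck path have the same right-to-left minima. -/
theorem sameMinima_of_fits {P : DyckWord} {π ρ : Word} (hπ : Fits π P) (hρ : Fits ρ P)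
    (h1 : π ∈ Av [3, 2, 1]) (h2 : ρ ∈ Av [2, 3, 1]) :
    SameMinima π (PermBij.inverse ρ.reverse) := by
  have hl : π.length = ρ.length := by rw [hπ.length_eq, hρ.length_eq]
  refine ⟨h1, inverse_mem_Av_132 (reverse_mem_Av_132.2 h2), by simp [hl], fun i v => ?_⟩
  rw [NE_inverse hρ.isPerm.reverse, NE_reverse, NE_reverse, hl]
  cases v with
  | zero => exact iff_of_false (hπ.isPerm.not_SE_zero _) (hρ.isPerm.not_SE_zero _)
  | succ v => rw [hπ.iff, hρ.iff]

theorem SameMinima.exists_fits {π σ : Word} (h : SameMinima π σ) : ∃ P : DyckWord, Fits π P := by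
  obtain ⟨P, hP⟩ := exists_dyckWord_stdPathAux σ.length σ
  have hP' : P.toList = heightPath σ := hP.trans (stdPath_eq_heightPath h.2.1)
  obtain ⟨s1, s2, s3⟩ := heightPath_spec h.2.1
  have hl := h.2.2.1
  have hsl : P.semilength = σ.length := by rw [DyckWord.semilength, hP', s2]
  refine ⟨P, Fits.of_box h.1.1 (by rw [hsl, hl]) fun k v hk hv => ?_⟩
  rw [hP', s3 k v (by omega) (by omega), ← h.2.2.2, NE_reverse, hl, Nat.sub_sub_self (by omega)]

theorem mansourDengDu_spec {P : DyckWord} {zs ts : List (List ℕ)} (hz : Zigzag P zs)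
    (ht : Trapezoidal 0 0 P ts) :
    Fits (fromRuns P.semilength zs) P ∧ fromRuns P.semilength zs ∈ Av [3, 2, 1] ∧
      Fits (fromRuns P.semilength ts) P ∧ fromRuns P.semilength ts ∈ Av [2, 3, 1] := by
  obtain ⟨z1, z2⟩ := zigzag_spec hz
  obtain ⟨t, t1, t2, t3⟩ := trapezoidal_spec ht le_rfl (by simp)
  have e : fromRuns P.semilength ts = t := by
    have := t3 [] [] 0 rfl
    simpa [fromRuns] using this
  rw [e]
  exact ⟨z2, z1, t2, t1⟩

theorem holds_mansourDengDu_iff (π σ : Word) :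
    Composite.graph ⟨[.i, .r], .MansourDengDu, false, []⟩ π σ ↔ SameMinima π σ := by
  constructor
  · rintro ⟨-, ρ, rfl, P, zs, ts, hz, ht, e, rfl⟩
    obtain rfl : π = _ := e
    obtain ⟨h1, h2, h3, h4⟩ := mansourDengDu_spec hz ht
    exact sameMinima_of_fits h1 h3 h2 h4
  · intro h
    obtain ⟨P, hP⟩ := h.exists_fits
    obtain ⟨zs, hz⟩ := exists_zigzag P
    obtain ⟨ts, ht⟩ := exists_trapezoidal P 0 0
    obtain ⟨h1, h2, h3, h4⟩ := mansourDengDu_spec hz ht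
    have e : π = fromRuns P.semilength zs :=
      (h.left_unique (sameMinima_of_fits hP h3 h.1 h4 |>.right_unique h ▸
        sameMinima_of_fits h1 h3 h2 h4))
    exact ⟨h.1.1, _, h.right_unique (sameMinima_of_fits hP h3 h.1 h4), P, zs, ts, hz, ht, e, rfl⟩

/-! ### The relations between the ten bijections -/

theorem relatePerms : RelatePerms := by
  intro B π σ h
  cases B with
  | Phi => exact ⟨(phiGraph_spec h).1.1, (phiGraph_spec h).2.1.1⟩
  | Knuth => exact ⟨h.1.1, h.2.1.1⟩
  | KnuthRotem => exact ⟨h.1.1, h.2.1.1⟩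
  | SimionSchmidt =>
    obtain ⟨h1, rfl⟩ := h
    exact ⟨h1.1, (simionSchmidt_spec h1.1).1.1⟩
  | KnuthRichards =>
    obtain ⟨h1, rfl⟩ := h
    exact ⟨h1.1, (richards_spec h1).1.1⟩
  | West => exact ⟨h.1.1, h.2.1.1⟩
  | Krattenthaler => exact ⟨h.1.1, h.2.1.1⟩
  | Reifegerste =>
    obtain ⟨h1, rfl⟩ := h
    exact ⟨h1.1, (reifegerste_spec h1.1).1.1⟩
  | ElizaldeDeutsch => exact ⟨h.1.1, h.2.1.1⟩
  | MansourDengDu =>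
    obtain ⟨P, zs, ts, hz, ht, rfl, rfl⟩ := h
    obtain ⟨h1, -, h3, -⟩ := mansourDengDu_spec hz ht
    exact ⟨h1.isPerm, h3.isPerm⟩

theorem MainRelation.holds {x y : Composite} (h : MainRelation x y) : Holds x y := by
  cases h with
  | simionSchmidt => exact fun π σ => (holds_phi_iff π σ).trans (holds_simionSchmidt_iff π σ).symm
  | krattenthaler => exact fun π σ => (holds_phi_iff π σ).trans (holds_krattenthaler_iff π σ).symm
  | mansourDengDu => exact fun π σ => (holds_phi_iff π σ).trans (holds_mansourDengDu_iff π σ).symm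
  | knuthRichards => exact fun π σ => (holds_phi_iff π σ).trans (holds_knuthRichards_iff π σ).symm
  | reifegerste => exact holds_reifegerste

end PermBij

open PermBij
theorem theorem2 :
    (∀ x y : PermBij.Composite, PermBij.MainRelation x y → PermBij.Holds x y) ∧
    (∀ x y : PermBij.Composite, PermBij.Holds x y →
      PermBij.Follows
        (fun p q => PermBij.MainRelation p q ∨ (PermBij.SelfRelation p q ∧ PermBij.Holds p q))
        x y) :=
  ⟨fun _ _ h => h.holds, fun _ _ h => follows_of_holds relatePerms (fun _ _ h => h.holds) h⟩
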